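/- **Theorem (weak–strong uniqueness for the Landau–Lifshitz equation).** Consider, for maps with values in $\mathbb{R}^3$, the equation $$\partial_t m + m\wedge\partial_t m = 2\, m\wedge\Delta m \qquad (1)$$ on $\mathbb{R}^3$. Let $m_0\in L^\infty(\mathbb{R}^3;\mathbb{R}^3)$ be smooth ($C^\infty$) with $|m_0|=1$ almost everywhere and $\nabla m_0\in L^2(\mathbb{R}^3;\mathbb{R}^9)$. Assume the following. * $m_2:(0,\infty)\times\mathbb{R}^3\to\mathbb{R}^3$ is a global weak solution of (1) with initial value $m_0$. That is, $|m_2|=1$ almost everywhere; $m_2$ has weak derivatives with $\nabla m_2\in L^\infty((0,T);L^2(\mathbb{R}^3;\mathbb{R}^9))$ and $\partial_t m_2\in L^2((0,T)\times\mathbb{R}^3;\mathbb{R}^3)$ for all $T>0$; $m_2$ has trace $m_0$ at $t=0$; and for every $\Psi\in H^1((0,\infty)\times\mathbb{R}^3;\mathbb{R}^3)$ and every $T>0$, $$\int_0^T\!\!\int_{\mathbb{R}^3}(\partial_t m_2+m_2\wedge\partial_t m_2)\cdot\Psi\,dx\,dt=-2\sum_{i=1}^3\int_0^T\!\!\int_{\mathbb{R}^3}(m_2\wedge\partial_i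 m_2)\cdot\partial_i\Psi\,dx\,dt .$$ Moreover $m_2$ satisfies the energy inequality: for almost every $T\ge 0$, $$\int_{\mathbb{R}^3}|\nabla m_2(T,x)|^2\,dx+\int_0^T\!\!\int_{\mathbb{R}^3}|\partial_t m_2|^2\,dx\,dt\le\int_{\mathbb{R}^3}|\nabla m_0|^2\,dx .$$ * $T>0$ and $m_1$ is a smooth solution of (1) up to time $T$ with the same initial data $m_0$. That is, $m_1\in C^\infty([0,T)\times\mathbb{R}^3;\mathbb{R}^3)$, its space-time derivatives of orders $1$, $2$ and $3$ are bounded on $(0,T')\times\mathbb{R}^3$ for every $T'<T$, $m_1$ satisfies (1) pointwise on $(0,T)\times\mathbb{R}^3$, and $m_1(0,\cdot)=m_0$. Then $m_2=m_1$ almost everywhere on $(0,T)\times\mathbb{R}^3$. -/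

import Mathlib

open MeasureTheory Set
open scoped ContDiff

noncomputable section

namespace LandauLifshitz

/-- The Euclidean space `ℝ³`; it serves both as physical space and as the space of values. -/
abbrev E3 : Type := EuclideanSpace ℝ (Fin 3)

/-- The vector product `u ∧ v` of `ℝ³`. -/
def wedge (u v : E3) : E3 := WithLp.toLp 2 (crossProduct u.ofLp v.ofLp)

/-- The `i`-th vector of the canonical basis of `ℝ³`. -/
def basisVec (i : Fin 3) : E3 := EuclideanSpace.single i (1 : ℝ)

/-- The time direction in `ℝ × ℝ³`. -/
def timeDir : ℝ × E3 := ((1 : ℝ), (0 : E3))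

/-- The `i`-th space direction in `ℝ × ℝ³`. -/
def spaceDir (i : Fin 3) : ℝ × E3 := ((0 : ℝ), basisVec i)

/-- The space-time domain `(0,∞) × ℝ³`. -/
def halfSpace : Set (ℝ × E3) := Ioi (0 : ℝ) ×ˢ univ

/-- The space-time slab `(0,T) × ℝ³`. -/
def slab (T : ℝ) : Set (ℝ × E3) := Ioo (0 : ℝ) T ×ˢ univ

/-- `g` is the weak derivative of `f` on `(0,∞) × ℝ³` in the direction `v`. -/
def IsWeakDeriv (v : ℝ × E3) (f g : ℝ × E3 → E3) : Prop :=
  LocallyIntegrableOn f halfSpace ∧ LocallyIntegrableOn g halfSpace ∧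
    ∀ φ : ℝ × E3 → ℝ, ContDiff ℝ ∞ φ → HasCompactSupport φ → tsupport φ ⊆ halfSpace →
      ∫ z in halfSpace, (fderiv ℝ φ z v) • f z = - ∫ z in halfSpace, φ z • g z

/-- `Ψ ∈ H¹((0,∞) × ℝ³; ℝ³)`, with weak time derivative `Ψt` and weak space derivatives
`Ψx i`. -/
structure IsH1 (Ψ Ψt : ℝ × E3 → E3) (Ψx : Fin 3 → ℝ × E3 → E3) : Prop where
  weak_dt : IsWeakDeriv timeDir Ψ Ψt
  weak_dx : ∀ i, IsWeakDeriv (spaceDir i) Ψ (Ψx i)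
  memLp : MemLp Ψ 2 (volume.restrict halfSpace)
  memLp_dt : MemLp Ψt 2 (volume.restrict halfSpace)
  memLp_dx : ∀ i, MemLp (Ψx i) 2 (volume.restrict halfSpace)

/-- `m₀` is the trace at time `0` of `m : (0,∞) × ℝ³ → ℝ³`, whose weak time derivative is `mt`:
Green's formula in time holds for test functions that need not vanish at time `0`. -/
def HasInitialTrace (m mt : ℝ × E3 → E3) (m₀ : E3 → E3) : Prop :=
  ∀ φ : ℝ × E3 → ℝ, ContDiff ℝ ∞ φ → HasCompactSupport φ →
    ∫ z in halfSpace, (fderiv ℝ φ z timeDir) • m z =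
      - (∫ z in halfSpace, φ z • mt z) - ∫ x : E3, φ ((0 : ℝ), x) • m₀ x

/-- `m` is a global weak solution on `(0,∞) × ℝ³` of
`∂ₜm + m ∧ ∂ₜm = 2 m ∧ Δm = 2 ∑ᵢ ∂ᵢ (m ∧ ∂ᵢm)`, with initial value `m₀`;
`mt` and `mx i` are its weak derivatives `∂ₜm` and `∂ᵢm`. -/
structure IsGlobalWeakSolution (m₀ : E3 → E3) (m mt : ℝ × E3 → E3)
    (mx : Fin 3 → ℝ × E3 → E3) : Prop where
  weak_dt : IsWeakDeriv timeDir m mt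
  weak_dx : ∀ i, IsWeakDeriv (spaceDir i) m (mx i)
  /-- `|m| = 1` almost everywhere. -/
  norm_eq_one : ∀ᵐ z ∂(volume.restrict halfSpace), ‖m z‖ = 1
  /-- `∂ₜm ∈ L²((0,T) × ℝ³)` for every `T`. -/
  memLp_dt : ∀ T : ℝ, 0 < T → MemLp mt 2 (volume.restrict (slab T))
  /-- `∇m ∈ L^∞((0,T); L²(ℝ³))` for every `T`. -/
  bound_dx : ∀ T : ℝ, 0 < T → ∃ C : NNReal, ∀ᵐ t ∂(volume.restrict (Ioo (0 : ℝ) T)),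
    ∫⁻ x : E3, ∑ i, ‖mx i (t, x)‖ₑ ^ 2 ≤ C
  /-- The weak formulation, against every `Ψ ∈ H¹((0,∞) × ℝ³; ℝ³)`. -/
  weak_eq : ∀ (Ψ Ψt : ℝ × E3 → E3) (Ψx : Fin 3 → ℝ × E3 → E3), IsH1 Ψ Ψt Ψx →
    ∀ T : ℝ, 0 < T →
      ∫ z in slab T, inner ℝ (mt z + wedge (m z) (mt z)) (Ψ z) =
        - 2 * ∑ i, ∫ z in slab T, inner ℝ (wedge (m z) (mx i z)) (Ψx i z)
  /-- The initial value is `m₀`, in the sense of traces. -/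
  initial : HasInitialTrace m mt m₀

/-- The energy inequality: for almost every `T ≥ 0`,
`∫ |∇m(T)|² dx + ∫₀ᵀ ∫ |∂ₜm|² dx dt ≤ ∫ |∇m₀|² dx`. -/
def EnergyInequality (m₀ : E3 → E3) (mt : ℝ × E3 → E3) (mx : Fin 3 → ℝ × E3 → E3) : Prop :=
  ∀ᵐ T ∂(volume.restrict (Ici (0 : ℝ))),
    (∫⁻ x : E3, ∑ i, ‖mx i (T, x)‖ₑ ^ 2)
        + ∫⁻ t in Ioo (0 : ℝ) T, ∫⁻ x : E3, ‖mt (t, x)‖ₑ ^ 2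
      ≤ ∫⁻ x : E3, ∑ i, ‖fderiv ℝ m₀ x (basisVec i)‖ₑ ^ 2

/-- `m` is a smooth solution of `∂ₜm + m ∧ ∂ₜm = 2 m ∧ Δm` up to time `T`, with initial value
`m₀`: it is `C^∞` on `[0,T) × ℝ³`, with space-time derivatives of order `1`, `2`, `3` bounded on
`(0,T') × ℝ³` for every `T' < T`, and it satisfies the equation pointwise. -/
structure IsSmoothSolution (T : ℝ) (m₀ : E3 → E3) (m : ℝ × E3 → E3) : Prop where
  smooth : ContDiffOn ℝ ∞ m (Ico (0 : ℝ) T ×ˢ univ)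
  bounded : ∀ T' : ℝ, T' < T → ∀ k ∈ Finset.Icc 1 3, ∃ C : ℝ, ∀ z ∈ slab T',
    ‖iteratedFDeriv ℝ k m z‖ ≤ C
  equation : ∀ t ∈ Ioo (0 : ℝ) T, ∀ x : E3,
    deriv (fun s => m (s, x)) t + wedge (m (t, x)) (deriv (fun s => m (s, x)) t) =
      (2 : ℝ) • wedge (m (t, x)) (Laplacian.laplacian (fun y => m (t, y)) x)
  initial : ∀ x : E3, m (0, x) = m₀ x

end LandauLifshitz

end

/-! The proof is a relative energy argument. Write `u` for the smooth solution, `v` for the weak one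
and w = v - u, and expand ∫|∇w|² = ∫|∇v|² + ∫|∇u|² - 2∫∇u·∇v. The first term is bounded by the
energy inequality and the second is given by the energy identity of smooth solutions. The third
varies in time by ∫∫(∇∂ₜu·∇v - Δu·∂ₜv), which involves only first derivatives of `v`
(`integral_slice_inner_eq`, `integral_cutoff_cross`).

The term ∇∂ₜu·∇v is removed by testing the weak formulation with v∧∂ₜu. Since |v| = 1 and v·∂v = 0,
this amounts to testing ∂ₜv - v∧∂ₜv = 2Δv + 2|∇v|²v with ∂ₜu (`weak_eq_wedge`). The same form of the
equation for `u` replaces Δu. By the orthogonality relations u·∂ₜu = v·∂ₜv = 0 all linear terms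
cancel: what is left is -|∂ₜw|² plus terms at least quadratic in w, ∂ₜw, ∇w, with coefficients
bounded by the derivatives of `u` (`stability_density_le`). Half of |∂ₜw|² absorbs the products
|w||∂ₜw|. The other half controls w itself, because w vanishes at time 0 and hence ∫|w(t)|² ≤
t∫∫|∂ₜw|² (`integral_slice_sub_le`). Gronwall's lemma then concludes.

Since `u` is not assumed to have finite energy, everything is localized by a cutoff χ at scale R.
This produces two errors: boundary terms of size 1/R times squared derivatives on a ball of radius
2R, and the defect ∫(1-χ)|∇m₀|² of the energy inequality, which is not local. Both tend to 0 once
the energy of `u` on cylinders is bounded uniformly in R. That bound is bootstrapped from the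
pointwise bounds through the localized energy identity (`exists_bound_cylinder`).

Two facts about weak solutions are needed on the way. A weak derivative of a sphere-valued map is
orthogonal to it (`IsWeakDeriv.inner_eq_zero`, by mollification). The trace condition means that v
is `m₀` plus the time primitive of its weak derivative (`HasInitialTrace.ae_eq_primitive`). -/

noncomputable section

/-! ### Calculus on the closed half space, up to the initial time. -/

namespace LandauLifshitz

/-- The closed space-time domain `[0,∞) × ℝ³`. -/
def closedHalfSpace : Set (ℝ × E3) := Ici (0 : ℝ) ×ˢ univ

/-- The derivative in the direction `v` of a function on `[0,∞) × ℝ³`. -/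
def dirDeriv {F : Type*} [NormedAddCommGroup F] [NormedSpace ℝ F] (v : ℝ × E3)
    (f : ℝ × E3 → F) (z : ℝ × E3) : F :=
  fderivWithin ℝ f closedHalfSpace z v

theorem uniqueDiffOn_closedHalfSpace : UniqueDiffOn ℝ closedHalfSpace :=
  (uniqueDiffOn_Ici 0).prod uniqueDiffOn_univ

theorem isOpen_halfSpace : IsOpen halfSpace := isOpen_Ioi.prod isOpen_univ

theorem measurableSet_halfSpace : MeasurableSet halfSpace := isOpen_halfSpace.measurableSet

theorem measurableSet_slab (S : ℝ) : MeasurableSet (slab S) :=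
  measurableSet_Ioo.prod MeasurableSet.univ

theorem halfSpace_subset_closedHalfSpace : halfSpace ⊆ closedHalfSpace :=
  prod_mono Ioi_subset_Ici_self subset_rfl

theorem slab_subset_halfSpace (S : ℝ) : slab S ⊆ halfSpace :=
  prod_mono Ioo_subset_Ioi_self subset_rfl

theorem closedHalfSpace_mem_nhds {z : ℝ × E3} (hz : z ∈ halfSpace) :
    closedHalfSpace ∈ nhds z :=
  Filter.mem_of_superset (isOpen_halfSpace.mem_nhds hz) halfSpace_subset_closedHalfSpace

theorem mem_closedHalfSpace {t : ℝ} {x : E3} : (t, x) ∈ closedHalfSpace ↔ 0 ≤ t := by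
  simp [closedHalfSpace]

theorem mem_halfSpace {t : ℝ} {x : E3} : (t, x) ∈ halfSpace ↔ 0 < t := by
  simp [halfSpace]

theorem mem_slab {S t : ℝ} {x : E3} : (t, x) ∈ slab S ↔ 0 < t ∧ t < S := by
  simp [slab]

theorem continuousOn_time {F : Type*} [TopologicalSpace F] {f : ℝ × E3 → F} (hf : ContinuousOn f closedHalfSpace) (x : E3) :
    ContinuousOn (fun s => f (s, x)) (Ici 0) :=
  hf.comp (by fun_prop) fun s hs => mem_closedHalfSpace.2 hs

variable {F : Type*} [NormedAddCommGroup F] [NormedSpace ℝ F]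

theorem _root_.ContDiffOn.dirDeriv {f : ℝ × E3 → F} (hf : ContDiffOn ℝ ∞ f closedHalfSpace)
    (v : ℝ × E3) : ContDiffOn ℝ ∞ (dirDeriv v f) closedHalfSpace := by
  have h : ContDiffOn ℝ ∞ (fderivWithin ℝ f closedHalfSpace) closedHalfSpace :=
    hf.fderivWithin uniqueDiffOn_closedHalfSpace (by simp)
  exact h.clm_apply contDiffOn_const

theorem dirDeriv_eq_fderiv {f : ℝ × E3 → F} {z : ℝ × E3} (hz : z ∈ halfSpace) (v : ℝ × E3) :
    dirDeriv v f z = fderiv ℝ f z v := by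
  rw [dirDeriv, fderivWithin_of_mem_nhds (closedHalfSpace_mem_nhds hz)]

theorem _root_.ContDiffOn.contDiffAt_halfSpace {f : ℝ × E3 → F}
    (hf : ContDiffOn ℝ ∞ f closedHalfSpace) {z : ℝ × E3} (hz : z ∈ halfSpace) :
    ContDiffAt ℝ ∞ f z :=
  hf.contDiffAt (closedHalfSpace_mem_nhds hz)

theorem hasDerivAt_time {f : ℝ × E3 → F} (hf : ContDiffOn ℝ ∞ f closedHalfSpace)
    {t : ℝ} (ht : 0 < t) (x : E3) :
    HasDerivAt (fun s => f (s, x)) (dirDeriv timeDir f (t, x)) t := by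
  have hz : (t, x) ∈ halfSpace := mem_halfSpace.2 ht
  rw [dirDeriv_eq_fderiv hz]
  have h1 : HasFDerivAt f (fderiv ℝ f (t, x)) (t, x) :=
    ((hf.contDiffAt_halfSpace hz).differentiableAt (by simp)).hasFDerivAt
  have h2 : HasDerivAt (fun s : ℝ => (s, x)) timeDir t :=
    (hasDerivAt_id t).prodMk (hasDerivAt_const t x)
  exact h1.comp_hasDerivAt t h2

theorem hasFDerivAt_space {f : ℝ × E3 → F} (hf : ContDiffOn ℝ ∞ f closedHalfSpace)
    {t : ℝ} (ht : 0 ≤ t) (x : E3) :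
    HasFDerivAt (fun y => f (t, y))
      ((fderivWithin ℝ f closedHalfSpace (t, x)).comp (ContinuousLinearMap.inr ℝ ℝ E3)) x := by
  have h1 : HasFDerivWithinAt f (fderivWithin ℝ f closedHalfSpace (t, x)) closedHalfSpace (t, x) :=
    ((hf.differentiableOn (by simp)) _ (mem_closedHalfSpace.2 ht)).hasFDerivWithinAt
  have h2 : HasFDerivWithinAt (fun y : E3 => (t, y)) (ContinuousLinearMap.inr ℝ ℝ E3) univ x :=
    (hasFDerivAt_prodMk_right t x).hasFDerivWithinAt
  rw [← hasFDerivWithinAt_univ]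
  exact h1.comp x h2 fun y _ => mem_closedHalfSpace.2 ht

theorem fderiv_space_apply {f : ℝ × E3 → F} (hf : ContDiffOn ℝ ∞ f closedHalfSpace)
    {t : ℝ} (ht : 0 ≤ t) (x : E3) (i : Fin 3) :
    fderiv ℝ (fun y => f (t, y)) x (basisVec i) = dirDeriv (spaceDir i) f (t, x) := by
  rw [(hasFDerivAt_space hf ht x).fderiv]
  simp [dirDeriv, spaceDir]

theorem contDiff_space {f : ℝ × E3 → F} (hf : ContDiffOn ℝ ∞ f closedHalfSpace)
    {t : ℝ} (ht : 0 ≤ t) : ContDiff ℝ ∞ (fun y => f (t, y)) := by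
  rw [← contDiffOn_univ]
  exact hf.comp (by fun_prop) fun y _ => mem_closedHalfSpace.2 ht

/-- In the open half space both sides are values of the second Fréchet derivative, which is
symmetric. -/
theorem dirDeriv_comm {f : ℝ × E3 → F} (hf : ContDiffOn ℝ ∞ f closedHalfSpace)
    (v w : ℝ × E3) {z : ℝ × E3} (hz : z ∈ halfSpace) :
    dirDeriv v (dirDeriv w f) z = dirDeriv w (dirDeriv v f) z := by
  have key : ∀ v w : ℝ × E3, dirDeriv v (dirDeriv w f) z = fderiv ℝ (fderiv ℝ f) z v w := by
    intro v w
    rw [dirDeriv_eq_fderiv hz]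
    have h1 : dirDeriv w f =ᶠ[nhds z] fun y => fderiv ℝ f y w := by
      filter_upwards [isOpen_halfSpace.mem_nhds hz] with y hy using dirDeriv_eq_fderiv hy w
    have h2 : DifferentiableAt ℝ (fderiv ℝ f) z :=
      ((hf.contDiffAt_halfSpace hz).fderiv_right (m := ∞) (by simp)).differentiableAt (by simp)
    rw [h1.fderiv_eq, fderiv_clm_apply h2 (by fun_prop)]
    simp
  rw [key, key]
  exact ((hf.contDiffAt_halfSpace hz).isSymmSndFDerivAt
    (by rw [minSmoothness_of_isRCLikeNormedField]; exact WithTop.coe_le_coe.2 le_top)).eq v w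

theorem dirDeriv_smul {a : ℝ × E3 → ℝ} {f : ℝ × E3 → F}
    (ha : ContDiffOn ℝ ∞ a closedHalfSpace) (hf : ContDiffOn ℝ ∞ f closedHalfSpace)
    (v : ℝ × E3) {z : ℝ × E3} (hz : z ∈ closedHalfSpace) :
    dirDeriv v (fun y => a y • f y) z = a z • dirDeriv v f z + dirDeriv v a z • f z := by
  rw [dirDeriv, fderivWithin_fun_smul (uniqueDiffOn_closedHalfSpace z hz)
    (ha.differentiableOn (by simp) z hz) (hf.differentiableOn (by simp) z hz)]
  simp [dirDeriv]

theorem contDiffOn_spatial {χ : E3 → ℝ} (hχ : ContDiff ℝ ∞ χ) :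
    ContDiffOn ℝ ∞ (fun z : ℝ × E3 => χ z.2) closedHalfSpace :=
  (hχ.comp contDiff_snd).contDiffOn

theorem dirDeriv_spatial {χ : E3 → ℝ} (hχ : ContDiff ℝ ∞ χ) (v : ℝ × E3) {z : ℝ × E3}
    (hz : z ∈ closedHalfSpace) :
    dirDeriv v (fun z : ℝ × E3 => χ z.2) z = fderiv ℝ χ z.2 v.2 := by
  have h : HasFDerivAt (fun z : ℝ × E3 => χ z.2)
      ((fderiv ℝ χ z.2).comp (ContinuousLinearMap.snd ℝ ℝ E3)) z :=
    ((hχ.differentiable (by simp)) z.2).hasFDerivAt.comp z hasFDerivAt_snd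
  rw [dirDeriv, h.hasFDerivWithinAt.fderivWithin (uniqueDiffOn_closedHalfSpace z hz)]
  simp

theorem dirDeriv_eq_zero_of_eventuallyEq {f : ℝ × E3 → F} {z : ℝ × E3}
    (h : f =ᶠ[nhdsWithin z closedHalfSpace] 0) (hz : z ∈ closedHalfSpace) (v : ℝ × E3) :
    dirDeriv v f z = 0 := by
  rw [dirDeriv, h.fderivWithin_eq (h.self_of_nhdsWithin hz)]
  simp

theorem dirDeriv_inner {f g : ℝ × E3 → E3} (hf : ContDiffOn ℝ ∞ f closedHalfSpace)
    (hg : ContDiffOn ℝ ∞ g closedHalfSpace) (v : ℝ × E3) {z : ℝ × E3} (hz : z ∈ closedHalfSpace) :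
    dirDeriv v (fun y => inner ℝ (f y) (g y)) z =
      inner ℝ (f z) (dirDeriv v g z) + inner ℝ (dirDeriv v f z) (g z) := by
  have h := ((hf.differentiableOn (by simp) z hz).hasFDerivWithinAt.inner ℝ
    (hg.differentiableOn (by simp) z hz).hasFDerivWithinAt)
  rw [dirDeriv, h.fderivWithin (uniqueDiffOn_closedHalfSpace z hz)]
  simp [dirDeriv, fderivInnerCLM_apply]

end LandauLifshitz
end

/-! ### Local integrability up to time 0, and weak derivatives on time slices. -/

noncomputable section

namespace LandauLifshitz

variable {F : Type*} [NormedAddCommGroup F]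

/-- `f` is integrable on the bounded cylinders `(0,S) × K`, up to the initial time. -/
def LocInt (f : ℝ × E3 → F) : Prop :=
  ∀ (S : ℝ) (K : Set E3), IsCompact K → IntegrableOn f (Ioo 0 S ×ˢ K)

/-- `G` vanishes outside of `[0,∞) × K`. -/
def SuppIn (K : Set E3) (G : ℝ × E3 → F) : Prop :=
  ∀ z ∈ closedHalfSpace, z.2 ∉ K → G z = 0

/-- The complement of `K` is open, so the function vanishes near every point outside the cylinder
and its derivative vanishes there too. -/
theorem SuppIn.dirDeriv [NormedSpace ℝ F] {K : Set E3} (hK : IsCompact K) {G : ℝ × E3 → F}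
    (hG : SuppIn K G) (v : ℝ × E3) : SuppIn K (dirDeriv v G) := by
  intro z hz hzK
  refine dirDeriv_eq_zero_of_eventuallyEq ?_ hz v
  have h1 : {y : ℝ × E3 | y.2 ∉ K} ∈ nhds z :=
    (hK.isClosed.isOpen_compl.preimage continuous_snd).mem_nhds hzK
  filter_upwards [mem_nhdsWithin_of_mem_nhds h1, self_mem_nhdsWithin] with y hy hy' using hG y hy' hy

theorem SuppIn.exists_bound {K : Set E3} (hK : IsCompact K) {G : ℝ × E3 → F} (hG : SuppIn K G)
    (hc : ContinuousOn G closedHalfSpace) (S : ℝ) :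
    ∃ C : ℝ, 0 ≤ C ∧ ∀ z ∈ closedHalfSpace, z.1 ≤ S → ‖G z‖ ≤ C := by
  have hcomp : IsCompact (Icc (0 : ℝ) S ×ˢ K) := isCompact_Icc.prod hK
  obtain ⟨C, hC⟩ := hcomp.exists_bound_of_continuousOn
    (hc.mono (prod_mono Icc_subset_Ici_self (subset_univ _)))
  refine ⟨max C 0, le_max_right _ _, fun z hz hzS => ?_⟩
  by_cases h : z.2 ∈ K
  · exact (hC z ⟨⟨hz.1, hzS⟩, h⟩).trans (le_max_left _ _)
  · rw [hG z hz h, norm_zero]; exact le_max_right _ _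

instance isAddHaarMeasure_volume : (volume : Measure (ℝ × E3)).IsAddHaarMeasure := by
  rw [Measure.volume_eq_prod]; infer_instance

theorem restrict_slab (S : ℝ) :
    (volume : Measure (ℝ × E3)).restrict (slab S) =
      (volume.restrict (Ioo (0 : ℝ) S)).prod (volume : Measure E3) := by
  rw [slab, Measure.volume_eq_prod, ← Measure.prod_restrict, Measure.restrict_univ]

theorem restrict_halfSpace :
    (volume : Measure (ℝ × E3)).restrict halfSpace =
      (volume.restrict (Ioi (0 : ℝ))).prod (volume : Measure E3) := by
  rw [halfSpace, Measure.volume_eq_prod, ← Measure.prod_restrict, Measure.restrict_univ]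

theorem integral_slab [NormedSpace ℝ F] {S : ℝ} {f : ℝ × E3 → F} (hf : IntegrableOn f (slab S)) :
    ∫ z in slab S, f z = ∫ t in Ioo (0 : ℝ) S, ∫ x, f (t, x) := by
  rw [IntegrableOn, restrict_slab] at hf
  rw [restrict_slab, integral_prod _ hf]

theorem LocInt.aestronglyMeasurable {f : ℝ × E3 → F} (hf : LocInt f) (S : ℝ) :
    AEStronglyMeasurable f (volume.restrict (slab S)) := by
  have h : slab S = ⋃ n : ℕ, Ioo (0 : ℝ) S ×ˢ Metric.closedBall (0 : E3) n := by
    ext z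
    simp only [slab, mem_prod, mem_univ, and_true, mem_iUnion, Metric.mem_closedBall,
      dist_zero_right, exists_and_left]
    exact ⟨fun h => ⟨h, exists_nat_ge _⟩, fun h => h.1⟩
  rw [h]
  exact AEStronglyMeasurable.iUnion fun n =>
    (hf S _ (isCompact_closedBall _ _)).aestronglyMeasurable

/-- The source of nearly all integrability claims below: on a bounded time interval, a continuous
factor supported over a compact set is bounded, so its product with a locally integrable function is
integrable over the whole slab. -/
theorem LocInt.integrableOn_slab_of_le {F' : Type*} [NormedAddCommGroup F']
    {F'' : Type*} [NormedAddCommGroup F''] {K : Set E3}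
    (hK : IsCompact K) {G : ℝ × E3 → F'} (hG : SuppIn K G) (hc : ContinuousOn G closedHalfSpace)
    {f : ℝ × E3 → F} (hf : LocInt f) {h : ℝ × E3 → F''} (S : ℝ)
    (hm : AEStronglyMeasurable h (volume.restrict (slab S)))
    (hle : ∀ z, ‖h z‖ ≤ ‖G z‖ * ‖f z‖) : IntegrableOn h (slab S) := by
  obtain ⟨C, hC0, hC⟩ := hG.exists_bound hK hc S
  have hsub : Ioo (0 : ℝ) S ×ˢ K ⊆ slab S := prod_mono subset_rfl (subset_univ _)
  have h1 : IntegrableOn h (Ioo (0 : ℝ) S ×ˢ K) := by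
    refine ((hf S K hK).norm.const_mul C).mono' (hm.mono_measure (Measure.restrict_mono hsub le_rfl)) ?_
    filter_upwards [ae_restrict_mem (measurableSet_Ioo.prod hK.measurableSet)] with z hz
    exact (hle z).trans (mul_le_mul_of_nonneg_right
      (hC z (halfSpace_subset_closedHalfSpace (slab_subset_halfSpace S (hsub hz))) hz.1.2.le)
      (norm_nonneg _))
  refine h1.of_forall_sdiff_eq_zero (measurableSet_slab S) fun z hz => ?_
  have hz' : z.2 ∉ K := fun h => hz.2 ⟨hz.1.1, h⟩
  have := hle z
  rw [hG z (halfSpace_subset_closedHalfSpace (slab_subset_halfSpace S hz.1)) hz'] at this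
  simpa using this

theorem aestronglyMeasurable_slab_of_continuousOn {G : ℝ × E3 → F} [SecondCountableTopology F]
    (hc : ContinuousOn G closedHalfSpace) (S : ℝ) :
    AEStronglyMeasurable G (volume.restrict (slab S)) :=
  (hc.mono ((slab_subset_halfSpace S).trans halfSpace_subset_closedHalfSpace)).aestronglyMeasurable
    (measurableSet_slab S)

theorem LocInt.integrableOn_inner {K : Set E3} (hK : IsCompact K) {G f : ℝ × E3 → E3}
    (hf : LocInt f) (hG : SuppIn K G) (hc : ContinuousOn G closedHalfSpace) (S : ℝ) :
    IntegrableOn (fun z => inner ℝ (G z) (f z)) (slab S) :=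
  LocInt.integrableOn_slab_of_le hK hG hc hf S
    ((aestronglyMeasurable_slab_of_continuousOn hc S).inner (hf.aestronglyMeasurable S))
    fun _ => norm_inner_le_norm _ _

theorem locInt_of_continuousOn {f : ℝ × E3 → F} (hf : ContinuousOn f closedHalfSpace) :
    LocInt f := by
  intro S K hK
  refine IntegrableOn.mono_set (t := Icc 0 S ×ˢ K) ?_ (prod_mono Ioo_subset_Icc_self subset_rfl)
  exact (hf.mono (prod_mono Icc_subset_Ici_self (subset_univ _))).integrableOn_compact
    (isCompact_Icc.prod hK)

theorem integrableOn_halfSpace_smul [NormedSpace ℝ F] {φ : ℝ × E3 → ℝ} (hφ : Continuous φ)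
    (hcs : HasCompactSupport φ) (hsub : tsupport φ ⊆ halfSpace) {f : ℝ × E3 → F}
    (hf : LocallyIntegrableOn f halfSpace) : IntegrableOn (fun z => φ z • f z) halfSpace := by
  have h1 : IntegrableOn (fun z => φ z • f z) (tsupport φ) :=
    (hf.integrableOn_compact_subset hsub hcs).continuousOn_smul hφ.continuousOn hcs
  refine h1.of_forall_sdiff_eq_zero measurableSet_halfSpace fun z hz => ?_
  rw [image_eq_zero_of_notMem_tsupport hz.2, zero_smul]

theorem contDiff_of_forall_tsupport {E' F' : Type*} [NormedAddCommGroup E'] [NormedSpace ℝ E']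
    [NormedAddCommGroup F'] [NormedSpace ℝ F'] {f : E' → F'}
    (h : ∀ x ∈ tsupport f, ContDiffAt ℝ ∞ f x) : ContDiff ℝ ∞ f := by
  rw [contDiff_iff_contDiffAt]
  intro x
  by_cases hx : x ∈ tsupport f
  · exact h x hx
  · exact contDiffAt_const.congr_of_eventuallyEq (notMem_tsupport_iff_eventuallyEq.1 hx)

/-- The test function vanishes off the half space, so the integration by parts takes place in the
whole space. There `f` need only be differentiable on the support of the test function. -/
theorem isWeakDeriv_dirDeriv {f : ℝ × E3 → E3} (hf : ContDiffOn ℝ ∞ f closedHalfSpace)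
    (v : ℝ × E3) : IsWeakDeriv v f (dirDeriv v f) := by
  have hfc := hf.continuousOn.mono halfSpace_subset_closedHalfSpace
  have hdc := (hf.dirDeriv v).continuousOn.mono halfSpace_subset_closedHalfSpace
  have hl1 := hfc.locallyIntegrableOn (μ := volume) measurableSet_halfSpace
  have hl2 := hdc.locallyIntegrableOn (μ := volume) measurableSet_halfSpace
  refine ⟨hl1, hl2, fun φ hφ hcs hsub => ?_⟩
  have hφ' : Continuous (fun z => fderiv ℝ φ z v) :=
    (hφ.continuous_fderiv (by simp)).clm_apply continuous_const
  have hcs' : HasCompactSupport (fun z => fderiv ℝ φ z v) := hcs.fderiv_apply ℝ v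
  have hsub' : tsupport (fun z => fderiv ℝ φ z v) ⊆ halfSpace :=
    (tsupport_fderiv_apply_subset ℝ v).trans hsub
  have z1 : ∀ z ∉ halfSpace, φ z = 0 := fun z hz =>
    image_eq_zero_of_notMem_tsupport fun h => hz (hsub h)
  have z2 : ∀ z ∉ halfSpace, fderiv ℝ φ z v = 0 := fun z hz =>
    image_eq_zero_of_notMem_tsupport (f := fun z => fderiv ℝ φ z v) fun h => hz (hsub' h)
  have i1 := integrableOn_halfSpace_smul hφ' hcs' hsub' hl1
  have i2 := integrableOn_halfSpace_smul hφ.continuous hcs hsub hl2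
  have i3 := integrableOn_halfSpace_smul hφ.continuous hcs hsub hl1
  rw [integrableOn_iff_integrable_of_support_subset] at i1 i2 i3
  · have e : (fun z => φ z • dirDeriv v f z) = fun z => φ z • fderiv ℝ f z v := by
      funext z
      by_cases hz : z ∈ halfSpace
      · rw [dirDeriv_eq_fderiv hz]
      · rw [z1 z hz, zero_smul, zero_smul]
    rw [e] at i2
    have := integral_smul_fderiv_eq_neg_fderiv_smul_of_integrable (μ := volume) i1 i2 i3
      (fun x _ => hφ.differentiable (by simp) x)
      (fun x hx => (hf.contDiffAt_halfSpace (hsub hx)).differentiableAt (by simp))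
    rw [setIntegral_eq_integral_of_forall_compl_eq_zero (fun z hz => by rw [z2 z hz, zero_smul]),
      setIntegral_eq_integral_of_forall_compl_eq_zero (fun z hz => by rw [z1 z hz, zero_smul]),
      e, this, neg_neg]
  · exact fun z hz => by_contra fun hz' => hz (by simp [z1 z hz'])
  · exact fun z hz => by_contra fun hz' => hz (by simp [z1 z hz'])
  · exact fun z hz => by_contra fun hz' => hz (by simp [z2 z hz'])

theorem inner_eq_sum (a b : E3) : inner ℝ a b = ∑ j, a j * b j := by
  simp [PiLp.inner_apply, mul_comm]

/-- The definition pairs a scalar test function with a vector-valued map. Its j-th component, tested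
with the j-th component of `Φ` and summed over j, gives the scalar product version. -/
theorem IsWeakDeriv.integral_inner {v : ℝ × E3} {f g : ℝ × E3 → E3} (h : IsWeakDeriv v f g)
    {Φ : ℝ × E3 → E3} (hΦ : ContDiff ℝ ∞ Φ) (hcs : HasCompactSupport Φ)
    (hsub : tsupport Φ ⊆ halfSpace) :
    ∫ z in halfSpace, inner ℝ (fderiv ℝ Φ z v) (f z) = - ∫ z in halfSpace, inner ℝ (Φ z) (g z) := by
  obtain ⟨hf, hg, hw⟩ := h
  have hφ : ∀ j, ContDiff ℝ ∞ (fun z => Φ z j) := fun j => contDiff_euclidean.1 hΦ j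
  have hts : ∀ j, tsupport (fun z => Φ z j) ⊆ tsupport Φ := fun j =>
    closure_mono fun z hz h => hz (by simp [h])
  have hcs' : ∀ j, HasCompactSupport (fun z => Φ z j) := fun j =>
    hcs.mono' ((subset_tsupport _).trans (hts j))
  have hd : ∀ j z, fderiv ℝ (fun z => Φ z j) z v = fderiv ℝ Φ z v j := by
    intro j z
    have h1 := ((EuclideanSpace.proj (𝕜 := ℝ) j).hasFDerivAt (x := Φ z)).comp z
      (hΦ.differentiable (by simp) z).hasFDerivAt
    have h2 : ((EuclideanSpace.proj (𝕜 := ℝ) j : E3 →L[ℝ] ℝ) ∘ Φ) = fun z => Φ z j := rfl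
    rw [h2] at h1
    rw [h1.fderiv]; rfl
  have i1 : ∀ j, IntegrableOn (fun z => fderiv ℝ (fun z => Φ z j) z v • f z) halfSpace := fun j =>
    integrableOn_halfSpace_smul (((hφ j).continuous_fderiv (by simp)).clm_apply continuous_const)
      ((hcs' j).fderiv_apply ℝ v)
      ((tsupport_fderiv_apply_subset ℝ v).trans ((hts j).trans hsub)) hf
  have i2 : ∀ j, IntegrableOn (fun z => Φ z j • g z) halfSpace := fun j =>
    integrableOn_halfSpace_smul (hφ j).continuous (hcs' j) ((hts j).trans hsub) hg
  have key : ∀ j, ∫ z in halfSpace, fderiv ℝ Φ z v j * f z j =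
      - ∫ z in halfSpace, Φ z j * g z j := by
    intro j
    have h1 := (EuclideanSpace.proj (𝕜 := ℝ) j : E3 →L[ℝ] ℝ).integral_comp_comm (i1 j)
    have h2 := (EuclideanSpace.proj (𝕜 := ℝ) j : E3 →L[ℝ] ℝ).integral_comp_comm (i2 j)
    rw [hw _ (hφ j) (hcs' j) ((hts j).trans hsub), map_neg, ← h2] at h1
    simpa [hd] using h1
  simp_rw [inner_eq_sum]
  rw [integral_finsetSum _ fun j _ => ?_, integral_finsetSum _ fun j _ => ?_,
    ← Finset.sum_neg_distrib]
  · exact Finset.sum_congr rfl fun j _ => key j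
  · simpa using (EuclideanSpace.proj (𝕜 := ℝ) j : E3 →L[ℝ] ℝ).integrable_comp (i2 j)
  · simpa [hd] using (EuclideanSpace.proj (𝕜 := ℝ) j : E3 →L[ℝ] ℝ).integrable_comp (i1 j)

theorem integrableOn_integral_slab {S : ℝ} {f : ℝ × E3 → F} [NormedSpace ℝ F]
    (hf : IntegrableOn f (slab S)) : IntegrableOn (fun t => ∫ x, f (t, x)) (Ioo 0 S) := by
  rw [IntegrableOn, restrict_slab] at hf
  exact hf.integral_prod_left

theorem ae_integrable_slice {S : ℝ} {f : ℝ × E3 → F} (hf : IntegrableOn f (slab S)) :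
    ∀ᵐ t ∂(volume.restrict (Ioo 0 S)), Integrable (fun x => f (t, x)) := by
  rw [IntegrableOn, restrict_slab] at hf
  exact hf.prod_right_ae

/-- Almost everywhere statements on the half-line can be checked on bounded intervals. -/
theorem ae_Ioi_of_forall_Ioo {p : ℝ → Prop}
    (h : ∀ S : ℝ, ∀ᵐ t ∂(volume.restrict (Ioo 0 S)), p t) :
    ∀ᵐ t ∂(volume.restrict (Ioi (0 : ℝ))), p t := by
  have hU : Ioi (0 : ℝ) = ⋃ n : ℕ, Ioo (0 : ℝ) n := by
    ext t
    simp only [mem_Ioi, mem_iUnion, mem_Ioo, exists_and_left]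
    exact ⟨fun h => ⟨h, exists_nat_gt t⟩, fun h => h.1⟩
  rw [hU, ae_restrict_iUnion_iff]
  exact fun n => h n

/-- Spatial integration by parts holds at almost every fixed time. A space derivative does not act
on a factor α(t), so testing with α(t)G for every smooth α compactly supported in (0,∞) makes the
slice integrals of `J` vanish almost everywhere. -/
theorem integral_slice_space {i : Fin 3} {V Vi : ℝ × E3 → E3}
    (hw : IsWeakDeriv (spaceDir i) V Vi) (hV : LocInt V) (hVi : LocInt Vi)
    {K : Set E3} (hK : IsCompact K) {G : ℝ × E3 → E3} (hG : ContDiffOn ℝ ∞ G closedHalfSpace)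
    (hGK : SuppIn K G) :
    ∀ᵐ t ∂(volume.restrict (Ioi (0 : ℝ))),
      ∫ x, inner ℝ (dirDeriv (spaceDir i) G (t, x)) (V (t, x)) =
        - ∫ x, inner ℝ (G (t, x)) (Vi (t, x)) := by
  set J : ℝ × E3 → ℝ := fun z =>
    inner ℝ (dirDeriv (spaceDir i) G z) (V z) + inner ℝ (G z) (Vi z) with hJ
  have iA : ∀ S, IntegrableOn (fun z => inner ℝ (dirDeriv (spaceDir i) G z) (V z)) (slab S) :=
    hV.integrableOn_inner hK (hGK.dirDeriv hK _) (hG.dirDeriv _).continuousOn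
  have iB : ∀ S, IntegrableOn (fun z => inner ℝ (G z) (Vi z)) (slab S) :=
    hVi.integrableOn_inner hK hGK hG.continuousOn
  have iJ : ∀ S, IntegrableOn J (slab S) := fun S => (iA S).add (iB S)
  have hloc : LocallyIntegrableOn (fun t => ∫ x, J (t, x)) (Ioi 0) := by
    rw [locallyIntegrableOn_iff isOpen_Ioi.isLocallyClosed]
    intro k hk hkc
    obtain ⟨S, hS⟩ := hkc.isBounded.bddAbove
    exact (integrableOn_integral_slab (iJ (S + 1))).mono_set fun t ht =>
      ⟨hk ht, (hS ht).trans_lt (lt_add_one S)⟩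
  have hzero : ∀ᵐ t, t ∈ Ioi (0 : ℝ) → ∫ x, J (t, x) = 0 := by
    refine isOpen_Ioi.ae_eq_zero_of_integral_contDiff_smul_eq_zero hloc fun α hα hαc hαs => ?_
    obtain ⟨S, hS⟩ := hαc.isBounded.bddAbove
    set Φ : ℝ × E3 → E3 := fun z => α z.1 • G z with hΦdef
    have hts : tsupport Φ ⊆ tsupport α ×ˢ univ := by
      refine closure_minimal (fun z hz => ⟨subset_tsupport _ fun h => hz ?_, mem_univ _⟩)
        ((isClosed_tsupport α).prod isClosed_univ)
      simp [hΦdef, h]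
    have hts' : tsupport Φ ⊆ halfSpace := hts.trans (prod_mono hαs subset_rfl)
    have hΦs : ContDiff ℝ ∞ Φ := contDiff_of_forall_tsupport fun z hz =>
      (hα.contDiffAt.comp z contDiffAt_fst).smul (hG.contDiffAt_halfSpace (hts' hz))
    have hΦc : HasCompactSupport Φ := by
      refine HasCompactSupport.of_support_subset_isCompact (hαc.isCompact.prod hK) fun z hz => ?_
      have hz' : z ∈ halfSpace := hts' (subset_tsupport _ hz)
      refine ⟨subset_tsupport _ fun h => hz (by simp [hΦdef, h]), by_contra fun h => hz ?_⟩
      simp [hΦdef, hGK z (halfSpace_subset_closedHalfSpace hz') h]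
    have hα0 : ∀ t, t ∉ Ioo 0 (S + 1) → α t = 0 := fun t ht =>
      image_eq_zero_of_notMem_tsupport fun h =>
        ht ⟨hαs h, (hS h).trans_lt (lt_add_one S)⟩
    have hd : ∀ z ∈ halfSpace, fderiv ℝ Φ z (spaceDir i) =
        α z.1 • dirDeriv (spaceDir i) G z := by
      intro z hz
      have h1 : HasFDerivAt (fun z : ℝ × E3 => α z.1)
          ((fderiv ℝ α z.1).comp (ContinuousLinearMap.fst ℝ ℝ E3)) z :=
        ((hα.differentiable (by simp)) z.1).hasFDerivAt.comp z hasFDerivAt_fst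
      have h2 := h1.smul ((hG.contDiffAt_halfSpace hz).differentiableAt (by simp)).hasFDerivAt
      rw [dirDeriv_eq_fderiv hz]
      have h3 : HasFDerivAt Φ _ z := h2
      rw [h3.fderiv]
      simp [spaceDir]
    have hint := hw.integral_inner hΦs hΦc hts'
    have e1 : ∫ z in halfSpace, inner ℝ (fderiv ℝ Φ z (spaceDir i)) (V z) =
        ∫ z in slab (S + 1), α z.1 * inner ℝ (dirDeriv (spaceDir i) G z) (V z) := by
      rw [← setIntegral_eq_of_subset_of_forall_sdiff_eq_zero measurableSet_halfSpace
        (slab_subset_halfSpace (S + 1))]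
      · refine setIntegral_congr_fun measurableSet_halfSpace fun z hz => ?_
        simp only [hd z hz, real_inner_smul_left]
      · intro z hz
        rw [hα0 z.1 fun h => hz.2 ⟨h, mem_univ _⟩, zero_mul]
    have e2 : ∫ z in halfSpace, inner ℝ (Φ z) (Vi z) =
        ∫ z in slab (S + 1), α z.1 * inner ℝ (G z) (Vi z) := by
      rw [← setIntegral_eq_of_subset_of_forall_sdiff_eq_zero measurableSet_halfSpace
        (slab_subset_halfSpace (S + 1))]
      · refine setIntegral_congr_fun measurableSet_halfSpace fun z hz => ?_
        simp only [hΦdef, real_inner_smul_left]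
      · intro z hz
        rw [hα0 z.1 fun h => hz.2 ⟨h, mem_univ _⟩, zero_mul]
    obtain ⟨C, hC⟩ := hαc.exists_bound_of_continuous hα.continuous
    have bm : ∀ {h : ℝ × E3 → ℝ}, IntegrableOn h (slab (S + 1)) →
        IntegrableOn (fun z => α z.1 * h z) (slab (S + 1)) := fun hh =>
      Integrable.bdd_mul hh (hα.continuous.comp continuous_fst).aestronglyMeasurable
        (Filter.Eventually.of_forall fun z => hC z.1)
    have e3 : ∫ z in slab (S + 1), α z.1 * J z = 0 := by
      simp only [hJ, mul_add]
      rw [integral_add (bm (iA _)) (bm (iB _)), ← e1, ← e2, hint, neg_add_cancel]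
    rw [integral_slab (bm (iJ _))] at e3
    simp only [integral_const_mul] at e3
    -- By Fubini, the space-time identity `e3` is the pairing of α with the function of time that
    -- must vanish.
    rw [← setIntegral_eq_integral_of_forall_compl_eq_zero (s := Ioo 0 (S + 1))
      fun t ht => by rw [hα0 t ht, zero_smul]]
    simpa using e3
  refine ae_Ioi_of_forall_Ioo fun S => ?_
  filter_upwards [ae_restrict_of_ae hzero, ae_restrict_mem measurableSet_Ioo,
    ae_integrable_slice (iA S), ae_integrable_slice (iB S)] with t h0 ht ia ib
  have := h0 ht.1
  simp only [hJ] at this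
  rw [integral_add ia ib] at this
  linarith

/-- No condition on `G` at times 0 and S is needed: the identity is integrated slice by slice. -/
theorem integral_slab_space {i : Fin 3} {V Vi : ℝ × E3 → E3}
    (hw : IsWeakDeriv (spaceDir i) V Vi) (hV : LocInt V) (hVi : LocInt Vi)
    {K : Set E3} (hK : IsCompact K) {G : ℝ × E3 → E3} (hG : ContDiffOn ℝ ∞ G closedHalfSpace)
    (hGK : SuppIn K G) (S : ℝ) :
    ∫ z in slab S, (inner ℝ (dirDeriv (spaceDir i) G z) (V z) : ℝ) =
      - ∫ z in slab S, (inner ℝ (G z) (Vi z) : ℝ) := by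
  rw [integral_slab (hV.integrableOn_inner hK (hGK.dirDeriv hK _)
    (hG.dirDeriv _).continuousOn S), integral_slab (hVi.integrableOn_inner hK hGK hG.continuousOn S),
    ← integral_neg]
  exact integral_congr_ae (ae_restrict_of_ae_restrict_of_subset Ioo_subset_Ioi_self
    (integral_slice_space hw hV hVi hK hG hGK))

end LandauLifshitz
end

/-! ### Mollification, and orthogonality of a sphere-valued map to its weak derivatives. -/

noncomputable section

namespace LandauLifshitz

open scoped Convolution in
/-- Regularization of `h` by convolution with the normalized bump function `ρ`. -/
def mollify (ρ : ContDiffBump (0 : ℝ × E3)) (h : ℝ × E3 → E3) : ℝ × E3 → E3 :=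
  ρ.normed volume ⋆[ContinuousLinearMap.lsmul ℝ ℝ, volume] h

theorem mollify_apply (ρ : ContDiffBump (0 : ℝ × E3)) (h : ℝ × E3 → E3) (z : ℝ × E3) :
    mollify ρ h z = ∫ y, ρ.normed volume (z - y) • h y := by
  rw [mollify, convolution_eq_swap]; rfl

theorem norm_mollify_le (ρ : ContDiffBump (0 : ℝ × E3)) {h : ℝ × E3 → E3} {C : ℝ}
    (hC : ∀ᵐ y, ‖h y‖ ≤ C) (z : ℝ × E3) : ‖mollify ρ h z‖ ≤ C := by
  rw [mollify_apply]
  have hi : Integrable (fun y => ρ.normed volume (z - y)) :=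
    (ρ.integrable_normed (μ := volume)).comp_sub_left z
  have h1 := norm_integral_le_of_norm_le (f := fun y => ρ.normed volume (z - y) • h y)
    (hi.mul_const C) (by
      filter_upwards [hC] with y hy
      rw [norm_smul, Real.norm_of_nonneg (ρ.nonneg_normed _)]
      exact mul_le_mul_of_nonneg_left hy (ρ.nonneg_normed _))
  rwa [integral_mul_const, integral_sub_left_eq_self (fun y => ρ.normed volume y) volume z,
    ρ.integral_normed, one_mul] at h1

/-- Mollification is self-adjoint: exchange the integrals and use that the bump function is even. -/
theorem integral_inner_mollify (ρ : ContDiffBump (0 : ℝ × E3)) {b f : ℝ × E3 → E3}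
    (hb : Integrable b) (hf : Integrable f) :
    ∫ z, inner ℝ (mollify ρ b z) (f z) = ∫ z, inner ℝ (b z) (mollify ρ f z) := by
  obtain ⟨C, hC⟩ := (ρ.hasCompactSupport_normed (μ := volume)).exists_bound_of_continuous
    ρ.continuous_normed
  have hint : Integrable (fun p : (ℝ × E3) × (ℝ × E3) =>
      ρ.normed volume (p.1 - p.2) * inner ℝ (b p.2) (f p.1)) (volume.prod volume) := by
    have h1 : Integrable (fun p : (ℝ × E3) × (ℝ × E3) => inner ℝ (b p.2) (f p.1))
        (volume.prod volume) := by
      refine (hf.norm.mul_prod hb.norm).mono'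
        (hb.aestronglyMeasurable.comp_snd.inner hf.aestronglyMeasurable.comp_fst)
        (Filter.Eventually.of_forall fun p => ?_)
      rw [mul_comm]
      exact norm_inner_le_norm _ _
    exact h1.bdd_mul (ρ.continuous_normed.comp (by fun_prop)).aestronglyMeasurable
      (Filter.Eventually.of_forall fun p => hC _)
  have hbm : ∀ (z : ℝ × E3) {h : ℝ × E3 → E3}, Integrable h →
      Integrable fun y => ρ.normed volume (z - y) • h y := fun z h hh =>
    hh.bdd_smul C (ρ.continuous_normed.comp (by fun_prop)).aestronglyMeasurable
      (Filter.Eventually.of_forall fun y => hC _)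
  have e1 : ∀ z, inner ℝ (mollify ρ b z) (f z) =
      ∫ y, ρ.normed volume (z - y) * inner ℝ (b y) (f z) := by
    intro z
    rw [mollify_apply, real_inner_comm, ← integral_inner (hbm z hb)]
    exact integral_congr_ae (Filter.Eventually.of_forall fun y => by
      simp only [real_inner_smul_right, real_inner_comm])
  have e2 : ∀ y, inner ℝ (b y) (mollify ρ f y) =
      ∫ z, ρ.normed volume (z - y) * inner ℝ (b y) (f z) := by
    intro y
    rw [mollify_apply, ← integral_inner (hbm y hf)]
    refine integral_congr_ae (Filter.Eventually.of_forall fun z => ?_)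
    simp only [real_inner_smul_right]
    rw [← neg_sub, ρ.normed_neg]
  simp_rw [e1, e2]
  exact integral_integral_swap hint

theorem integrable_indicator_compact {f : ℝ × E3 → E3} (hf : LocallyIntegrableOn f halfSpace)
    {K : Set (ℝ × E3)} (hK : IsCompact K) (hsub : K ⊆ halfSpace) :
    Integrable (K.indicator f) :=
  (hf.integrableOn_compact_subset hsub hK).integrable_indicator hK.measurableSet

/-- Mollification commutes with the weak derivative of φf. The functions `f'` and `g'` are
replacements for `f` and `g` that agree with them on the support of φ; `f'` is integrable on the
whole space, as the convolution requires. -/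
theorem fderiv_mollify_smul {v : ℝ × E3} {f g : ℝ × E3 → E3} (h : IsWeakDeriv v f g)
    {φ : ℝ × E3 → ℝ} (hφ : ContDiff ℝ ∞ φ) (hcs : HasCompactSupport φ)
    (hsub : tsupport φ ⊆ halfSpace) {f' g' : ℝ × E3 → E3} (hf' : Integrable f')
    (hff : EqOn f f' (tsupport φ)) (hgg : EqOn g g' (tsupport φ))
    (ρ : ContDiffBump (0 : ℝ × E3)) (z : ℝ × E3) :
    fderiv ℝ (mollify ρ fun y => φ y • f' y) z v =
      mollify ρ (fun y => fderiv ℝ φ y v • f' y + φ y • g' y) z := by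
  obtain ⟨Cφ, hCφ⟩ := hcs.exists_bound_of_continuous hφ.continuous
  have ha : Integrable fun y => φ y • f' y :=
    hf'.bdd_smul Cφ hφ.continuous.aestronglyMeasurable (Filter.Eventually.of_forall hCφ)
  have hρ : ContDiff ℝ ∞ (ρ.normed volume) := ρ.contDiff_normed
  have hd := (ρ.hasCompactSupport_normed (μ := volume)).hasFDerivAt_convolution_left
    (ContinuousLinearMap.lsmul ℝ ℝ) (ρ.contDiff_normed (n := 1)) ha.locallyIntegrable z
  have hd' : HasFDerivAt (mollify ρ fun y => φ y • f' y) _ z := hd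
  obtain ⟨C', hC'⟩ := ((ρ.hasCompactSupport_normed (μ := volume)).fderiv (𝕜 := ℝ)).exists_bound_of_continuous
    (hρ.continuous_fderiv (by simp))
  rw [hd'.fderiv, convolution_eq_swap, ContinuousLinearMap.integral_apply]
  · simp only [ContinuousLinearMap.precompL_apply, ContinuousLinearMap.lsmul_apply]
    -- The convolution at z, with the derivative on the kernel, becomes the weak derivative identity
    -- tested with the kernel times φ.
    set ψ : ℝ × E3 → ℝ := fun y => ρ.normed volume (z - y) * φ y with hψ
    have hρz : ContDiff ℝ ∞ fun y => ρ.normed volume (z - y) :=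
      hρ.comp (contDiff_const.sub contDiff_id)
    have hψs : ContDiff ℝ ∞ ψ := hρz.mul hφ
    have hψt : tsupport ψ ⊆ tsupport φ := tsupport_mul_subset_right
    have hψc : HasCompactSupport ψ := hcs.mul_left
    have hw := h.2.2 ψ hψs hψc (hψt.trans hsub)
    have hψd : ∀ y, fderiv ℝ ψ y v =
        ρ.normed volume (z - y) * fderiv ℝ φ y v - fderiv ℝ (ρ.normed volume) (z - y) v * φ y := by
      intro y
      have h1 : HasFDerivAt (fun y => ρ.normed volume (z - y))
          ((fderiv ℝ (ρ.normed volume) (z - y)).comp (-ContinuousLinearMap.id ℝ (ℝ × E3))) y :=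
        ((hρ.differentiable (by simp) _).hasFDerivAt).comp y ((hasFDerivAt_id y).const_sub z)
      have h2 : HasFDerivAt ψ _ y := h1.mul (hφ.differentiable (by simp) y).hasFDerivAt
      rw [h2.fderiv]
      simp
      ring
    have z1 : ∀ y ∉ tsupport φ, φ y = 0 := fun y hy => image_eq_zero_of_notMem_tsupport hy
    have z2 : ∀ y ∉ tsupport φ, fderiv ℝ φ y v = 0 := fun y hy =>
      image_eq_zero_of_notMem_tsupport (f := fun z => fderiv ℝ φ z v)
        fun h => hy (tsupport_fderiv_apply_subset ℝ v h)
    rw [setIntegral_eq_integral_of_forall_compl_eq_zero, setIntegral_eq_integral_of_forall_compl_eq_zero] at hw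
    · have e1 : (fun y => fderiv ℝ ψ y v • f y) = fun y =>
          (ρ.normed volume (z - y) * fderiv ℝ φ y v) • f' y -
            fderiv ℝ (ρ.normed volume) (z - y) v • φ y • f' y := by
        funext y
        rw [hψd]
        by_cases hy : y ∈ tsupport φ
        · rw [hff hy, sub_smul, mul_smul, mul_smul]
        · simp [z1 y hy, z2 y hy]
      have e2 : (fun y => ψ y • g y) = fun y => (ρ.normed volume (z - y) * φ y) • g' y := by
        funext y
        by_cases hy : y ∈ tsupport φ
        · rw [hgg hy]
        · simp [hψ, z1 y hy]
      have i1 : Integrable fun y => (ρ.normed volume (z - y) * fderiv ℝ φ y v) • f' y := by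
        have hc : Continuous fun y => ρ.normed volume (z - y) * fderiv ℝ φ y v :=
          hρz.continuous.mul ((hφ.continuous_fderiv (by simp)).clm_apply continuous_const)
        have hk : HasCompactSupport fun y => ρ.normed volume (z - y) * fderiv ℝ φ y v :=
          (hcs.fderiv_apply ℝ v).mul_left
        obtain ⟨C, hC⟩ := hk.exists_bound_of_continuous hc
        exact hf'.bdd_smul C hc.aestronglyMeasurable (Filter.Eventually.of_forall hC)
      have i2 : Integrable fun y => fderiv ℝ (ρ.normed volume) (z - y) v • φ y • f' y := by
        refine ha.bdd_smul (C' * ‖v‖) ?_ (Filter.Eventually.of_forall fun y =>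
          ((fderiv ℝ (ρ.normed volume) (z - y)).le_opNorm v).trans
            (mul_le_mul_of_nonneg_right (hC' _) (norm_nonneg _)))
        exact (((hρ.continuous_fderiv (by simp)).comp (by fun_prop)).clm_apply
          continuous_const).aestronglyMeasurable
      have i3 : Integrable fun y => (ρ.normed volume (z - y) * φ y) • g' y := by
        rw [← e2, ← integrableOn_iff_integrable_of_support_subset (s := halfSpace)]
        · exact integrableOn_halfSpace_smul hψs.continuous hψc (hψt.trans hsub) h.2.1
        · exact fun y hy => by_contra fun hy' => hy (by
            simp [hψ, z1 y fun h => hy' (hsub h)])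
      rw [e1, e2, integral_sub i1 i2] at hw
      rw [mollify_apply]
      have e3 : (fun y => ρ.normed volume (z - y) • (fderiv ℝ φ y v • f' y + φ y • g' y)) =
          fun y => (ρ.normed volume (z - y) * fderiv ℝ φ y v) • f' y +
            (ρ.normed volume (z - y) * φ y) • g' y := by
        funext y; rw [smul_add, mul_smul, mul_smul]
      rw [e3, integral_add i1 i3]
      have := sub_eq_iff_eq_add.1 hw
      rw [this]; abel
    · intro y hy
      simp [hψ, z1 y fun h => hy (hsub h)]
    · intro y hy
      rw [hψd]
      simp [z1 y fun h => hy (hsub h), z2 y fun h => hy (hsub h)]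
  · refine (ha.norm.const_mul C').mono'
      ?_ (Filter.Eventually.of_forall fun y => ?_)
    · exact ContinuousLinearMap.aestronglyMeasurable_comp₂ _
        ((hρ.continuous_fderiv (by simp)).comp (by fun_prop)).aestronglyMeasurable
        ha.aestronglyMeasurable
    · have hC0 : 0 ≤ C' := (norm_nonneg _).trans (hC' 0)
      refine ContinuousLinearMap.opNorm_le_bound _ (by positivity) fun w => ?_
      rw [ContinuousLinearMap.precompL_apply, ContinuousLinearMap.lsmul_apply, norm_smul]
      calc _ ≤ (C' * ‖w‖) * ‖φ y • f' y‖ := by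
            gcongr
            exact ((fderiv ℝ (ρ.normed volume) (z - y)).le_opNorm w).trans
              (mul_le_mul_of_nonneg_right (hC' _) (norm_nonneg _))
        _ = _ := by ring

theorem integral_fderiv_apply_eq_zero {φ : ℝ × E3 → ℝ} (hφ : ContDiff ℝ ∞ φ)
    (hcs : HasCompactSupport φ) (v : ℝ × E3) : ∫ z, fderiv ℝ φ z v = 0 := by
  have hc : Continuous fun z => fderiv ℝ φ z v :=
    (hφ.continuous_fderiv (by simp)).clm_apply continuous_const
  have := integral_mul_fderiv_eq_neg_fderiv_mul_of_integrable (μ := volume) (v := v)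
    (f := fun _ : ℝ × E3 => (1 : ℝ)) (g := φ) (by simp)
    (by simpa using hc.integrable_of_hasCompactSupport (hcs.fderiv_apply ℝ v))
    (by simpa using hφ.continuous.integrable_of_hasCompactSupport hcs)
    (fun x _ => by fun_prop) (fun x _ => hφ.differentiable (by simp) x)
  simpa using this

/-- A weak derivative of a map with values in the unit sphere is orthogonal to the map. -/
theorem IsWeakDeriv.inner_eq_zero {v : ℝ × E3} {f g : ℝ × E3 → E3} (h : IsWeakDeriv v f g)
    (hn : ∀ᵐ z ∂(volume.restrict halfSpace), ‖f z‖ = 1) :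
    ∀ᵐ z ∂(volume.restrict halfSpace), inner ℝ (f z) (g z) = (0 : ℝ) := by
  have hm : AEStronglyMeasurable (fun z => inner ℝ (f z) (g z)) (volume.restrict halfSpace) :=
    h.1.aestronglyMeasurable.inner h.2.1.aestronglyMeasurable
  have hloc : LocallyIntegrableOn (fun z => inner ℝ (f z) (g z)) halfSpace := by
    rw [locallyIntegrableOn_iff isOpen_halfSpace.isLocallyClosed]
    intro k hk hkc
    refine (h.2.1.integrableOn_compact_subset hk hkc).norm.mono'
      (hm.mono_measure (Measure.restrict_mono hk le_rfl)) ?_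
    filter_upwards [ae_restrict_of_ae_restrict_of_subset hk hn] with z hz
    simpa [hz] using norm_inner_le_norm (𝕜 := ℝ) (f z) (g z)
  rw [ae_restrict_iff' measurableSet_halfSpace] at hn ⊢
  refine isOpen_halfSpace.ae_eq_zero_of_integral_contDiff_smul_eq_zero hloc
    fun φ hφ hcs hsub => ?_
  -- A closed thickening of the support still inside the half space leaves room to mollify at scales
  -- up to δ. Truncation to it makes `f` and `g` integrable.
  obtain ⟨δ, hδ, hδs⟩ := hcs.isCompact.exists_cthickening_subset_open isOpen_halfSpace hsub
  set K := Metric.cthickening δ (tsupport φ) with hKdef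
  have hK : IsCompact K := hcs.isCompact.cthickening
  have hφK : tsupport φ ⊆ K := Metric.self_subset_cthickening _
  set f' := K.indicator f with hf'
  set g' := K.indicator g with hg'
  have if' : Integrable f' := integrable_indicator_compact h.1 hK hδs
  have ig' : Integrable g' := integrable_indicator_compact h.2.1 hK hδs
  have hff : EqOn f f' (tsupport φ) := fun z hz => (indicator_of_mem (hφK hz) f).symm
  have hgg : EqOn g g' (tsupport φ) := fun z hz => (indicator_of_mem (hφK hz) g).symm
  have hf1 : ∀ᵐ z, ‖f' z‖ ≤ 1 := by
    filter_upwards [hn] with z hz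
    by_cases hzK : z ∈ K
    · rw [hf', indicator_of_mem hzK, hz (hδs hzK)]
    · rw [hf', indicator_of_notMem hzK]; simp
  obtain ⟨C, hC⟩ := hcs.exists_bound_of_continuous hφ.continuous
  have hdc : Continuous fun z => fderiv ℝ φ z v :=
    (hφ.continuous_fderiv (by simp)).clm_apply continuous_const
  obtain ⟨C', hC'⟩ := (hcs.fderiv_apply ℝ v).exists_bound_of_continuous hdc
  set a : ℝ × E3 → E3 := fun y => φ y • f' y with ha
  set b : ℝ × E3 → E3 := fun y => fderiv ℝ φ y v • f' y + φ y • g' y with hb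
  have ia : Integrable a :=
    if'.bdd_smul C hφ.continuous.aestronglyMeasurable (Filter.Eventually.of_forall hC)
  have ib : Integrable b :=
    (if'.bdd_smul C' hdc.aestronglyMeasurable (Filter.Eventually.of_forall hC')).add
      (ig'.bdd_smul C hφ.continuous.aestronglyMeasurable (Filter.Eventually.of_forall hC))
  have haC : ∀ᵐ z, ‖a z‖ ≤ C := by
    filter_upwards [hf1] with z hz
    rw [ha, norm_smul]
    exact (mul_le_of_le_one_right (norm_nonneg _) hz).trans (hC z)
  -- Test the weak derivative with the mollified φf, whose derivative is the mollified `b`, and move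
  -- the mollifier from `b` onto `f'`.
  have hrec : ∀ ρ : ContDiffBump (0 : ℝ × E3), ρ.rOut ≤ δ →
      ∫ z, inner ℝ (b z) (mollify ρ f' z) = - ∫ z, inner ℝ (mollify ρ a z) (g' z) := by
    intro ρ hρ
    have hts : tsupport (mollify ρ a) ⊆ K := by
      refine closure_minimal ?_ Metric.isClosed_cthickening
      refine (support_convolution_subset _).trans ?_
      rintro _ ⟨y, hy, x, hx, rfl⟩
      rw [ρ.support_normed_eq, mem_ball_zero_iff] at hy
      refine Metric.mem_cthickening_of_dist_le _ x _ _ (subset_tsupport _ fun h0 => hx ?_) ?_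
      · simp [ha, h0]
      · simpa using hy.le.trans hρ
    have hsm : ContDiff ℝ ∞ (mollify ρ a) :=
      (ρ.hasCompactSupport_normed (μ := volume)).contDiff_convolution_left _ ρ.contDiff_normed
        ia.locallyIntegrable
    have hw := h.integral_inner hsm (hK.of_isClosed_subset (isClosed_tsupport _) hts)
      (hts.trans hδs)
    have hfd : ∀ z, fderiv ℝ (mollify ρ a) z v = mollify ρ b z :=
      fderiv_mollify_smul h hφ hcs hsub if' hff hgg ρ
    have z1 : ∀ z ∉ K, mollify ρ a z = 0 := fun z hz =>
      image_eq_zero_of_notMem_tsupport fun h => hz (hts h)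
    have z2 : ∀ z ∉ K, mollify ρ b z = 0 := fun z hz => by
      rw [← hfd]
      exact image_eq_zero_of_notMem_tsupport (f := fun z => fderiv ℝ (mollify ρ a) z v)
        fun h => hz (hts (tsupport_fderiv_apply_subset ℝ v h))
    rw [← integral_inner_mollify ρ ib if']
    have e1 : ∀ z, inner ℝ (fderiv ℝ (mollify ρ a) z v) (f z) =
        (inner ℝ (mollify ρ b z) (f' z) : ℝ) := by
      intro z
      rw [hfd]
      by_cases hz : z ∈ K
      · rw [hf', indicator_of_mem hz]
      · rw [z2 z hz, inner_zero_left, inner_zero_left]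
    have e2 : ∀ z, inner ℝ (mollify ρ a z) (g z) = (inner ℝ (mollify ρ a z) (g' z) : ℝ) := by
      intro z
      by_cases hz : z ∈ K
      · rw [hg', indicator_of_mem hz]
      · rw [z1 z hz, inner_zero_left, inner_zero_left]
    simp_rw [e1, e2] at hw
    rwa [setIntegral_eq_integral_of_forall_compl_eq_zero,
      setIntegral_eq_integral_of_forall_compl_eq_zero] at hw
    · exact fun z hz => by rw [z1 z fun h => hz (hδs h), inner_zero_left]
    · exact fun z hz => by rw [z2 z fun h => hz (hδs h), inner_zero_left]
  have hpos : ∀ n : ℕ, 0 < δ / (n + 1) := fun n => by positivity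
  set ρ : ℕ → ContDiffBump (0 : ℝ × E3) := fun n =>
    ⟨δ / (n + 1) / 2, δ / (n + 1), half_pos (hpos n), half_lt_self (hpos n)⟩ with hρ
  have hlim : Filter.Tendsto (fun n => (ρ n).rOut) Filter.atTop (nhds 0) := by
    simpa [hρ, div_eq_mul_inv] using tendsto_one_div_add_atTop_nhds_zero_nat.const_mul δ
  have hratio : ∀ᶠ n in Filter.atTop, (ρ n).rOut ≤ 2 * (ρ n).rIn :=
    Filter.Eventually.of_forall fun n => by simp only [hρ]; linarith
  have hle : ∀ n, (ρ n).rOut ≤ δ := fun n => by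
    simp only [hρ]
    exact div_le_self hδ.le (by linarith [n.cast_nonneg (α := ℝ)])
  have cm : ∀ n {h : ℝ × E3 → E3}, Integrable h → Continuous (mollify (ρ n) h) := fun n h hh =>
    ((ρ n).hasCompactSupport_normed (μ := volume)).continuous_convolution_left _
      (ρ n).continuous_normed hh.locallyIntegrable
  -- Dominated convergence: mollification preserves the bound |f'| ≤ 1, so the integrable function
  -- |b| dominates.
  have l1 : Filter.Tendsto (fun n => ∫ z, inner ℝ (b z) (mollify (ρ n) f' z)) Filter.atTop
      (nhds (∫ z, inner ℝ (b z) (f' z))) := by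
    refine tendsto_integral_of_dominated_convergence (fun z => ‖b z‖)
      (fun n => ib.aestronglyMeasurable.inner (cm n if').aestronglyMeasurable) ib.norm
      (fun n => Filter.Eventually.of_forall fun z => (norm_inner_le_norm _ _).trans
        (mul_le_of_le_one_right (norm_nonneg _) (norm_mollify_le _ hf1 z))) ?_
    filter_upwards [ContDiffBump.ae_convolution_tendsto_right_of_locallyIntegrable hlim hratio
      if'.locallyIntegrable] with z hz
    exact tendsto_const_nhds.inner hz
  have l2 : Filter.Tendsto (fun n => ∫ z, inner ℝ (mollify (ρ n) a z) (g' z)) Filter.atTop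
      (nhds (∫ z, inner ℝ (a z) (g' z))) := by
    refine tendsto_integral_of_dominated_convergence (fun z => C * ‖g' z‖)
      (fun n => (cm n ia).aestronglyMeasurable.inner ig'.aestronglyMeasurable)
      (ig'.norm.const_mul C)
      (fun n => Filter.Eventually.of_forall fun z => (norm_inner_le_norm _ _).trans
        (mul_le_mul_of_nonneg_right (norm_mollify_le _ haC z) (norm_nonneg _))) ?_
    filter_upwards [ContDiffBump.ae_convolution_tendsto_right_of_locallyIntegrable hlim hratio
      ia.locallyIntegrable] with z hz
    exact hz.inner tendsto_const_nhds
  have heq : ∫ z, inner ℝ (b z) (f' z) = - ∫ z, inner ℝ (a z) (g' z) := by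
    refine tendsto_nhds_unique l1 ?_
    simp_rw [fun n => hrec (ρ n) (hle n)]
    exact l2.neg
  have z1 : ∀ y ∉ tsupport φ, φ y = 0 := fun y hy => image_eq_zero_of_notMem_tsupport hy
  have z2 : ∀ y ∉ tsupport φ, fderiv ℝ φ y v = 0 := fun y hy =>
    image_eq_zero_of_notMem_tsupport (f := fun z => fderiv ℝ φ z v)
      fun h => hy (tsupport_fderiv_apply_subset ℝ v h)
  have e1 : ∀ᵐ z, inner ℝ (b z) (f' z) = fderiv ℝ φ z v + φ z • (inner ℝ (f z) (g z) : ℝ) := by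
    filter_upwards [hn] with z hz
    by_cases hzK : z ∈ tsupport φ
    · rw [hb]
      simp only
      rw [← hff hzK, ← hgg hzK, inner_add_left, real_inner_smul_left, real_inner_smul_left,
        real_inner_self_eq_norm_sq, hz (hsub hzK), real_inner_comm]
      simp
    · simp [hb, z1 z hzK, z2 z hzK]
  have e2 : ∀ z, inner ℝ (a z) (g' z) = φ z • (inner ℝ (f z) (g z) : ℝ) := by
    intro z
    by_cases hzK : z ∈ tsupport φ
    · rw [ha]
      simp only
      rw [← hff hzK, ← hgg hzK, real_inner_smul_left, smul_eq_mul]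
    · simp [ha, z1 z hzK]
  have i2 : Integrable fun z => φ z • (inner ℝ (f z) (g z) : ℝ) := by
    rw [← integrableOn_iff_integrable_of_support_subset (s := halfSpace)]
    · exact integrableOn_halfSpace_smul hφ.continuous hcs hsub hloc
    · exact fun y hy => by_contra fun hy' => hy (by simp [z1 y fun h => hy' (hsub h)])
  -- With |f| = 1 the limit identity reads ∫∂φ + ∫φ f·g = -∫φ f·g, and ∫∂φ = 0. Hence 2∫φ f·g = 0.
  rw [integral_congr_ae e1, integral_congr_ae (Filter.Eventually.of_forall e2),
    integral_add (hdc.integrable_of_hasCompactSupport (hcs.fderiv_apply ℝ v)) i2,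
    integral_fderiv_apply_eq_zero hφ hcs, zero_add] at heq
  linarith

end LandauLifshitz
end

/-! ### Primitives in time and the meaning of the initial trace. -/

noncomputable section

namespace LandauLifshitz

/-- Both factors are absolutely continuous, `h` as the primitive of the continuous `h'` and the
other as the primitive of an integrable function. Integration by parts therefore holds with
derivatives taken almost everywhere. -/
theorem mul_primitive_sub_eq_integral {h h' f : ℝ → ℝ} {S : ℝ} (c : ℝ) (hS : 0 ≤ S)
    (hc : ContinuousOn h (Icc 0 S)) (hd : ∀ t ∈ Ioo 0 S, HasDerivAt h (h' t) t)
    (hc' : ContinuousOn h' (Icc 0 S)) (hf : IntervalIntegrable f volume 0 S) :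
    ∫ t in (0 : ℝ)..S, (h' t * (c + ∫ s in (0 : ℝ)..t, f s) + h t * f t) =
      h S * (c + ∫ s in (0 : ℝ)..S, f s) - h 0 * c := by
  have hi' : IntervalIntegrable h' volume 0 S := by
    apply ContinuousOn.intervalIntegrable; rwa [uIcc_of_le hS]
  have hh : ∀ t ∈ Icc 0 S, h t = h 0 + ∫ s in (0 : ℝ)..t, h' s := by
    intro t ht
    rw [intervalIntegral.integral_eq_sub_of_hasDerivAt_of_le ht.1
      (hc.mono (Icc_subset_Icc_right ht.2)) (fun s hs => hd s ⟨hs.1, hs.2.trans_le ht.2⟩)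
      (hi'.mono_set (by rw [uIcc_of_le hS, uIcc_of_le ht.1]; exact Icc_subset_Icc_right ht.2))]
    ring
  have h0 : (0 : ℝ) ∈ uIcc 0 S := left_mem_uIcc
  have a1 : AbsolutelyContinuousOnInterval (fun t => h 0 + ∫ s in (0 : ℝ)..t, h' s) 0 S :=
    contDiffOn_const.absolutelyContinuousOnInterval.fun_add
      (hi'.absolutelyContinuousOnInterval_intervalIntegral h0)
  have a2 : AbsolutelyContinuousOnInterval (fun t => c + ∫ s in (0 : ℝ)..t, f s) 0 S :=
    contDiffOn_const.absolutelyContinuousOnInterval.fun_add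
      (hf.absolutelyContinuousOnInterval_intervalIntegral h0)
  have key := a1.integral_deriv_mul_eq_sub a2
  simp only [intervalIntegral.integral_same, add_zero] at key
  rw [← hh S ⟨hS, le_rfl⟩] at key
  rw [← key]
  refine intervalIntegral.integral_congr_ae ?_
  filter_upwards [hi'.ae_hasDerivAt_integral, hf.ae_hasDerivAt_integral] with t h1 h2 ht
  have ht' : t ∈ uIcc 0 S := uIoc_subset_uIcc ht
  have d1 := ((h1 ht' 0 h0).const_add (h 0)).deriv
  have d2 := ((h2 ht' 0 h0).const_add c).deriv
  rw [d1, d2, ← hh t (by rwa [uIcc_of_le hS] at ht')]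

theorem proj_intervalIntegral {f : ℝ → E3} {a b : ℝ} (hf : IntervalIntegrable f volume a b)
    (j : Fin 3) : (∫ s in a..b, f s) j = ∫ s in a..b, f s j :=
  ((EuclideanSpace.proj (𝕜 := ℝ) j : E3 →L[ℝ] ℝ).intervalIntegral_comp_comm hf).symm

theorem intervalIntegrable_proj {f : ℝ → E3} {a b : ℝ} (hf : IntervalIntegrable f volume a b)
    (j : Fin 3) : IntervalIntegrable (fun s => f s j) volume a b :=
  ⟨(EuclideanSpace.proj (𝕜 := ℝ) j : E3 →L[ℝ] ℝ).integrable_comp hf.1,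
    (EuclideanSpace.proj (𝕜 := ℝ) j : E3 →L[ℝ] ℝ).integrable_comp hf.2⟩

theorem inner_primitive_sub_eq_integral {h h' f : ℝ → E3} {S : ℝ} (c : E3) (hS : 0 ≤ S)
    (hc : ContinuousOn h (Icc 0 S)) (hd : ∀ t ∈ Ioo 0 S, HasDerivAt h (h' t) t)
    (hc' : ContinuousOn h' (Icc 0 S)) (hf : IntervalIntegrable f volume 0 S) :
    ∫ t in (0 : ℝ)..S, (inner ℝ (h' t) (c + ∫ s in (0 : ℝ)..t, f s) + inner ℝ (h t) (f t) : ℝ) =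
      inner ℝ (h S) (c + ∫ s in (0 : ℝ)..S, f s) - inner ℝ (h 0) c := by
  have hp : ∀ j : Fin 3, Continuous fun a : E3 => a j := fun j =>
    (EuclideanSpace.proj (𝕜 := ℝ) j : E3 →L[ℝ] ℝ).continuous
  have key := fun j : Fin 3 => mul_primitive_sub_eq_integral (h := fun t => h t j)
    (h' := fun t => h' t j) (f := fun t => f t j) (c j) hS ((hp j).comp_continuousOn hc)
    (fun t ht => (EuclideanSpace.proj (𝕜 := ℝ) j : E3 →L[ℝ] ℝ).hasFDerivAt.comp_hasDerivAt t
      (hd t ht))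
    ((hp j).comp_continuousOn hc') (intervalIntegrable_proj hf j)
  have hsub : ∀ t ∈ uIcc 0 S, IntervalIntegrable f volume 0 t := fun t ht =>
    hf.mono_set (uIcc_subset_uIcc_left ht)
  have e : ∀ t ∈ uIcc 0 S,
      (inner ℝ (h' t) (c + ∫ s in (0 : ℝ)..t, f s) + inner ℝ (h t) (f t) : ℝ) =
        ∑ j, (h' t j * (c j + ∫ s in (0 : ℝ)..t, f s j) + h t j * f t j) := by
    intro t ht
    rw [inner_eq_sum, inner_eq_sum, ← Finset.sum_add_distrib]
    refine Finset.sum_congr rfl fun j _ => ?_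
    rw [PiLp.add_apply, proj_intervalIntegral (hsub t ht)]
  rw [intervalIntegral.integral_congr e, intervalIntegral.integral_finsetSum, inner_eq_sum,
    inner_eq_sum, ← Finset.sum_sub_distrib]
  · refine Finset.sum_congr rfl fun j _ => ?_
    rw [PiLp.add_apply, proj_intervalIntegral hf]
    exact key j
  · intro j _
    have c1 : ContinuousOn (fun t => c j + ∫ s in (0 : ℝ)..t, f s j) (uIcc 0 S) :=
      continuousOn_const.add (intervalIntegral.continuousOn_primitive_interval'
        (intervalIntegrable_proj hf j) left_mem_uIcc)
    rw [← uIcc_of_le hS] at hc hc'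
    exact (((hp j).comp_continuousOn hc').mul c1).intervalIntegrable.add
      ((intervalIntegrable_proj hf j).continuousOn_mul ((hp j).comp_continuousOn hc))

/-- The primitive in time, vanishing at the initial time. -/
def timePrimitive (f : ℝ × E3 → E3) (z : ℝ × E3) : E3 := ∫ s in (0 : ℝ)..z.1, f (s, z.2)

theorem setIntegral_Ioo_eq {F : Type*} [NormedAddCommGroup F] [NormedSpace ℝ F] {f : ℝ → F}
    {S : ℝ} (hS : 0 ≤ S) : ∫ t in Ioo 0 S, f t = ∫ t in (0 : ℝ)..S, f t := by
  rw [intervalIntegral.integral_of_le hS, integral_Ioc_eq_integral_Ioo]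

theorem intervalIntegrable_iff_Ioo {F : Type*} [NormedAddCommGroup F] {f : ℝ → F}
    {S : ℝ} (hS : 0 ≤ S) : IntervalIntegrable f volume 0 S ↔ IntegrableOn f (Ioo 0 S) :=
  intervalIntegrable_iff_integrableOn_Ioo_of_le hS

/-- The primitive is an integral over all of (0,S) against the indicator of {s < t}, so Fubini on
(time × space) × time gives its integrability. -/
theorem LocInt.timePrimitive {f : ℝ × E3 → E3} (hf : LocInt f) : LocInt (timePrimitive f) := by
  intro S K hK
  have h0 := hf S K hK
  rw [IntegrableOn, Measure.volume_eq_prod, ← Measure.prod_restrict] at h0 ⊢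
  set μ := (volume : Measure ℝ).restrict (Ioo 0 S)
  set ν := (volume : Measure E3).restrict K
  have hmp : MeasurePreserving (fun p : (ℝ × E3) × ℝ => (p.1.1, (p.2, p.1.2)))
      ((μ.prod ν).prod μ) (μ.prod (μ.prod ν)) :=
    ((MeasurePreserving.id μ).prod (Measure.measurePreserving_swap (μ := ν) (ν := μ))).comp
      (measurePreserving_prodAssoc μ ν μ)
  have h1 : Integrable (fun p : (ℝ × E3) × ℝ => f (p.2, p.1.2)) ((μ.prod ν).prod μ) :=
    hmp.integrable_comp_of_integrable (g := fun q : ℝ × (ℝ × E3) => f q.2) (h0.comp_snd μ)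
  have hms : MeasurableSet {p : (ℝ × E3) × ℝ | p.2 < p.1.1} :=
    measurableSet_lt measurable_snd (measurable_fst.comp measurable_fst)
  have h2 := (h1.indicator hms).integral_prod_left
  refine h2.congr ?_
  have hmem : ∀ᵐ z ∂(μ.prod ν), z ∈ Ioo 0 S ×ˢ K := by
    rw [Measure.prod_restrict]
    exact ae_restrict_mem (measurableSet_Ioo.prod hK.measurableSet)
  filter_upwards [hmem] with z hz
  have e : ∀ s, indicator {p : (ℝ × E3) × ℝ | p.2 < p.1.1}
      (fun p : (ℝ × E3) × ℝ => f (p.2, p.1.2)) (z, s) =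
      (Iio z.1).indicator (fun s => f (s, z.2)) s := by
    intro s
    by_cases h : s < z.1 <;> simp [indicator, h]
  simp_rw [e]
  rw [integral_indicator measurableSet_Iio, Measure.restrict_restrict measurableSet_Iio,
    LandauLifshitz.timePrimitive, ← setIntegral_Ioo_eq hz.1.1.le]
  congr 2
  ext s
  simp only [mem_inter_iff, mem_Iio, mem_Ioo]
  exact ⟨fun h => ⟨h.2.1, h.1⟩, fun h => ⟨h.2, h.1, h.2.trans hz.1.2⟩⟩

/-- The exceptional null set of points x must not depend on S, so Fubini is applied on countably
many cylinders. -/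
theorem LocInt.ae_intervalIntegrable {f : ℝ × E3 → E3} (hf : LocInt f) :
    ∀ᵐ x : E3, ∀ S : ℝ, 0 ≤ S → IntervalIntegrable (fun s => f (s, x)) volume 0 S := by
  have h : ∀ n : ℕ, ∀ᵐ x : E3, x ∈ Metric.closedBall (0 : E3) n →
      IntegrableOn (fun s => f (s, x)) (Ioo 0 (n : ℝ)) := by
    intro n
    have h0 := hf n _ (isCompact_closedBall (0 : E3) n)
    rw [IntegrableOn, Measure.volume_eq_prod, ← Measure.prod_restrict] at h0
    have := h0.prod_left_ae
    rwa [ae_restrict_iff' measurableSet_closedBall] at this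
  filter_upwards [ae_all_iff.2 h] with x hx S hS
  rw [intervalIntegrable_iff_Ioo hS]
  obtain ⟨n, hn⟩ := exists_nat_ge (max S ‖x‖)
  exact (hx n (by simpa using (le_max_right _ _).trans hn)).mono_set
    (Ioo_subset_Ioo_right ((le_max_left _ _).trans hn))

theorem integral_slab_symm {F : Type*} [NormedAddCommGroup F] [NormedSpace ℝ F] {S : ℝ}
    {f : ℝ × E3 → F} (hf : IntegrableOn f (slab S)) :
    ∫ z in slab S, f z = ∫ x, ∫ t in Ioo (0 : ℝ) S, f (t, x) := by
  rw [IntegrableOn, restrict_slab] at hf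
  rw [restrict_slab, integral_prod_symm _ hf]

theorem LocInt.add {F : Type*} [NormedAddCommGroup F] {f g : ℝ × E3 → F} (hf : LocInt f)
    (hg : LocInt g) : LocInt (fun z => f z + g z) :=
  fun S K hK => (hf S K hK).add (hg S K hK)

theorem LocInt.sub {F : Type*} [NormedAddCommGroup F] {f g : ℝ × E3 → F} (hf : LocInt f)
    (hg : LocInt g) : LocInt (fun z => f z - g z) :=
  fun S K hK => (hf S K hK).sub (hg S K hK)

theorem locInt_initial {m₀ : E3 → E3} (hm₀ : Continuous m₀) :
    LocInt fun z : ℝ × E3 => m₀ z.2 :=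
  locInt_of_continuousOn (hm₀.comp continuous_snd).continuousOn

/-- Integration by parts in time against a function that is a primitive in time. -/
theorem integral_slab_time {m₀ : E3 → E3} (hm₀ : Continuous m₀) {Vt : ℝ × E3 → E3}
    (hVt : LocInt Vt) {K : Set E3} (hK : IsCompact K) {H : ℝ × E3 → E3}
    (hH : ContDiffOn ℝ ∞ H closedHalfSpace) (hHK : SuppIn K H) {S : ℝ} (hS : 0 ≤ S) :
    ∫ z in slab S, (inner ℝ (dirDeriv timeDir H z) (m₀ z.2 + timePrimitive Vt z)
        + inner ℝ (H z) (Vt z) : ℝ) =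
      ∫ x, (inner ℝ (H (S, x)) (m₀ x + timePrimitive Vt (S, x)) - inner ℝ (H (0, x)) (m₀ x)) := by
  have hHt := hH.dirDeriv timeDir
  -- Space is put outside: for almost every x, what remains is a one-dimensional integration by
  -- parts in time.
  refine (integral_slab_symm ((((locInt_initial hm₀).add hVt.timePrimitive).integrableOn_inner hK
    (hHK.dirDeriv hK _) hHt.continuousOn S).add
      (hVt.integrableOn_inner hK hHK hH.continuousOn S))).trans ?_
  refine integral_congr_ae ?_
  filter_upwards [hVt.ae_intervalIntegrable] with x hx
  rw [setIntegral_Ioo_eq hS]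
  exact inner_primitive_sub_eq_integral (h := fun t => H (t, x))
    (h' := fun t => dirDeriv timeDir H (t, x)) (f := fun t => Vt (t, x)) (m₀ x) hS
    ((continuousOn_time hH.continuousOn x).mono Icc_subset_Ici_self)
    (fun t ht => hasDerivAt_time hH ht.1 x)
    ((continuousOn_time hHt.continuousOn x).mono Icc_subset_Ici_self) (hx S hS)

open scoped Convolution in
/-- A smooth function compactly supported in the half space is, there, the time derivative of a
smooth compactly supported function on the whole space. -/
theorem exists_fderiv_timeDir_eq {ψ : ℝ × E3 → ℝ} (hψ : ContDiff ℝ ∞ ψ)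
    (hcs : HasCompactSupport ψ) :
    ∃ φ : ℝ × E3 → ℝ, ContDiff ℝ ∞ φ ∧ HasCompactSupport φ ∧
      ∀ z ∈ halfSpace, fderiv ℝ φ z timeDir = ψ z := by
  set k := Prod.fst '' tsupport ψ with hk
  set K := Prod.snd '' tsupport ψ with hK
  have hkc : IsCompact k := hcs.isCompact.image continuous_fst
  have hKc : IsCompact K := hcs.isCompact.image continuous_snd
  obtain ⟨S, hS⟩ := hkc.isBounded.bddAbove
  have z1 : ∀ t x, t ∉ k → ψ (t, x) = 0 := fun t x ht =>
    image_eq_zero_of_notMem_tsupport fun h => ht ⟨_, h, rfl⟩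
  have z2 : ∀ t x, x ∉ K → ψ (t, x) = 0 := fun t x ht =>
    image_eq_zero_of_notMem_tsupport fun h => ht ⟨_, h, rfl⟩
  have z3 : ∀ t x, S < t → ψ (t, x) = 0 := fun t x ht => z1 t x fun h => (hS h).not_gt ht
  set g : E3 → ℝ → ℝ := fun x t => ψ (t, x) with hg
  -- Convolution with minus the indicator of (-∞,0) produces -∫_t^∞ ψ(s,x) ds, the primitive
  -- vanishing for large t. In this form smoothness in (x,t) follows from that of convolutions with
  -- a parameter.
  set f : ℝ → ℝ := (Iio 0).indicator fun _ => -1 with hf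
  have hfl : LocallyIntegrable f :=
    (locallyIntegrable_const (-1)).indicator measurableSet_Iio
  set P : E3 × ℝ → ℝ := fun q => (f ⋆[ContinuousLinearMap.mul ℝ ℝ, volume] g q.1) q.2 with hP
  have hPs : ContDiff ℝ ∞ P := by
    rw [← contDiffOn_univ, ← univ_prod_univ]
    refine contDiffOn_convolution_right_with_param (n := ⊤) (k := k) _ isOpen_univ hkc
      (fun p t _ ht => z1 t p ht) hfl ?_
    exact (hψ.comp (contDiff_snd.prodMk contDiff_fst)).contDiffOn
  have hPv : ∀ x t, t < S + 1 → P (x, t) = - ∫ s in t..(S + 1), ψ (s, x) := by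
    intro x t ht
    have hcx : Continuous fun s => ψ (s, x) := hψ.continuous.comp (by fun_prop)
    simp only [hP, convolution_eq_swap, hf, hg, ContinuousLinearMap.mul_apply']
    have e : ∀ s, (Iio (0 : ℝ)).indicator (fun _ => (-1 : ℝ)) (t - s) * ψ (s, x) =
        (Ioc t (S + 1)).indicator (fun s => - ψ (s, x)) s := by
      intro s
      by_cases h1 : t < s
      · by_cases h2 : s ≤ S + 1
        · simp [indicator, h1, h2]
        · simp [indicator, h1, h2, z3 s x (by linarith)]
      · simp [indicator, h1]
    simp_rw [e]
    rw [integral_indicator measurableSet_Ioc, integral_neg, intervalIntegral.integral_of_le ht.le]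
  have hP0 : ∀ x t, S < t → P (x, t) = 0 := by
    intro x t ht
    simp only [hP, convolution_eq_swap, hf, hg, ContinuousLinearMap.mul_apply']
    rw [← integral_zero ℝ ℝ]
    refine integral_congr_ae (Filter.Eventually.of_forall fun s => ?_)
    by_cases h1 : t < s
    · simp [z3 s x (ht.trans h1)]
    · simp [indicator, h1]
  have hPd : ∀ x t, HasDerivAt (fun s => P (x, s)) (ψ (t, x)) t := by
    intro x t
    rcases lt_or_ge t (S + 1) with ht | ht
    · have hcx : Continuous fun s => ψ (s, x) := hψ.continuous.comp (by fun_prop)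
      have h1 := (intervalIntegral.integral_hasDerivAt_left
        (hcx.intervalIntegrable t (S + 1)) (hcx.stronglyMeasurableAtFilter _ _)
        hcx.continuousAt).neg
      rw [neg_neg] at h1
      refine h1.congr_of_eventuallyEq ?_
      filter_upwards [Iio_mem_nhds ht] with s hs using hPv x s hs
    · rw [z3 t x (by linarith)]
      refine (hasDerivAt_const t (0 : ℝ)).congr_of_eventuallyEq ?_
      filter_upwards [Ioi_mem_nhds (show S < t by linarith)] with s hs using hP0 x s hs
  set r : ℝ := max (S + 1) 1 with hr
  have hr0 : 0 < r := lt_of_lt_of_le one_pos (le_max_right _ _)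
  -- The primitive need not vanish as t → -∞. The factor θ removes the far past; for t > 0 it
  -- changes nothing, since θ = 1 up to time r and the primitive is 0 after S < r.
  set θ : ContDiffBump (0 : ℝ) := ⟨r, r + 1, hr0, lt_add_one r⟩ with hθ
  have hθ1 : ∀ t, 0 < t → ∀ x, θ t * P (x, t) = P (x, t) := by
    intro t ht x
    rcases le_or_gt t r with h | h
    · rw [θ.one_of_mem_closedBall (by
        simpa [hθ, abs_of_pos ht] using h), one_mul]
    · rw [hP0 x t (by linarith [le_max_left (S + 1) 1]), mul_zero]
  refine ⟨fun z => θ z.1 * P (z.2, z.1), ?_, ?_, ?_⟩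
  · exact (θ.contDiff.comp contDiff_fst).mul (hPs.comp (contDiff_snd.prodMk contDiff_fst))
  · refine HasCompactSupport.of_support_subset_isCompact
      (θ.hasCompactSupport.isCompact.prod hKc) fun z hz => ?_
    refine ⟨subset_tsupport _ fun h => hz (by simp [h]), by_contra fun h => hz ?_⟩
    have : P (z.2, z.1) = 0 := by
      simp only [hP, convolution_eq_swap, hg, ContinuousLinearMap.mul_apply']
      simp [z2 _ _ h]
    simp [this]
  · rintro ⟨t, x⟩ hz
    have hdiff : DifferentiableAt ℝ (fun z : ℝ × E3 => θ z.1 * P (z.2, z.1)) (t, x) :=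
      ((θ.contDiff.comp contDiff_fst).mul
        (hPs.comp (contDiff_snd.prodMk contDiff_fst))).differentiable (by simp) _
    have h2 : HasDerivAt (fun s : ℝ => (s, x)) timeDir t :=
      (hasDerivAt_id t).prodMk (hasDerivAt_const t x)
    have h3 := hdiff.hasFDerivAt.comp_hasDerivAt t h2
    refine h3.unique ((hPd x t).congr_of_eventuallyEq ?_)
    filter_upwards [Ioi_mem_nhds (mem_halfSpace.1 hz)] with s hs using hθ1 s hs x

theorem LocInt.locallyIntegrableOn {F : Type*} [NormedAddCommGroup F] {f : ℝ × E3 → F}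
    (hf : LocInt f) : LocallyIntegrableOn f halfSpace := by
  rw [locallyIntegrableOn_iff isOpen_halfSpace.isLocallyClosed]
  intro k hk hkc
  obtain ⟨S, hS⟩ := (hkc.image continuous_fst).isBounded.bddAbove
  exact (hf (S + 1) _ (hkc.image continuous_snd)).mono_set fun z hz =>
    ⟨⟨(hk hz).1, (hS ⟨z, hz, rfl⟩).trans_lt (lt_add_one S)⟩, ⟨z, hz, rfl⟩⟩

theorem integral_const_inner {c : E3} {μ : Measure (ℝ × E3)} {φ : ℝ × E3 → ℝ} {f : ℝ × E3 → E3}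
    (hf : Integrable (fun z => φ z • f z) μ) :
    ∫ z, φ z * inner ℝ c (f z) ∂μ = inner ℝ c (∫ z, φ z • f z ∂μ) := by
  rw [← integral_inner hf]
  simp_rw [real_inner_smul_right]

/-- Both m and V = m₀ + ∫₀ᵗ∂ₜm satisfy Green's formula with the same boundary term, so ∂ₜφ is
orthogonal to m - V for every φ, including those not vanishing at time 0. Every test function on the
half space is such a ∂ₜφ there. -/
theorem HasInitialTrace.ae_eq_primitive {m mt : ℝ × E3 → E3} {m₀ : E3 → E3}
    (h : HasInitialTrace m mt m₀) (hm₀ : Continuous m₀) (hm : LocInt m) (hmt : LocInt mt) :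
    ∀ᵐ z ∂(volume.restrict halfSpace), m z = m₀ z.2 + timePrimitive mt z := by
  set V : ℝ × E3 → E3 := fun z => m₀ z.2 + timePrimitive mt z with hV
  have hVl : LocInt V := (locInt_initial hm₀).add hmt.timePrimitive
  have key : ∀ c : E3, ∀ᵐ z, z ∈ halfSpace → inner ℝ c (m z - V z) = (0 : ℝ) := by
    intro c
    refine isOpen_halfSpace.ae_eq_zero_of_integral_contDiff_smul_eq_zero ?_
      fun ψ hψ hcs hsub => ?_
    · refine LocInt.locallyIntegrableOn fun S K hK => ?_
      exact ((hm.sub hVl) S K hK).const_inner c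
    obtain ⟨φ, hφ, hφc, hφψ⟩ := exists_fderiv_timeDir_eq hψ hcs
    set K := Prod.snd '' tsupport φ with hKdef
    have hK : IsCompact K := hφc.isCompact.image continuous_snd
    obtain ⟨S', hS'⟩ := (hφc.isCompact.image continuous_fst).isBounded.bddAbove
    -- Beyond the time support of φ, so that the boundary term at time S vanishes.
    set S := max S' 0 + 1 with hSdef
    have hS0 : 0 ≤ S := by positivity
    have zt : ∀ z : ℝ × E3, S ≤ z.1 → z ∉ tsupport φ := fun z hz hz' => by
      have := hS' ⟨z, hz', rfl⟩
      linarith [le_max_left S' 0]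
    have zφ : ∀ z : ℝ × E3, z ∉ tsupport φ → φ z = 0 := fun z hz =>
      image_eq_zero_of_notMem_tsupport hz
    have zφ' : ∀ z : ℝ × E3, z ∉ tsupport φ → fderiv ℝ φ z timeDir = 0 := fun z hz =>
      image_eq_zero_of_notMem_tsupport (f := fun z => fderiv ℝ φ z timeDir)
        fun h => hz (tsupport_fderiv_apply_subset ℝ timeDir h)
    have hφd : Continuous fun z => fderiv ℝ φ z timeDir :=
      (hφ.continuous_fderiv (by simp)).clm_apply continuous_const
    have sφ : SuppIn K φ := fun z _ hz => zφ z fun h => hz ⟨z, h, rfl⟩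
    have sφ' : SuppIn K fun z => fderiv ℝ φ z timeDir :=
      fun z _ hz => zφ' z fun h => hz ⟨z, h, rfl⟩
    have hdiff : ∀ z ∈ halfSpace \ slab S, S ≤ z.1 := fun z hz => by
      by_contra! hlt
      exact hz.2 ⟨⟨hz.1.1, hlt⟩, mem_univ _⟩
    have ismul : ∀ {a : ℝ × E3 → ℝ} {f : ℝ × E3 → E3}, Continuous a → SuppIn K a → LocInt f →
        IntegrableOn (fun z => a z • f z) (slab S) := fun ha hs hf =>
      LocInt.integrableOn_slab_of_le hK hs ha.continuousOn hf S
        (ha.aestronglyMeasurable.smul (hf.aestronglyMeasurable S)) fun z => (norm_smul _ _).le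
    have htr := h φ hφ hφc
    rw [setIntegral_eq_of_subset_of_forall_sdiff_eq_zero measurableSet_halfSpace
        (slab_subset_halfSpace S) (fun z hz => by rw [zφ' z (zt z (hdiff z hz)), zero_smul]),
      setIntegral_eq_of_subset_of_forall_sdiff_eq_zero measurableSet_halfSpace
        (slab_subset_halfSpace S) (fun z hz => by rw [zφ z (zt z (hdiff z hz)), zero_smul])] at htr
    have htr' := congrArg (fun a => (inner ℝ c a : ℝ)) htr
    simp only [inner_sub_right, inner_neg_right] at htr'
    have i0 : Integrable fun x => φ (0, x) • m₀ x := by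
      have hc0 : Continuous fun x => φ (0, x) := hφ.continuous.comp (by fun_prop)
      refine (hc0.smul hm₀).integrable_of_hasCompactSupport
        (HasCompactSupport.of_support_subset_isCompact hK fun x hx => by_contra fun hx' => hx ?_)
      simp [sφ (0, x) (mem_closedHalfSpace.2 le_rfl) hx']
    rw [← integral_const_inner (ismul hφd sφ' hm), ← integral_const_inner (ismul hφ.continuous sφ hmt),
      ← integral_inner i0] at htr'
    have hHs : ContDiffOn ℝ ∞ (fun z => φ z • c) closedHalfSpace :=
      (hφ.smul contDiff_const).contDiffOn
    have hibp := integral_slab_time hm₀ hmt hK hHs (fun z hz hz' => by simp [sφ z hz hz']) hS0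
    have e1 : ∀ z ∈ slab S, (inner ℝ (dirDeriv timeDir (fun z => φ z • c) z)
        (m₀ z.2 + timePrimitive mt z) + inner ℝ (φ z • c) (mt z) : ℝ) =
        fderiv ℝ φ z timeDir * inner ℝ c (V z) + φ z * inner ℝ c (mt z) := by
      intro z hz
      rw [dirDeriv_eq_fderiv (slab_subset_halfSpace S hz),
        fderiv_fun_smul (hφ.differentiable (by simp) z) (by fun_prop)]
      simp [real_inner_smul_left, hV]
    rw [setIntegral_congr_fun (measurableSet_slab S) e1] at hibp
    have jm : ∀ {a : ℝ × E3 → ℝ} {f : ℝ × E3 → E3}, Continuous a → SuppIn K a → LocInt f →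
        IntegrableOn (fun z => a z * inner ℝ c (f z)) (slab S) := fun ha hs hf => by
      have := (ismul ha hs hf).const_inner (𝕜 := ℝ) c
      simpa only [IntegrableOn, real_inner_smul_right] using this
    rw [integral_add (jm hφd sφ' hVl) (jm hφ.continuous sφ hmt)] at hibp
    have e2 : ∀ x, (inner ℝ (φ (S, x) • c) (m₀ x + timePrimitive mt (S, x))
        - inner ℝ (φ (0, x) • c) (m₀ x) : ℝ) = - inner ℝ c (φ (0, x) • m₀ x) := by
      intro x
      rw [zφ (S, x) (zt (S, x) le_rfl)]
      simp [real_inner_smul_left, real_inner_smul_right]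
    simp_rw [e2] at hibp
    rw [integral_neg] at hibp
    have e3 : ∫ z, ψ z • (inner ℝ c (m z - V z) : ℝ) =
        (∫ z in slab S, fderiv ℝ φ z timeDir * inner ℝ c (m z))
          - ∫ z in slab S, fderiv ℝ φ z timeDir * inner ℝ c (V z) := by
      rw [← integral_sub (jm hφd sφ' hm) (jm hφd sφ' hVl),
        ← setIntegral_eq_integral_of_forall_compl_eq_zero (s := halfSpace)
          (fun z hz => by
            rw [image_eq_zero_of_notMem_tsupport fun h => hz (hsub h), zero_smul])]
      rw [setIntegral_eq_of_subset_of_forall_sdiff_eq_zero measurableSet_halfSpace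
        (slab_subset_halfSpace S) (fun z hz => by
          rw [← hφψ z hz.1, zφ' z (zt z (hdiff z hz)), zero_smul])]
      refine setIntegral_congr_fun (measurableSet_slab S) fun z hz => ?_
      rw [← hφψ z (slab_subset_halfSpace S hz), inner_sub_right, smul_eq_mul, mul_sub]
    rw [e3]
    linarith
  rw [ae_restrict_iff' measurableSet_halfSpace]
  -- Three vectors c, those of the basis, suffice to identify m and V.
  filter_upwards [ae_all_iff.2 fun i => key (basisVec i)] with z hz hz'
  refine sub_eq_zero.1 (PiLp.ext fun i => ?_)
  simpa [hV, basisVec, EuclideanSpace.inner_single_left] using hz i hz'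

end LandauLifshitz
end

/-! ### Evolution of a weak space derivative paired with a smooth field. -/

noncomputable section

namespace LandauLifshitz

theorem integral_inner_fderiv_space {G m₀ : E3 → E3} (hG : ContDiff ℝ ∞ G)
    (hGc : HasCompactSupport G) (hm₀ : ContDiff ℝ ∞ m₀) (e : E3) :
    ∫ x, (inner ℝ (G x) (fderiv ℝ m₀ x e) : ℝ) = - ∫ x, inner ℝ (fderiv ℝ G x e) (m₀ x) := by
  have c1 : Continuous fun x => fderiv ℝ G x e :=
    (hG.continuous_fderiv (by simp)).clm_apply continuous_const
  have c2 : Continuous fun x => fderiv ℝ m₀ x e :=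
    (hm₀.continuous_fderiv (by simp)).clm_apply continuous_const
  have hs : ∀ {f g : E3 → E3}, HasCompactSupport f →
      HasCompactSupport fun x => (inner ℝ (f x) (g x) : ℝ) := fun hf =>
    hf.mono fun x hx h => hx (by simp [h])
  have hi : ∀ {f g : E3 → E3}, Continuous f → Continuous g → HasCompactSupport f →
      Integrable fun x => (innerSL ℝ (f x)) (g x) := fun hf hg h =>
    (hf.inner (𝕜 := ℝ) hg).integrable_of_hasCompactSupport (hs h)
  have := integral_bilinear_fderiv_right_eq_neg_left_of_integrable (μ := volume) (v := e)
    (B := innerSL ℝ) (f := G) (g := m₀) (hi c1 hm₀.continuous (hGc.fderiv_apply ℝ e))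
    (hi hG.continuous c2 hGc) (hi hG.continuous hm₀.continuous hGc)
    (fun x _ => hG.differentiable (by simp) x) (fun x _ => hm₀.differentiable (by simp) x)
  exact this

/-- The evolution of `∫ G · ∂ᵢV` for a smooth `G`. -/
theorem integral_slice_inner_eq {m₀ : E3 → E3} (hm₀ : ContDiff ℝ ∞ m₀) {i : Fin 3}
    {V Vt Vi : ℝ × E3 → E3} (hw : IsWeakDeriv (spaceDir i) V Vi) (hV : LocInt V)
    (hVt : LocInt Vt) (hVi : LocInt Vi)
    (hrep : ∀ᵐ z ∂(volume.restrict halfSpace), V z = m₀ z.2 + timePrimitive Vt z)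
    {K : Set E3} (hK : IsCompact K) {G : ℝ × E3 → E3} (hG : ContDiffOn ℝ ∞ G closedHalfSpace)
    (hGK : SuppIn K G) :
    ∀ᵐ S ∂(volume.restrict (Ioi (0 : ℝ))),
      ∫ x, (inner ℝ (G (S, x)) (Vi (S, x)) : ℝ) =
        (∫ x, (inner ℝ (G (0, x)) (fderiv ℝ m₀ x (basisVec i)) : ℝ)) +
          ∫ z in slab S, (inner ℝ (dirDeriv timeDir G z) (Vi z)
            - inner ℝ (dirDeriv (spaceDir i) G z) (Vt z) : ℝ) := by
  -- Formally, ∫G·∂ᵢV = -∫H·V with H = ∂ᵢG. The right side is differentiated in time, V being a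
  -- primitive in time, and the term ∂ₜH·V is then integrated back by parts in space. Thus only ∂ₜV
  -- and ∂ᵢV occur, never ∂ₜ∂ᵢV.
  set H := dirDeriv (spaceDir i) G with hHdef
  have hH : ContDiffOn ℝ ∞ H closedHalfSpace := hG.dirDeriv _
  have hHK : SuppIn K H := hGK.dirDeriv hK _
  have hGt := hG.dirDeriv timeDir
  have hGtK : SuppIn K (dirDeriv timeDir G) := hGK.dirDeriv hK _
  have hHt := hH.dirDeriv timeDir
  have hHtK : SuppIn K (dirDeriv timeDir H) := hHK.dirDeriv hK _
  have hPl : LocInt fun z : ℝ × E3 => m₀ z.2 + timePrimitive Vt z :=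
    (locInt_initial hm₀.continuous).add hVt.timePrimitive
  have r2 : ∀ᵐ t ∂(volume.restrict (Ioi (0 : ℝ))), ∀ᵐ x : E3,
      V (t, x) = m₀ x + timePrimitive Vt (t, x) := by
    rw [restrict_halfSpace] at hrep
    exact Measure.ae_ae_of_ae_prod hrep
  have r3 : ∀ᵐ t ∂(volume.restrict (Ioi (0 : ℝ))),
      Integrable fun x => (inner ℝ (H (t, x)) (m₀ x + timePrimitive Vt (t, x)) : ℝ) :=
    ae_Ioi_of_forall_Ioo fun S =>
      ae_integrable_slice (hPl.integrableOn_inner hK hHK hH.continuousOn S)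
  filter_upwards [integral_slice_space hw hV hVi hK hG hGK, r2, r3,
    ae_restrict_mem measurableSet_Ioi] with S h1 h2 h3 hS
  have hS0 : 0 ≤ S := le_of_lt hS
  have t1 := integral_slab_time hm₀.continuous hVt hK hH hHK hS0
  have i1 := hPl.integrableOn_inner hK hHtK hHt.continuousOn S
  have i2 := hVt.integrableOn_inner hK hHK hH.continuousOn S
  have i3 := hVi.integrableOn_inner hK hGtK hGt.continuousOn S
  have c0 : ContDiff ℝ ∞ fun x => G (0, x) := contDiff_space hG le_rfl
  have s0 : HasCompactSupport fun x => G (0, x) :=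
    HasCompactSupport.of_support_subset_isCompact hK fun x hx => by_contra fun h =>
      hx (hGK (0, x) (mem_closedHalfSpace.2 le_rfl) h)
  have hH0 : ∀ x, fderiv ℝ (fun y => G (0, y)) x (basisVec i) = H (0, x) := fun x =>
    fderiv_space_apply hG le_rfl x i
  have i0 : Integrable fun x => (inner ℝ (H (0, x)) (m₀ x) : ℝ) := by
    refine ((contDiff_space hH le_rfl).continuous.inner hm₀.continuous)
      |>.integrable_of_hasCompactSupport (HasCompactSupport.of_support_subset_isCompact hK
        fun x hx => by_contra fun h => hx ?_)
    simp [hHK (0, x) (mem_closedHalfSpace.2 le_rfl) h]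
  have hinit := integral_inner_fderiv_space c0 s0 hm₀ (basisVec i)
  simp_rw [hH0] at hinit
  rw [integral_add i1 i2, integral_sub h3 i0] at t1
  have e1 : ∫ z in slab S, (inner ℝ (dirDeriv timeDir H z) (m₀ z.2 + timePrimitive Vt z) : ℝ) =
      - ∫ z in slab S, (inner ℝ (dirDeriv timeDir G z) (Vi z) : ℝ) := by
    -- Mixed derivatives of `G` commute, which puts the space derivative outside and allows the
    -- integration by parts against V.
    have e2 : ∫ z in slab S, (inner ℝ (dirDeriv timeDir H z) (m₀ z.2 + timePrimitive Vt z) : ℝ) =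
        ∫ z in slab S, (inner ℝ (dirDeriv (spaceDir i) (dirDeriv timeDir G) z) (V z) : ℝ) := by
      refine integral_congr_ae ?_
      filter_upwards [ae_restrict_of_ae_restrict_of_subset (slab_subset_halfSpace S) hrep,
        ae_restrict_mem (measurableSet_slab S)] with z hz hzS
      rw [← hz, hHdef, dirDeriv_comm hG _ _ (slab_subset_halfSpace S hzS)]
    rw [e2, integral_slab_space hw hV hVi hK hGt hGtK]
  have e3 : ∫ x, (inner ℝ (H (S, x)) (V (S, x)) : ℝ) =
      ∫ x, (inner ℝ (H (S, x)) (m₀ x + timePrimitive Vt (S, x)) : ℝ) := by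
    refine integral_congr_ae ?_
    filter_upwards [h2] with x hx
    rw [hx]
  rw [integral_sub i3 i2]
  linarith

end LandauLifshitz
end

/-! ### The vector product, and admissible test fields for the weak formulation. -/

noncomputable section

namespace LandauLifshitz

theorem wedge_apply_zero (a b : E3) : wedge a b 0 = a 1 * b 2 - a 2 * b 1 := by
  simp [wedge, cross_apply]

theorem wedge_apply_one (a b : E3) : wedge a b 1 = a 2 * b 0 - a 0 * b 2 := by
  simp [wedge, cross_apply]

theorem wedge_apply_two (a b : E3) : wedge a b 2 = a 0 * b 1 - a 1 * b 0 := by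
  simp [wedge, cross_apply]

theorem inner_wedge_wedge (a b c d : E3) :
    inner ℝ (wedge a b) (wedge c d) =
      (inner ℝ a c * inner ℝ b d - inner ℝ a d * inner ℝ b c : ℝ) := by
  simp only [inner_eq_sum, Fin.sum_univ_three, wedge_apply_zero, wedge_apply_one, wedge_apply_two]
  ring

/-- The triple product is invariant under cyclic permutations. -/
theorem inner_wedge_cycle (a b c : E3) :
    inner ℝ a (wedge b c) = (inner ℝ b (wedge c a) : ℝ) := by
  simp only [inner_eq_sum, Fin.sum_univ_three, wedge_apply_zero, wedge_apply_one, wedge_apply_two]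
  ring

theorem inner_wedge_swap (a b c : E3) :
    inner ℝ a (wedge b c) = - (inner ℝ (wedge b a) c : ℝ) := by
  simp only [inner_eq_sum, Fin.sum_univ_three, wedge_apply_zero, wedge_apply_one, wedge_apply_two]
  ring

theorem norm_wedge_le (a b : E3) : ‖wedge a b‖ ≤ ‖a‖ * ‖b‖ := by
  have h := inner_wedge_wedge a b a b
  rw [real_inner_self_eq_norm_sq, real_inner_self_eq_norm_sq, real_inner_self_eq_norm_sq,
    real_inner_comm] at h
  refine le_of_sq_le_sq ?_ (by positivity)
  nlinarith [sq_nonneg (inner ℝ b a : ℝ), real_inner_comm a b]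

/-- The vector product as a continuous bilinear map. -/
def wedgeL : E3 →L[ℝ] E3 →L[ℝ] E3 :=
  (LinearMap.mk₂ ℝ wedge (fun a b c => by simp [wedge]) (fun r a b => by simp [wedge])
    (fun a b c => by simp [wedge]) (fun r a b => by simp [wedge])).mkContinuous₂ 1
    fun a b => (norm_wedge_le a b).trans (by rw [one_mul])

theorem wedgeL_apply (a b : E3) : wedgeL a b = wedge a b := rfl

theorem _root_.MeasureTheory.AEStronglyMeasurable.wedge {α : Type*} [MeasurableSpace α]
    {μ : Measure α} {f g : α → E3} (hf : AEStronglyMeasurable f μ)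
    (hg : AEStronglyMeasurable g μ) : AEStronglyMeasurable (fun z => wedge (f z) (g z)) μ :=
  wedgeL.aestronglyMeasurable_comp₂ hf hg

theorem locallyIntegrableOn_wedge {f Φ : ℝ × E3 → E3} (hf : LocallyIntegrableOn f halfSpace)
    (hΦ : ContinuousOn Φ closedHalfSpace) :
    LocallyIntegrableOn (fun z => wedge (f z) (Φ z)) halfSpace := by
  rw [locallyIntegrableOn_iff isOpen_halfSpace.isLocallyClosed]
  intro k hk hkc
  have hΦk : ContinuousOn Φ k := hΦ.mono (hk.trans halfSpace_subset_closedHalfSpace)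
  obtain ⟨C, hC⟩ := hkc.exists_bound_of_continuousOn hΦk
  have hfk := hf.integrableOn_compact_subset hk hkc
  refine (hfk.norm.const_mul C).mono'
    (hfk.aestronglyMeasurable.wedge (hΦk.aestronglyMeasurable hkc.measurableSet)) ?_
  filter_upwards [ae_restrict_mem hkc.measurableSet] with z hz
  refine (norm_wedge_le _ _).trans ?_
  rw [mul_comm]
  exact mul_le_mul_of_nonneg_right (hC z hz) (norm_nonneg _)

/-- Since c·(f∧Φ) = f·(Φ∧c), the product rule for a smooth factor reduces to testing the weak
derivative of f with φ(Φ∧c), for every fixed vector c. -/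
theorem IsWeakDeriv.wedge {v : ℝ × E3} {f g Φ : ℝ × E3 → E3} (h : IsWeakDeriv v f g)
    (hΦ : ContDiffOn ℝ ∞ Φ closedHalfSpace) :
    IsWeakDeriv v (fun z => wedge (f z) (Φ z))
      (fun z => LandauLifshitz.wedge (g z) (Φ z) +
        LandauLifshitz.wedge (f z) (dirDeriv v Φ z)) := by
  have l1 := locallyIntegrableOn_wedge h.1 hΦ.continuousOn
  have l2 := locallyIntegrableOn_wedge h.2.1 hΦ.continuousOn
  have l3 := locallyIntegrableOn_wedge h.1 (hΦ.dirDeriv v).continuousOn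
  refine ⟨l1, l2.add l3, fun φ hφ hcs hsub => ?_⟩
  have hφd : Continuous fun z => fderiv ℝ φ z v :=
    (hφ.continuous_fderiv (by simp)).clm_apply continuous_const
  have i1 := integrableOn_halfSpace_smul hφd (hcs.fderiv_apply ℝ v)
    ((tsupport_fderiv_apply_subset ℝ v).trans hsub) l1
  have i2 : IntegrableOn (fun z => φ z • (LandauLifshitz.wedge (g z) (Φ z) +
      LandauLifshitz.wedge (f z) (dirDeriv v Φ z))) halfSpace :=
    integrableOn_halfSpace_smul hφ.continuous hcs hsub (l2.add l3)
  refine ext_inner_left ℝ fun c => ?_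
  rw [inner_neg_right, ← integral_const_inner i1, ← integral_const_inner i2]
  set Θ : ℝ × E3 → E3 := fun z => φ z • wedgeL (Φ z) c with hΘ
  have hts : tsupport Θ ⊆ tsupport φ := tsupport_smul_subset_left _ _
  have hΘs : ContDiff ℝ ∞ Θ := contDiff_of_forall_tsupport fun z hz =>
    hφ.contDiffAt.smul ((wedgeL.contDiff.contDiffAt.comp z
      (hΦ.contDiffAt_halfSpace (hsub (hts hz)))).clm_apply contDiffAt_const)
  have hw := h.integral_inner hΘs (hcs.isCompact.of_isClosed_subset (isClosed_tsupport _) hts)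
    (hts.trans hsub)
  have hd : ∀ z ∈ halfSpace, fderiv ℝ Θ z v =
      φ z • LandauLifshitz.wedge (dirDeriv v Φ z) c +
        fderiv ℝ φ z v • LandauLifshitz.wedge (Φ z) c := by
    intro z hz
    have h1 : HasFDerivAt (fun z => wedgeL (Φ z) c) _ z :=
      (wedgeL.flip c).hasFDerivAt.comp z
        ((hΦ.contDiffAt_halfSpace hz).differentiableAt (by simp)).hasFDerivAt
    have h2 : HasFDerivAt Θ _ z := (hφ.differentiable (by simp) z).hasFDerivAt.smul h1
    rw [h2.fderiv, dirDeriv_eq_fderiv hz]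
    simp [wedgeL_apply]
  have e1 : ∀ z ∈ halfSpace, (inner ℝ (fderiv ℝ Θ z v) (f z) : ℝ) =
      φ z * inner ℝ c (LandauLifshitz.wedge (f z) (dirDeriv v Φ z)) +
        fderiv ℝ φ z v * inner ℝ c (LandauLifshitz.wedge (f z) (Φ z)) := by
    intro z hz
    rw [hd z hz, inner_add_left, real_inner_smul_left, real_inner_smul_left,
      inner_wedge_cycle c (f z), inner_wedge_cycle c (f z), real_inner_comm, real_inner_comm (f z)]
  have e2 : ∀ z, (inner ℝ (Θ z) (g z) : ℝ) =
      φ z * inner ℝ c (LandauLifshitz.wedge (g z) (Φ z)) := by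
    intro z
    rw [hΘ, real_inner_smul_left, wedgeL_apply, inner_wedge_cycle c (g z), real_inner_comm]
  have j : ∀ {a : ℝ × E3 → ℝ} {F : ℝ × E3 → E3}, IntegrableOn (fun z => a z • F z) halfSpace →
      IntegrableOn (fun z => a z * inner ℝ c (F z)) halfSpace := fun h => by
    have := h.const_inner (𝕜 := ℝ) c
    simpa only [IntegrableOn, real_inner_smul_right] using this
  have j1 := j i1
  have j2 := j (integrableOn_halfSpace_smul hφ.continuous hcs hsub l2)
  have j3 := j (integrableOn_halfSpace_smul hφ.continuous hcs hsub l3)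
  rw [setIntegral_congr_fun measurableSet_halfSpace e1, integral_add j3 j1] at hw
  simp_rw [e2] at hw
  simp_rw [inner_add_right, mul_add]
  rw [integral_add j2 j3]
  linarith

theorem SuppIn.memLp {K : Set E3} (hK : IsCompact K) {Φ : ℝ × E3 → E3} (h : SuppIn K Φ)
    (hc : ContinuousOn Φ closedHalfSpace) (p : ENNReal) (S : ℝ) :
    MemLp Φ p (volume.restrict (slab S)) := by
  obtain ⟨C, -, hC⟩ := h.exists_bound hK hc S
  have hsub : Ioo (0 : ℝ) S ×ˢ K ⊆ slab S := prod_mono subset_rfl (subset_univ _)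
  have hms : MeasurableSet (Ioo (0 : ℝ) S ×ˢ K) := measurableSet_Ioo.prod hK.measurableSet
  have hfin : IsFiniteMeasure ((volume : Measure (ℝ × E3)).restrict (Ioo 0 S ×ˢ K)) := by
    refine ⟨?_⟩
    rw [Measure.restrict_apply_univ, Measure.volume_eq_prod, Measure.prod_prod]
    exact ENNReal.mul_lt_top measure_Ioo_lt_top hK.measure_lt_top
  have h1 : MemLp Φ p (volume.restrict (Ioo 0 S ×ˢ K)) := by
    refine MemLp.of_bound ((aestronglyMeasurable_slab_of_continuousOn hc S).mono_measure
      (Measure.restrict_mono hsub le_rfl)) C ?_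
    filter_upwards [ae_restrict_mem hms] with z hz
    exact hC z ⟨hz.1.1.le, mem_univ _⟩ hz.1.2.le
  have h2 : MemLp ((Ioo (0 : ℝ) S ×ˢ K).indicator Φ) p (volume.restrict (slab S)) := by
    rw [memLp_indicator_iff_restrict hms, Measure.restrict_restrict hms, inter_eq_left.2 hsub]
    exact h1
  refine h2.ae_eq ?_
  filter_upwards [ae_restrict_mem (measurableSet_slab S)] with z hz
  by_cases hzK : z.2 ∈ K
  · exact indicator_of_mem (show z ∈ Ioo (0 : ℝ) S ×ˢ K from ⟨hz.1, hzK⟩) Φ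
  · rw [indicator_of_notMem fun hz' => hzK hz'.2,
      h z (halfSpace_subset_closedHalfSpace (slab_subset_halfSpace S hz)) hzK]

/-- Global membership in H¹ is required of test fields, whereas weak solutions are controlled on
bounded time intervals only. Vanishing at late times bridges the two. -/
theorem memLp_halfSpace_of_slab {f : ℝ × E3 → E3} {p : ENNReal} {S : ℝ}
    (hf : MemLp f p (volume.restrict (slab S)))
    (h0 : ∀ z ∈ halfSpace, S ≤ z.1 → f z = 0) : MemLp f p (volume.restrict halfSpace) := by
  have h2 : MemLp ((slab S).indicator f) p (volume.restrict halfSpace) := by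
    rw [memLp_indicator_iff_restrict (measurableSet_slab S),
      Measure.restrict_restrict (measurableSet_slab S), inter_eq_left.2 (slab_subset_halfSpace S)]
    exact hf
  refine h2.ae_eq ?_
  filter_upwards [ae_restrict_mem measurableSet_halfSpace] with z hz
  by_cases hzS : z ∈ slab S
  · exact indicator_of_mem hzS f
  · rw [indicator_of_notMem hzS, h0 z hz]
    by_contra! hlt
    exact hzS ⟨⟨hz.1, hlt⟩, mem_univ _⟩

theorem _root_.MeasureTheory.MemLp.integrable_inner_two {α : Type*} [MeasurableSpace α]
    {μ : Measure α} {f g : α → E3} (hf : MemLp f 2 μ) (hg : MemLp g 2 μ) :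
    Integrable (fun z => (inner ℝ (f z) (g z) : ℝ)) μ :=
  (hf.norm.integrable_mul hg.norm).mono' (hf.1.inner hg.1)
    (Filter.Eventually.of_forall fun _ => norm_inner_le_norm _ _)

section WeakSolution

variable {m₀ : E3 → E3} {m mt : ℝ × E3 → E3} {mx : Fin 3 → ℝ × E3 → E3}

theorem IsGlobalWeakSolution.ae_norm (h : IsGlobalWeakSolution m₀ m mt mx) (S : ℝ) :
    ∀ᵐ z ∂(volume.restrict (slab S)), ‖m z‖ = 1 :=
  ae_restrict_of_ae_restrict_of_subset (slab_subset_halfSpace S) h.norm_eq_one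

theorem IsGlobalWeakSolution.aestronglyMeasurable (h : IsGlobalWeakSolution m₀ m mt mx) (S : ℝ) :
    AEStronglyMeasurable m (volume.restrict (slab S)) :=
  h.weak_dt.1.aestronglyMeasurable.mono_measure
    (Measure.restrict_mono (slab_subset_halfSpace S) le_rfl)

theorem IsGlobalWeakSolution.memLp_dx (h : IsGlobalWeakSolution m₀ m mt mx) {S : ℝ} (hS : 0 < S)
    (i : Fin 3) : MemLp (mx i) 2 (volume.restrict (slab S)) := by
  have hm : AEStronglyMeasurable (mx i) (volume.restrict (slab S)) :=
    (h.weak_dx i).2.1.aestronglyMeasurable.mono_measure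
      (Measure.restrict_mono (slab_subset_halfSpace S) le_rfl)
  refine ⟨hm, ?_⟩
  rw [eLpNorm_lt_top_iff_lintegral_rpow_enorm_lt_top two_ne_zero ENNReal.ofNat_ne_top]
  obtain ⟨C, hC⟩ := h.bound_dx S hS
  have hm' := hm
  rw [restrict_slab] at hm' ⊢
  rw [lintegral_prod _ (hm'.enorm.pow_const _)]
  calc ∫⁻ t in Ioo 0 S, ∫⁻ x, ‖mx i (t, x)‖ₑ ^ (2 : ENNReal).toReal
      ≤ ∫⁻ _t in Ioo (0 : ℝ) S, (C : ENNReal) := by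
        refine lintegral_mono_ae ?_
        filter_upwards [hC] with t ht
        refine (lintegral_mono fun x => ?_).trans ht
        have : ‖mx i (t, x)‖ₑ ^ (2 : ENNReal).toReal = ‖mx i (t, x)‖ₑ ^ 2 := by simp
        rw [this]
        exact Finset.single_le_sum (f := fun i => ‖mx i (t, x)‖ₑ ^ 2) (fun _ _ => zero_le)
          (Finset.mem_univ i)
    _ < ⊤ := by
        rw [setLIntegral_const]
        exact ENNReal.mul_lt_top ENNReal.coe_lt_top measure_Ioo_lt_top

theorem locInt_of_memLp {f : ℝ × E3 → E3}
    (h : ∀ S, 0 < S → MemLp f 2 (volume.restrict (slab S))) : LocInt f := by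
  intro S K hK
  have hsub : Ioo (0 : ℝ) S ×ˢ K ⊆ slab (max S 1) :=
    prod_mono (Ioo_subset_Ioo_right (le_max_left _ _)) (subset_univ _)
  have hfin : IsFiniteMeasure ((volume : Measure (ℝ × E3)).restrict (Ioo 0 S ×ˢ K)) := by
    refine ⟨?_⟩
    rw [Measure.restrict_apply_univ, Measure.volume_eq_prod, Measure.prod_prod]
    exact ENNReal.mul_lt_top measure_Ioo_lt_top hK.measure_lt_top
  exact ((h (max S 1) (lt_max_of_lt_right one_pos)).mono_measure
    (Measure.restrict_mono hsub le_rfl)).integrable one_le_two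

theorem IsGlobalWeakSolution.locInt_dt (h : IsGlobalWeakSolution m₀ m mt mx) : LocInt mt :=
  locInt_of_memLp h.memLp_dt

theorem IsGlobalWeakSolution.locInt_dx (h : IsGlobalWeakSolution m₀ m mt mx) (i : Fin 3) :
    LocInt (mx i) :=
  locInt_of_memLp fun _ hS => h.memLp_dx hS i

theorem IsGlobalWeakSolution.locInt (h : IsGlobalWeakSolution m₀ m mt mx) : LocInt m := by
  intro S K hK
  have hsub : Ioo (0 : ℝ) S ×ˢ K ⊆ slab S := prod_mono subset_rfl (subset_univ _)
  have hfin : IsFiniteMeasure ((volume : Measure (ℝ × E3)).restrict (Ioo 0 S ×ˢ K)) := by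
    refine ⟨?_⟩
    rw [Measure.restrict_apply_univ, Measure.volume_eq_prod, Measure.prod_prod]
    exact ENNReal.mul_lt_top measure_Ioo_lt_top hK.measure_lt_top
  exact Integrable.of_bound ((h.aestronglyMeasurable S).mono_measure
    (Measure.restrict_mono hsub le_rfl)) 1
    ((ae_restrict_of_ae_restrict_of_subset hsub (h.ae_norm S)).mono fun z hz => hz.le)

/-- The weak formulation tested against `m ∧ Φ`. -/
theorem IsGlobalWeakSolution.weak_eq_wedge (h : IsGlobalWeakSolution m₀ m mt mx)
    {K : Set E3} (hK : IsCompact K) {Φ : ℝ × E3 → E3} (hΦ : ContDiffOn ℝ ∞ Φ closedHalfSpace)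
    (hΦK : SuppIn K Φ) {N : ℝ} (hN : 0 < N) (hΦN : ∀ z ∈ closedHalfSpace, N ≤ z.1 → Φ z = 0)
    {S : ℝ} (hS : 0 < S) :
    IntegrableOn (fun z => (inner ℝ (mt z - wedge (m z) (mt z)) (Φ z) : ℝ) +
        2 * ∑ i, (inner ℝ (mx i z) (dirDeriv (spaceDir i) Φ z)
          - ‖mx i z‖ ^ 2 * inner ℝ (m z) (Φ z))) (slab S) ∧
    ∫ z in slab S, ((inner ℝ (mt z - wedge (m z) (mt z)) (Φ z) : ℝ) +
        2 * ∑ i, (inner ℝ (mx i z) (dirDeriv (spaceDir i) Φ z)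
          - ‖mx i z‖ ^ 2 * inner ℝ (m z) (Φ z))) = 0 := by
  set Ψ : ℝ × E3 → E3 := fun z => wedge (m z) (Φ z) with hΨ
  set D : (ℝ × E3) → (ℝ × E3 → E3) → ℝ × E3 → E3 := fun v g z =>
    wedge (g z) (Φ z) + wedge (m z) (dirDeriv v Φ z) with hD
  -- The margin 1 past N ensures that Φ vanishes in a whole neighbourhood, hence so does its
  -- derivative.
  have hΦd : ∀ v, ∀ z ∈ closedHalfSpace, N + 1 ≤ z.1 → dirDeriv v Φ z = 0 := by
    intro v z hz hzN
    refine dirDeriv_eq_zero_of_eventuallyEq ?_ hz v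
    have h1 : {y : ℝ × E3 | N < y.1} ∈ nhds z :=
      (isOpen_Ioi.preimage continuous_fst).mem_nhds (show N < z.1 by linarith)
    filter_upwards [mem_nhdsWithin_of_mem_nhds h1, self_mem_nhdsWithin] with y hy hy'
      using hΦN y hy' (le_of_lt hy)
  have mW : ∀ {S : ℝ} {Θ : ℝ × E3 → E3}, ContinuousOn Θ closedHalfSpace → SuppIn K Θ →
      MemLp (fun z => wedge (m z) (Θ z)) 2 (volume.restrict (slab S)) := fun {S Θ} hc hs => by
    refine (hs.memLp hK hc 2 S).of_le ((h.aestronglyMeasurable S).wedge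
      (aestronglyMeasurable_slab_of_continuousOn hc S)) ?_
    filter_upwards [h.ae_norm S] with z hz
    simpa [hz] using norm_wedge_le (m z) (Θ z)
  have mG : ∀ {S : ℝ} {g : ℝ × E3 → E3}, MemLp g 2 (volume.restrict (slab S)) →
      MemLp (fun z => wedge (g z) (Φ z)) 2 (volume.restrict (slab S)) := fun {S g} hg => by
    obtain ⟨C, -, hC⟩ := hΦK.exists_bound hK hΦ.continuousOn S
    refine hg.of_le_mul (c := C) (hg.1.wedge
      (aestronglyMeasurable_slab_of_continuousOn hΦ.continuousOn S)) ?_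
    filter_upwards [ae_restrict_mem (measurableSet_slab S)] with z hz
    refine (norm_wedge_le _ _).trans ?_
    rw [mul_comm]
    exact mul_le_mul_of_nonneg_right (hC z (halfSpace_subset_closedHalfSpace
      (slab_subset_halfSpace S hz)) hz.1.2.le) (norm_nonneg _)
  have mD : ∀ {S : ℝ} (v : ℝ × E3) {g : ℝ × E3 → E3}, MemLp g 2 (volume.restrict (slab S)) →
      MemLp (D v g) 2 (volume.restrict (slab S)) := fun v g hg =>
    (mG hg).add (mW (hΦ.dirDeriv v).continuousOn (hΦK.dirDeriv hK v))
  have hN1 : 0 < N + 1 := by linarith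
  have D0 : ∀ v g, ∀ z ∈ halfSpace, N + 1 ≤ z.1 → D v g z = 0 := fun v g z hz hzN => by
    have hz' := halfSpace_subset_closedHalfSpace hz
    rw [hD]
    simp only
    rw [hΦN z hz' (by linarith), hΦd v z hz' hzN, ← wedgeL_apply, ← wedgeL_apply, map_zero,
      map_zero, add_zero]
  -- The product m∧Φ is admissible because Φ has bounded support in space and time, while |m| = 1
  -- and the derivatives of m are square integrable on slabs.
  have hH1 : IsH1 Ψ (D timeDir mt) (fun i => D (spaceDir i) (mx i)) :=
    { weak_dt := h.weak_dt.wedge hΦ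
      weak_dx := fun i => (h.weak_dx i).wedge hΦ
      memLp := memLp_halfSpace_of_slab (mW (S := N + 1) hΦ.continuousOn hΦK) fun z hz hzN => by
        rw [hΨ]
        simp only
        rw [hΦN z (halfSpace_subset_closedHalfSpace hz) (by linarith), ← wedgeL_apply, map_zero]
      memLp_dt := memLp_halfSpace_of_slab (mD timeDir (h.memLp_dt _ hN1)) (D0 _ _)
      memLp_dx := fun i => memLp_halfSpace_of_slab (mD (spaceDir i) (h.memLp_dx hN1 i)) (D0 _ _) }
  have hw := h.weak_eq Ψ _ _ hH1 S hS
  have mwedge : ∀ {g : ℝ × E3 → E3}, MemLp g 2 (volume.restrict (slab S)) →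
      MemLp (fun z => wedge (m z) (g z)) 2 (volume.restrict (slab S)) := fun {g} hg => by
    refine hg.of_le ((h.aestronglyMeasurable S).wedge hg.1) ?_
    filter_upwards [h.ae_norm S] with z hz
    simpa [hz] using norm_wedge_le (m z) (g z)
  have iA : IntegrableOn (fun z => (inner ℝ (mt z + wedge (m z) (mt z)) (Ψ z) : ℝ)) (slab S) :=
    ((h.memLp_dt S hS).add (mwedge (h.memLp_dt S hS))).integrable_inner_two
      (mW hΦ.continuousOn hΦK)
  have iB : ∀ i, IntegrableOn (fun z => (inner ℝ (wedge (m z) (mx i z))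
      (D (spaceDir i) (mx i) z) : ℝ)) (slab S) := fun i =>
    (mwedge (h.memLp_dx hS i)).integrable_inner_two (mD _ (h.memLp_dx hS i))
  have iC : IntegrableOn (fun z => (inner ℝ (mt z + wedge (m z) (mt z)) (Ψ z) : ℝ) +
      2 * ∑ i, (inner ℝ (wedge (m z) (mx i z)) (D (spaceDir i) (mx i) z))) (slab S) :=
    iA.add ((integrable_finsetSum _ fun i _ => iB i).const_mul 2)
  have hzero : ∫ z in slab S, ((inner ℝ (mt z + wedge (m z) (mt z)) (Ψ z) : ℝ) +
      2 * ∑ i, (inner ℝ (wedge (m z) (mx i z)) (D (spaceDir i) (mx i) z))) = 0 := by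
    rw [integral_add iA ((integrable_finsetSum _ fun i _ => iB i).const_mul 2),
      integral_const_mul, integral_finsetSum _ fun i _ => iB i, hw]
    ring
  -- By Lagrange's identity with |m| = 1 and m·∂m = 0, (m∧∂ₜm)·(m∧Φ) = ∂ₜm·Φ and (m∧∂ᵢm)·∂ᵢ(m∧Φ) =
  -- ∂ᵢm·∂ᵢΦ - |∂ᵢm|² m·Φ.
  have hae : (fun z => (inner ℝ (mt z + wedge (m z) (mt z)) (Ψ z) : ℝ) +
      2 * ∑ i, (inner ℝ (wedge (m z) (mx i z)) (D (spaceDir i) (mx i) z)))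
      =ᵐ[volume.restrict (slab S)] fun z => (inner ℝ (mt z - wedge (m z) (mt z)) (Φ z) : ℝ) +
        2 * ∑ i, (inner ℝ (mx i z) (dirDeriv (spaceDir i) Φ z)
          - ‖mx i z‖ ^ 2 * inner ℝ (m z) (Φ z)) := by
    have o1 := ae_restrict_of_ae_restrict_of_subset (slab_subset_halfSpace S)
      (h.weak_dt.inner_eq_zero h.norm_eq_one)
    have o2 := fun i => ae_restrict_of_ae_restrict_of_subset (slab_subset_halfSpace S)
      ((h.weak_dx i).inner_eq_zero h.norm_eq_one)
    filter_upwards [h.ae_norm S, o1, ae_all_iff.2 o2] with z hz h1 h2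
    have hzz : (inner ℝ (m z) (m z) : ℝ) = 1 := by rw [real_inner_self_eq_norm_sq, hz, one_pow]
    have h1' : (inner ℝ (mt z) (m z) : ℝ) = 0 := by rw [real_inner_comm, h1]
    congr 1
    · rw [hΨ]
      simp only
      rw [inner_add_left, inner_sub_left, inner_wedge_wedge, hzz, h1',
        inner_wedge_swap (mt z) (m z)]
      ring
    · congr 1
      refine Finset.sum_congr rfl fun i _ => ?_
      have h2' : (inner ℝ (mx i z) (m z) : ℝ) = 0 := by rw [real_inner_comm, h2 i]
      rw [hD]
      simp only
      rw [inner_add_right, inner_wedge_wedge, inner_wedge_wedge, hzz, h2 i, h2',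
        real_inner_self_eq_norm_sq]
      ring
  exact ⟨iC.congr hae, by rw [← integral_congr_ae hae, hzero]⟩

end WeakSolution

end LandauLifshitz
end

/-! ### Truncation of smooth solutions in time, and spatial cutoffs. -/

noncomputable section

namespace LandauLifshitz

theorem wedge_wedge_self (a b : E3) :
    wedge a (wedge a b) = (inner ℝ a b : ℝ) • a - (inner ℝ a a : ℝ) • b := by
  refine PiLp.ext fun j => ?_
  rw [PiLp.sub_apply, PiLp.smul_apply, PiLp.smul_apply, smul_eq_mul, smul_eq_mul, inner_eq_sum,
    inner_eq_sum, Fin.sum_univ_three, Fin.sum_univ_three]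
  match j with
  | 0 => rw [wedge_apply_zero, wedge_apply_one, wedge_apply_two]; ring
  | 1 => rw [wedge_apply_one, wedge_apply_zero, wedge_apply_two]; ring
  | 2 => rw [wedge_apply_two, wedge_apply_one, wedge_apply_zero]; ring

theorem inner_self_wedge (a b : E3) : (inner ℝ a (wedge a b) : ℝ) = 0 := by
  simp only [inner_eq_sum, Fin.sum_univ_three, wedge_apply_zero, wedge_apply_one, wedge_apply_two]
  ring

/-- The Landau–Lifshitz equation solved for the Laplacian. -/
theorem two_smul_laplacian_eq {a p L : E3} {q : ℝ} (ha : (inner ℝ a a : ℝ) = 1)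
    (hap : (inner ℝ a p : ℝ) = 0) (haL : (inner ℝ a L : ℝ) = -q)
    (h : p + wedge a p = (2 : ℝ) • wedge a L) :
    (2 : ℝ) • L = p - wedge a p - (2 * q) • a := by
  -- Applying a∧ to the equation inverts it up to the component along a, and that component is
  -- prescribed by a·L = -q.
  have h1 := congrArg (fun b => wedgeL a b) h
  simp only [map_add, map_smul, wedgeL_apply, wedge_wedge_self, ha, hap, haL] at h1
  rw [zero_smul, one_smul, one_smul, zero_sub, smul_sub, smul_smul] at h1
  have h2 : (2 : ℝ) • L = ((2 * -q) • a) - (wedge a p + -p) := by rw [h1]; abel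
  rw [h2, mul_neg, neg_smul]
  abel

/-- A solution, smooth on `[0,∞) × ℝ³` and of bounded support in time, of the Landau–Lifshitz
equation on `(0,T) × ℝ³`. -/
structure IsTruncatedSolution (T : ℝ) (m₀ : E3 → E3) (u : ℝ × E3 → E3) : Prop where
  smooth : ContDiffOn ℝ ∞ u closedHalfSpace
  vanish : ∃ N : ℝ, 0 < N ∧ ∀ z ∈ closedHalfSpace, N ≤ z.1 → u z = 0
  initial : ∀ x, u (0, x) = m₀ x
  norm_eq_one : ∀ z ∈ slab T, ‖u z‖ = 1
  orthogonal_dt : ∀ z ∈ slab T, inner ℝ (u z) (dirDeriv timeDir u z) = (0 : ℝ)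
  equation : ∀ z ∈ slab T, (2 : ℝ) • ∑ i, dirDeriv (spaceDir i) (dirDeriv (spaceDir i) u) z =
    dirDeriv timeDir u z - wedge (u z) (dirDeriv timeDir u z)
      - (2 * ∑ i, ‖dirDeriv (spaceDir i) u z‖ ^ 2) • u z
  bounded : ∃ M : ℝ, ∀ z ∈ slab T, ‖dirDeriv timeDir u z‖ ≤ M ∧
    ∀ i, ‖dirDeriv (spaceDir i) u z‖ ≤ M

theorem isOpen_slab (S : ℝ) : IsOpen (slab S) := isOpen_Ioo.prod isOpen_univ

theorem norm_timeDir : ‖timeDir‖ ≤ 1 := by simp [timeDir, Prod.norm_def]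

theorem norm_spaceDir (i : Fin 3) : ‖spaceDir i‖ ≤ 1 := by
  simp [spaceDir, basisVec, Prod.norm_def]

theorem laplacian_space {f : ℝ × E3 → E3} (hf : ContDiffOn ℝ ∞ f closedHalfSpace) {t : ℝ}
    (ht : 0 ≤ t) (x : E3) :
    Laplacian.laplacian (fun y => f (t, y)) x =
      ∑ i, dirDeriv (spaceDir i) (dirDeriv (spaceDir i) f) (t, x) := by
  rw [InnerProductSpace.laplacian_eq_iteratedFDeriv_orthonormalBasis _
    (EuclideanSpace.basisFun (Fin 3) ℝ)]
  refine Finset.sum_congr rfl fun i _ => ?_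
  rw [iteratedFDeriv_two_apply]
  simp only [Matrix.cons_val_zero, Matrix.cons_val_one, EuclideanSpace.basisFun_apply]
  change fderiv ℝ (fderiv ℝ fun y => f (t, y)) x (basisVec i) (basisVec i) = _
  have hs := contDiff_space hf ht
  have h1 : (fun y => fderiv ℝ (fun y => f (t, y)) y (basisVec i)) =
      fun y => dirDeriv (spaceDir i) f (t, y) := funext fun y => fderiv_space_apply hf ht y i
  have h2 : DifferentiableAt ℝ (fderiv ℝ fun y => f (t, y)) x :=
    (hs.fderiv_right (m := ∞) (by simp)).differentiable (by simp) x
  rw [← fderiv_space_apply (hf.dirDeriv _) ht, ← h1, fderiv_clm_apply h2 (by fun_prop)]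
  simp

/-- Multiplication by a cutoff in time, equal to 1 on [0,T'] and 0 before T, gives a field smooth
for all times and usable in test functions. The geometric relations follow from the equation: its
scalar product with u gives u·∂ₜu = 0, so |u| keeps its initial value 1; differentiating |u|² = 1
twice in space then gives u·∂ᵢ∂ᵢu = -|∂ᵢu|². -/
theorem IsSmoothSolution.exists_truncation {T : ℝ} {m₀ : E3 → E3} {m : ℝ × E3 → E3}
    (h : IsSmoothSolution T m₀ m) (hm₀ : ∀ x, ‖m₀ x‖ = 1) {T' : ℝ} (hT' : 0 < T') (hT : T' < T) :
    ∃ u, IsTruncatedSolution T' m₀ u ∧ ∀ z ∈ slab T', u z = m z := by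
  set T'' := (T' + T) / 2 with hT''
  have h1 : T' < T'' := by rw [hT'']; linarith
  have h2 : T'' < T := by rw [hT'']; linarith
  set θ : ContDiffBump (0 : ℝ) := ⟨T', T'', hT', h1⟩ with hθ
  have θ1 : ∀ t, 0 ≤ t → t ≤ T' → θ t = 1 := fun t h0 ht =>
    θ.one_of_mem_closedBall (by simpa [hθ, abs_of_nonneg h0] using ht)
  have θ0 : ∀ t, T'' ≤ t → θ t = 0 := fun t ht =>
    θ.zero_of_le_dist (by simpa [hθ] using ht.trans (le_abs_self t))
  set u : ℝ × E3 → E3 := fun z => θ z.1 • m z with hu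
  have hum : ∀ z ∈ slab T', u z = m z := fun z hz => by
    rw [hu]; simp only; rw [θ1 z.1 hz.1.1.le hz.1.2.le, one_smul]
  have hs : ContDiffOn ℝ ∞ u closedHalfSpace := by
    intro z hz
    rcases lt_or_ge z.1 T with hzT | hzT
    · have hm : ContDiffWithinAt ℝ ∞ m closedHalfSpace z := by
        refine (h.smooth z ⟨⟨hz.1, hzT⟩, mem_univ _⟩).mono_of_mem_nhdsWithin ?_
        have : {y : ℝ × E3 | y.1 < T} ∈ nhds z :=
          (isOpen_Iio.preimage continuous_fst).mem_nhds hzT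
        filter_upwards [mem_nhdsWithin_of_mem_nhds this, self_mem_nhdsWithin] with y hy hy'
        exact ⟨⟨hy'.1, hy⟩, mem_univ _⟩
      exact ((θ.contDiff.comp contDiff_fst).contDiffAt.contDiffWithinAt).smul hm
    · refine ContDiffAt.contDiffWithinAt ?_
      refine (contDiffAt_const (c := (0 : E3))).congr_of_eventuallyEq ?_
      have : {y : ℝ × E3 | T'' < y.1} ∈ nhds z :=
        (isOpen_Ioi.preimage continuous_fst).mem_nhds (show T'' < z.1 by linarith)
      filter_upwards [this] with y hy
      rw [hu]; simp only; rw [θ0 y.1 (le_of_lt hy), zero_smul]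
  have hev : ∀ z ∈ slab T', u =ᶠ[nhds z] m := fun z hz => by
    filter_upwards [(isOpen_slab T').mem_nhds hz] with y hy using hum y hy
  have hdu : ∀ z ∈ slab T', ∀ v, dirDeriv v u z = fderiv ℝ m z v := fun z hz v => by
    rw [dirDeriv_eq_fderiv (slab_subset_halfSpace _ hz), (hev z hz).fderiv_eq]
  have hinit : ∀ x, u (0, x) = m₀ x := fun x => by
    rw [hu]; simp only; rw [θ1 0 le_rfl hT'.le, one_smul, h.initial]
  have heq : ∀ z ∈ slab T', dirDeriv timeDir u z + wedge (u z) (dirDeriv timeDir u z) =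
      (2 : ℝ) • wedge (u z) (∑ i, dirDeriv (spaceDir i) (dirDeriv (spaceDir i) u) z) := by
    rintro ⟨t, x⟩ hz
    have ht := mem_slab.1 hz
    have e := h.equation t ⟨ht.1, ht.2.trans hT⟩ x
    have d1 : deriv (fun s => m (s, x)) t = dirDeriv timeDir u (t, x) := by
      refine ((hasDerivAt_time hs ht.1 x).congr_of_eventuallyEq ?_).deriv
      filter_upwards [Ioo_mem_nhds ht.1 ht.2] with s hs using (hum (s, x) (mem_slab.2 hs)).symm
    have d2 : (fun y => m (t, y)) = fun y => u (t, y) :=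
      funext fun y => (hum (t, y) (mem_slab.2 ht)).symm
    rw [d1, d2, laplacian_space hs ht.1.le, ← hum _ hz] at e
    exact e
  have horth : ∀ z ∈ slab T', inner ℝ (u z) (dirDeriv timeDir u z) = (0 : ℝ) := fun z hz => by
    have e := congrArg (fun b => (inner ℝ (u z) b : ℝ)) (heq z hz)
    simpa [inner_add_right, real_inner_smul_right, inner_self_wedge] using e
  have hnorm2 : ∀ z ∈ slab T', (inner ℝ (u z) (u z) : ℝ) = 1 := by
    rintro ⟨t, x⟩ hz
    have ht := mem_slab.1 hz
    have hin : ContDiffOn ℝ ∞ (fun z => (inner ℝ (u z) (u z) : ℝ)) closedHalfSpace :=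
      hs.inner ℝ hs
    -- The derivative of |u|² in time is 2u·∂ₜu = 0.
    have hd : ∀ s ∈ Ioo 0 t, HasDerivAt (fun s => (inner ℝ (u (s, x)) (u (s, x)) : ℝ)) 0 s := by
      intro s hs'
      have hsl : (s, x) ∈ slab T' := mem_slab.2 ⟨hs'.1, hs'.2.trans ht.2⟩
      have := hasDerivAt_time hin hs'.1 x
      have ho : (inner ℝ (dirDeriv timeDir u (s, x)) (u (s, x)) : ℝ) = 0 := by
        rw [real_inner_comm, horth _ hsl]
      rwa [dirDeriv_inner hs hs _ (halfSpace_subset_closedHalfSpace (slab_subset_halfSpace _ hsl)),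
        ho, horth _ hsl, zero_add] at this
    have := intervalIntegral.integral_eq_sub_of_hasDerivAt_of_le ht.1.le
      ((continuousOn_time hin.continuousOn x).mono Icc_subset_Ici_self) hd (by simp)
    rw [intervalIntegral.integral_zero, hinit, real_inner_self_eq_norm_sq (m₀ x), hm₀] at this
    linarith
  have hux : ∀ z ∈ slab T', ∀ i, (inner ℝ (u z) (dirDeriv (spaceDir i) u z) : ℝ) = 0 := by
    intro z hz i
    have hzc := halfSpace_subset_closedHalfSpace (slab_subset_halfSpace _ hz)
    have e := dirDeriv_inner hs hs (spaceDir i) hzc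
    have hc : (fun z => (inner ℝ (u z) (u z) : ℝ)) =ᶠ[nhds z] fun _ => 1 := by
      filter_upwards [(isOpen_slab T').mem_nhds hz] with y hy using hnorm2 y hy
    rw [dirDeriv_eq_fderiv (slab_subset_halfSpace _ hz), hc.fderiv_eq,
      real_inner_comm (u z) (dirDeriv (spaceDir i) u z)] at e
    simp at e
    linarith
  have huxx : ∀ z ∈ slab T', ∀ i,
      (inner ℝ (u z) (dirDeriv (spaceDir i) (dirDeriv (spaceDir i) u) z) : ℝ) =
        - ‖dirDeriv (spaceDir i) u z‖ ^ 2 := by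
    intro z hz i
    have hzc := halfSpace_subset_closedHalfSpace (slab_subset_halfSpace _ hz)
    have e := dirDeriv_inner hs (hs.dirDeriv (spaceDir i)) (spaceDir i) hzc
    have hc : (fun z => (inner ℝ (u z) (dirDeriv (spaceDir i) u z) : ℝ)) =ᶠ[nhds z] fun _ => 0 := by
      filter_upwards [(isOpen_slab T').mem_nhds hz] with y hy using hux y hy i
    rw [dirDeriv_eq_fderiv (slab_subset_halfSpace _ hz), hc.fderiv_eq,
      real_inner_self_eq_norm_sq] at e
    simp at e
    linarith
  refine ⟨u, ⟨hs, ⟨T'', hT'.trans h1, fun z _ hz => ?_⟩, hinit, fun z hz => ?_, horth,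
    fun z hz => ?_, ?_⟩, hum⟩
  · rw [hu]; simp only; rw [θ0 z.1 hz, zero_smul]
  · have := hnorm2 z hz
    rw [real_inner_self_eq_norm_sq] at this
    exact (pow_eq_one_iff_of_nonneg (norm_nonneg _) two_ne_zero).1 this
  · refine two_smul_laplacian_eq (hnorm2 z hz) (horth z hz) ?_ (heq z hz)
    rw [inner_sum, ← Finset.sum_neg_distrib]
    exact Finset.sum_congr rfl fun i _ => huxx z hz i
  · obtain ⟨C, hC⟩ := h.bounded T' hT 1 (by simp)
    have hC' : ∀ z ∈ slab T', ∀ v : ℝ × E3, ‖v‖ ≤ 1 → ‖dirDeriv v u z‖ ≤ C := by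
      intro z hz v hv
      have h3 := hC z hz
      rw [norm_iteratedFDeriv_one] at h3
      rw [hdu z hz]
      exact ((fderiv ℝ m z).le_of_opNorm_le_of_le h3 hv).trans (by rw [mul_one])
    exact ⟨C, fun z hz => ⟨hC' z hz _ norm_timeDir, fun i => hC' z hz _ (norm_spaceDir i)⟩⟩

/-- A smooth cutoff function at scale `R`. -/
structure IsCutoff (L R : ℝ) (χ : E3 → ℝ) : Prop where
  smooth : ContDiff ℝ ∞ χ
  nonneg : ∀ x, 0 ≤ χ x
  le_one : ∀ x, χ x ≤ 1
  eq_one : ∀ x, ‖x‖ ≤ R → χ x = 1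
  eq_zero : ∀ x, 2 * R ≤ ‖x‖ → χ x = 0
  sq_fderiv_le : ∀ i x, (fderiv ℝ χ x (basisVec i)) ^ 2 ≤ (L / R) ^ 2 * χ x

/-- Squaring a bump η(x/R) gives ∂χ = 2η∂η/R, hence |∂χ|² ≤ (2C/R)²χ with C a bound for the
derivative of η. This lets a term with ∂χ be absorbed into one weighted by χ. -/
theorem exists_isCutoff : ∃ L : ℝ, 0 ≤ L ∧ ∀ R : ℝ, 0 < R → ∃ χ, IsCutoff L R χ := by
  set η : ContDiffBump (0 : E3) := ⟨1, 2, one_pos, one_lt_two⟩ with hη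
  have hηs : ContDiff ℝ ∞ η := η.contDiff
  obtain ⟨C, hC⟩ := (η.hasCompactSupport.fderiv (𝕜 := ℝ)).exists_bound_of_continuous
    (hηs.continuous_fderiv (by simp))
  have hC0 : 0 ≤ C := (norm_nonneg _).trans (hC 0)
  refine ⟨2 * C, by positivity, fun R hR => ⟨fun x => η (R⁻¹ • x) ^ 2, ?_⟩⟩
  have hnorm : ∀ x : E3, ‖R⁻¹ • x‖ = ‖x‖ / R := fun x => by
    rw [norm_smul, norm_inv, Real.norm_of_nonneg hR.le]; field_simp
  have hsm : ContDiff ℝ ∞ fun x : E3 => η (R⁻¹ • x) := hηs.comp (contDiff_const_smul _)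
  refine ⟨hsm.pow 2, fun x => sq_nonneg _, fun x => ?_, fun x hx => ?_, fun x hx => ?_,
    fun i x => ?_⟩
  · exact pow_le_one₀ η.nonneg η.le_one
  · rw [η.one_of_mem_closedBall, one_pow]
    rw [mem_closedBall_zero_iff, hnorm]
    exact (div_le_one hR).2 hx
  · rw [η.zero_of_le_dist, zero_pow two_ne_zero]
    rw [dist_zero_right, hnorm]
    exact (le_div_iff₀ hR).2 hx
  · have h1 : HasFDerivAt (fun x : E3 => η (R⁻¹ • x))
        ((fderiv ℝ η (R⁻¹ • x)).comp (R⁻¹ • ContinuousLinearMap.id ℝ E3)) x :=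
      (hηs.differentiable (by simp) _).hasFDerivAt.comp x ((hasFDerivAt_id x).const_smul R⁻¹)
    have h2 := h1.pow 2
    rw [h2.fderiv]
    have hb : |fderiv ℝ η (R⁻¹ • x) (basisVec i)| ≤ C := by
      refine ((fderiv ℝ η (R⁻¹ • x)).le_of_opNorm_le_of_le (hC _)
        (show ‖basisVec i‖ ≤ 1 by simp [basisVec])).trans (by rw [mul_one])
    have hb2 : (fderiv ℝ η (R⁻¹ • x) (basisVec i)) ^ 2 ≤ C ^ 2 :=
      sq_le_sq' (abs_le.1 hb).1 (abs_le.1 hb).2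
    simp only [smul_apply, ContinuousLinearMap.comp_apply, map_smul,
      ContinuousLinearMap.id_apply, smul_eq_mul, nsmul_eq_mul]
    calc _ = (4 * R⁻¹ ^ 2 * η (R⁻¹ • x) ^ 2) * (fderiv ℝ η (R⁻¹ • x) (basisVec i)) ^ 2 := by
          push_cast; ring
      _ ≤ (4 * R⁻¹ ^ 2 * η (R⁻¹ • x) ^ 2) * C ^ 2 := by gcongr
      _ = _ := by rw [div_eq_mul_inv]; ring

end LandauLifshitz
end

/-! ### The localized cross term and the localized energy identity. -/

noncomputable section

namespace LandauLifshitz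

variable {L R T : ℝ} {χ : E3 → ℝ} {m₀ : E3 → E3} {u : ℝ × E3 → E3}

theorem IsCutoff.suppIn_smul (hχ : IsCutoff L R χ) {F : Type*} [NormedAddCommGroup F]
    [NormedSpace ℝ F] (f : ℝ × E3 → F) :
    SuppIn (Metric.closedBall (0 : E3) (2 * R)) fun z => χ z.2 • f z := by
  intro z _ hz
  rw [Metric.mem_closedBall, dist_zero_right, not_le] at hz
  simp only
  rw [hχ.eq_zero _ hz.le, zero_smul]

theorem IsCutoff.contDiffOn_smul (hχ : IsCutoff L R χ) {F : Type*} [NormedAddCommGroup F]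
    [NormedSpace ℝ F] {f : ℝ × E3 → F} (hf : ContDiffOn ℝ ∞ f closedHalfSpace) :
    ContDiffOn ℝ ∞ (fun z => χ z.2 • f z) closedHalfSpace :=
  (contDiffOn_spatial hχ.smooth).smul hf

theorem IsCutoff.dirDeriv_smul_time (hχ : IsCutoff L R χ) {f : ℝ × E3 → E3}
    (hf : ContDiffOn ℝ ∞ f closedHalfSpace) {z : ℝ × E3} (hz : z ∈ closedHalfSpace) :
    dirDeriv timeDir (fun z => χ z.2 • f z) z = χ z.2 • dirDeriv timeDir f z := by
  rw [dirDeriv_smul (contDiffOn_spatial hχ.smooth) hf _ hz, dirDeriv_spatial hχ.smooth _ hz]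
  simp [timeDir]

theorem IsCutoff.dirDeriv_smul_space (hχ : IsCutoff L R χ) {f : ℝ × E3 → E3}
    (hf : ContDiffOn ℝ ∞ f closedHalfSpace) {z : ℝ × E3} (hz : z ∈ closedHalfSpace) (i : Fin 3) :
    dirDeriv (spaceDir i) (fun z => χ z.2 • f z) z =
      χ z.2 • dirDeriv (spaceDir i) f z + fderiv ℝ χ z.2 (basisVec i) • f z := by
  rw [dirDeriv_smul (contDiffOn_spatial hχ.smooth) hf _ hz, dirDeriv_spatial hχ.smooth _ hz]
  simp [spaceDir]

theorem mem_closedHalfSpace_of_mem_slab {S : ℝ} {z : ℝ × E3} (hz : z ∈ slab S) :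
    z ∈ closedHalfSpace :=
  halfSpace_subset_closedHalfSpace (slab_subset_halfSpace S hz)

theorem inner_wedge_self (a b : E3) : (inner ℝ (wedge a b) b : ℝ) = 0 := by
  simp only [inner_eq_sum, Fin.sum_univ_three, wedge_apply_zero, wedge_apply_one, wedge_apply_two]
  ring

/-- The density of the variation of `∫ χ ∇u · ∇V`. -/
def crossDensity (χ : E3 → ℝ) (u Vt : ℝ × E3 → E3) (Vx : Fin 3 → ℝ × E3 → E3) (z : ℝ × E3) : ℝ :=
  ∑ i, (χ z.2 * inner ℝ (dirDeriv (spaceDir i) (dirDeriv timeDir u) z) (Vx i z)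
    - (χ z.2 * inner ℝ (dirDeriv (spaceDir i) (dirDeriv (spaceDir i) u) z) (Vt z)
      + fderiv ℝ χ z.2 (basisVec i) * inner ℝ (dirDeriv (spaceDir i) u z) (Vt z)))

theorem integral_cutoff_cross (hm₀ : ContDiff ℝ ∞ m₀) (hu : ContDiffOn ℝ ∞ u closedHalfSpace)
    (hinit : ∀ x, u (0, x) = m₀ x) (hχ : IsCutoff L R χ)
    {V Vt : ℝ × E3 → E3} {Vx : Fin 3 → ℝ × E3 → E3}
    (hw : ∀ i, IsWeakDeriv (spaceDir i) V (Vx i)) (hV : LocInt V)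
    (hVt : LocInt Vt) (hVx : ∀ i, LocInt (Vx i))
    (hrep : ∀ᵐ z ∂(volume.restrict halfSpace), V z = m₀ z.2 + timePrimitive Vt z) :
    (∀ S, IntegrableOn (crossDensity χ u Vt Vx) (slab S)) ∧
    ∀ᵐ S ∂(volume.restrict (Ioi (0 : ℝ))),
      ∑ i, ∫ x, χ x * (inner ℝ (dirDeriv (spaceDir i) u (S, x)) (Vx i (S, x)) : ℝ) =
        (∑ i, ∫ x, χ x * ‖fderiv ℝ m₀ x (basisVec i)‖ ^ 2) +
          ∫ z in slab S, crossDensity χ u Vt Vx z := by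
  have hK := isCompact_closedBall (0 : E3) (2 * R)
  -- The evolution of ∫G·∂ᵢV is applied to G = χ∂ᵢu and summed over i.
  set G : Fin 3 → ℝ × E3 → E3 := fun i z => χ z.2 • dirDeriv (spaceDir i) u z with hGdef
  have hux := fun i => hu.dirDeriv (spaceDir i)
  have hG : ∀ i, ContDiffOn ℝ ∞ (G i) closedHalfSpace := fun i => hχ.contDiffOn_smul (hux i)
  have hGK : ∀ i, SuppIn _ (G i) := fun i => hχ.suppIn_smul (dirDeriv (spaceDir i) u)
  have i1 : ∀ i S, IntegrableOn (fun z => (inner ℝ (dirDeriv timeDir (G i) z) (Vx i z) : ℝ)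
      - inner ℝ (dirDeriv (spaceDir i) (G i) z) (Vt z)) (slab S) := fun i S =>
    ((hVx i).integrableOn_inner hK ((hGK i).dirDeriv hK _) ((hG i).dirDeriv _).continuousOn S).sub
      (hVt.integrableOn_inner hK ((hGK i).dirDeriv hK _) ((hG i).dirDeriv _).continuousOn S)
  have e1 : ∀ S, ∀ z ∈ slab S, ∑ i, ((inner ℝ (dirDeriv timeDir (G i) z) (Vx i z) : ℝ)
      - inner ℝ (dirDeriv (spaceDir i) (G i) z) (Vt z)) = crossDensity χ u Vt Vx z := by
    intro S z hz
    have hzc := mem_closedHalfSpace_of_mem_slab hz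
    refine Finset.sum_congr rfl fun i _ => ?_
    rw [hχ.dirDeriv_smul_time (hux i) hzc, hχ.dirDeriv_smul_space (hux i) hzc,
      real_inner_smul_left, inner_add_left, real_inner_smul_left, real_inner_smul_left,
      dirDeriv_comm hu _ _ (slab_subset_halfSpace S hz)]
  refine ⟨fun S => ?_, ?_⟩
  · exact (integrable_finsetSum _ fun i _ => i1 i S).congr
      ((ae_restrict_mem (measurableSet_slab S)).mono fun z hz => by
        simpa using e1 S z hz)
  · have key := fun i => integral_slice_inner_eq hm₀ (hw i) hV hVt (hVx i) hrep hK (hG i) (hGK i)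
    filter_upwards [ae_all_iff.2 key] with S hS
    have h0 : ∀ i x, dirDeriv (spaceDir i) u (0, x) = fderiv ℝ m₀ x (basisVec i) := fun i x => by
      rw [← fderiv_space_apply hu le_rfl]
      simp_rw [hinit]
    rw [← setIntegral_congr_fun (measurableSet_slab S) (e1 S),
      integral_finsetSum _ fun i _ => i1 i S, ← Finset.sum_add_distrib]
    refine Finset.sum_congr rfl fun i _ => ?_
    have := hS i
    simp only [hGdef, real_inner_smul_left, h0, real_inner_self_eq_norm_sq] at this
    exact this

theorem integrableOn_slab_of_continuousOn {K : Set E3} (hK : IsCompact K) {G : ℝ × E3 → ℝ}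
    (hG : SuppIn K G) (hc : ContinuousOn G closedHalfSpace) (S : ℝ) : IntegrableOn G (slab S) :=
  LocInt.integrableOn_slab_of_le hK hG hc (f := fun _ => (1 : ℝ))
    (locInt_of_continuousOn continuousOn_const) S
    (aestronglyMeasurable_slab_of_continuousOn hc S) fun z => by simp

theorem eq_primitive_of_contDiffOn (hu : ContDiffOn ℝ ∞ u closedHalfSpace)
    (hinit : ∀ x, u (0, x) = m₀ x) {z : ℝ × E3} (hz : z ∈ halfSpace) :
    u z = m₀ z.2 + timePrimitive (dirDeriv timeDir u) z := by
  obtain ⟨t, x⟩ := z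
  have ht : 0 < t := mem_halfSpace.1 hz
  have hc := (continuousOn_time (hu.dirDeriv timeDir).continuousOn x).mono
    (show Icc 0 t ⊆ Ici (0 : ℝ) from Icc_subset_Ici_self)
  have := intervalIntegral.integral_eq_sub_of_hasDerivAt_of_le ht.le
    ((continuousOn_time hu.continuousOn x).mono Icc_subset_Ici_self)
    (fun s hs => hasDerivAt_time hu hs.1 x)
    (by apply ContinuousOn.intervalIntegrable; rwa [uIcc_of_le ht.le])
  rw [timePrimitive, this, hinit]
  abel

/-- The localized energy identity for smooth solutions. -/
theorem IsTruncatedSolution.energy_identity (hu : IsTruncatedSolution T m₀ u)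
    (hm₀ : ContDiff ℝ ∞ m₀) (hχ : IsCutoff L R χ) :
    (∀ S, IntegrableOn (fun z => - (χ z.2 * ‖dirDeriv timeDir u z‖ ^ 2)
      - 2 * ∑ i, fderiv ℝ χ z.2 (basisVec i) *
        (inner ℝ (dirDeriv (spaceDir i) u z) (dirDeriv timeDir u z) : ℝ)) (slab S)) ∧
    ∀ᵐ S ∂(volume.restrict (Ioo 0 T)),
      ∑ i, ∫ x, χ x * ‖dirDeriv (spaceDir i) u (S, x)‖ ^ 2 =
        (∑ i, ∫ x, χ x * ‖fderiv ℝ m₀ x (basisVec i)‖ ^ 2) +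
          ∫ z in slab S, (- (χ z.2 * ‖dirDeriv timeDir u z‖ ^ 2)
            - 2 * ∑ i, fderiv ℝ χ z.2 (basisVec i) *
              (inner ℝ (dirDeriv (spaceDir i) u z) (dirDeriv timeDir u z) : ℝ)) := by
  have hK := isCompact_closedBall (0 : E3) (2 * R)
  have hus := hu.smooth
  have hut := hus.dirDeriv timeDir
  have hux := fun i => hus.dirDeriv (spaceDir i)
  set G : Fin 3 → ℝ × E3 → E3 := fun i z => χ z.2 • dirDeriv (spaceDir i) u z with hGdef
  have hG : ∀ i, ContDiffOn ℝ ∞ (G i) closedHalfSpace := fun i => hχ.contDiffOn_smul (hux i)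
  have hGK : ∀ i, SuppIn _ (G i) := fun i => hχ.suppIn_smul (dirDeriv (spaceDir i) u)
  have hcut : ContinuousOn (fun z : ℝ × E3 => χ z.2) closedHalfSpace :=
    (contDiffOn_spatial hχ.smooth).continuousOn
  have lut := locInt_of_continuousOn hut.continuousOn
  have iD : ∀ i S, IntegrableOn (fun z => (inner ℝ (dirDeriv (spaceDir i) (G i) z)
      (dirDeriv timeDir u z) : ℝ)) (slab S) := fun i S =>
    lut.integrableOn_inner hK ((hGK i).dirDeriv hK _) ((hG i).dirDeriv _).continuousOn S
  have iG : ∀ i S, IntegrableOn (fun z => (inner ℝ (G i z)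
      (dirDeriv (spaceDir i) (dirDeriv timeDir u) z) : ℝ)) (slab S) := fun i S =>
    (locInt_of_continuousOn (hut.dirDeriv _).continuousOn).integrableOn_inner hK (hGK i)
      (hG i).continuousOn S
  have hfd : ∀ i, Continuous fun x => fderiv ℝ χ x (basisVec i) := fun i =>
    (hχ.smooth.continuous_fderiv (by simp)).clm_apply continuous_const
  refine ⟨fun S => ?_, ?_⟩
  · refine integrableOn_slab_of_continuousOn hK ?_ ?_ S
    · intro z hz hzK
      rw [Metric.mem_closedBall, dist_zero_right, not_le] at hzK
      have h1 := hχ.eq_zero z.2 hzK.le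
      have h2 : ∀ i, fderiv ℝ χ z.2 (basisVec i) = 0 := fun i => by
        have := hχ.sq_fderiv_le i z.2
        rw [h1, mul_zero] at this
        exact pow_eq_zero_iff two_ne_zero |>.1 (le_antisymm this (sq_nonneg _))
      simp [h1, h2]
    · have c1 := hut.continuousOn
      have c2 := fun i => (hux i).continuousOn
      refine ContinuousOn.sub (hcut.mul (c1.norm.pow 2)).neg
        (continuousOn_const.mul (continuousOn_finsetSum _ fun i _ => ?_))
      exact ((hfd i).comp continuous_snd).continuousOn.mul ((c2 i).inner c1)
  · have hcr := (integral_cutoff_cross hm₀ hus hu.initial hχ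
      (fun i => isWeakDeriv_dirDeriv hus (spaceDir i)) (locInt_of_continuousOn hus.continuousOn)
      lut (fun i => locInt_of_continuousOn (hux i).continuousOn)
      ((ae_restrict_mem measurableSet_halfSpace).mono fun z hz =>
        eq_primitive_of_contDiffOn hus hu.initial hz)).2
    filter_upwards [ae_restrict_of_ae_restrict_of_subset Ioo_subset_Ioi_self hcr,
      ae_restrict_mem measurableSet_Ioo] with S hS hST
    simp only [real_inner_self_eq_norm_sq] at hS
    rw [hS]
    congr 1
    have e1 : ∀ z ∈ slab S, crossDensity χ u (dirDeriv timeDir u)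
        (fun i => dirDeriv (spaceDir i) u) z = ∑ i, ((inner ℝ (G i z)
          (dirDeriv (spaceDir i) (dirDeriv timeDir u) z) : ℝ) -
            inner ℝ (dirDeriv (spaceDir i) (G i) z) (dirDeriv timeDir u z)) := by
      intro z hz
      refine Finset.sum_congr rfl fun i _ => ?_
      rw [hχ.dirDeriv_smul_space (hux i) (mem_closedHalfSpace_of_mem_slab hz), hGdef,
        real_inner_smul_left, inner_add_left, real_inner_smul_left, real_inner_smul_left]
      simp only [real_inner_comm]
    -- Integration by parts in space shows that the two halves of the variation coincide, leaving
    -- -2∂ᵢ(χ∂ᵢu)·∂ₜu.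
    have e2 : ∀ i, ∫ z in slab S, ((inner ℝ (G i z)
          (dirDeriv (spaceDir i) (dirDeriv timeDir u) z) : ℝ) -
            inner ℝ (dirDeriv (spaceDir i) (G i) z) (dirDeriv timeDir u z)) =
        ∫ z in slab S, (-2 * inner ℝ (dirDeriv (spaceDir i) (G i) z)
          (dirDeriv timeDir u z) : ℝ) := by
      intro i
      have := integral_slab_space (isWeakDeriv_dirDeriv hut (spaceDir i)) lut
        (locInt_of_continuousOn (hut.dirDeriv _).continuousOn) hK (hG i) (hGK i) S
      rw [integral_sub (iG i S) (iD i S), integral_const_mul]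
      linarith
    rw [setIntegral_congr_fun (measurableSet_slab S) e1,
      integral_finsetSum (f := fun i z => (inner ℝ (G i z)
          (dirDeriv (spaceDir i) (dirDeriv timeDir u) z) : ℝ) -
            inner ℝ (dirDeriv (spaceDir i) (G i) z) (dirDeriv timeDir u z)) _
        fun i _ => (iG i S).sub (iD i S)]
    simp_rw [e2]
    rw [← integral_finsetSum _ fun i _ => (iD i S).const_mul (-2)]
    refine setIntegral_congr_fun (measurableSet_slab S) fun z hz => ?_
    have hzT : z ∈ slab T := ⟨⟨hz.1.1, hz.1.2.trans hST.2⟩, mem_univ _⟩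
    have hzc := mem_closedHalfSpace_of_mem_slab hz
    -- The scalar product of the equation with ∂ₜu: both u and u∧∂ₜu are orthogonal to it, so
    -- 2Δu·∂ₜu = |∂ₜu|².
    have heq := congrArg (fun b => (inner ℝ b (dirDeriv timeDir u z) : ℝ)) (hu.equation z hzT)
    simp only [inner_sub_left, real_inner_smul_left, hu.orthogonal_dt z hzT, sum_inner,
      real_inner_self_eq_norm_sq, inner_wedge_self] at heq
    simp only [hGdef, fun i => hχ.dirDeriv_smul_space (hux i) hzc i, inner_add_left,
      real_inner_smul_left, mul_add, Finset.sum_add_distrib, ← Finset.mul_sum]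
    linear_combination (-χ z.2) * heq

end LandauLifshitz
end

/-! ### Energy of the smooth solution on cylinders, uniformly in the radius. -/

noncomputable section

namespace LandauLifshitz

variable {L R T : ℝ} {χ : E3 → ℝ} {m₀ : E3 → E3} {u : ℝ × E3 → E3}

/-- The cylinder of radius `R` over `(0,S)`. -/
def cylinder (S R : ℝ) : Set (ℝ × E3) := Ioo (0 : ℝ) S ×ˢ Metric.closedBall (0 : E3) R

/-- The initial energy. -/
def initialEnergy (m₀ : E3 → E3) : ℝ := ∑ i, ∫ x, ‖fderiv ℝ m₀ x (basisVec i)‖ ^ 2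

theorem measurableSet_cylinder (S R : ℝ) : MeasurableSet (cylinder S R) :=
  measurableSet_Ioo.prod measurableSet_closedBall

theorem cylinder_subset_slab (S R : ℝ) : cylinder S R ⊆ slab S :=
  prod_mono subset_rfl (subset_univ _)

theorem cylinder_mono {S S' R R' : ℝ} (hS : S ≤ S') (hR : R ≤ R') :
    cylinder S R ⊆ cylinder S' R' :=
  prod_mono (Ioo_subset_Ioo_right hS) (Metric.closedBall_subset_closedBall hR)

theorem LocInt.integrableOn_cylinder {F : Type*} [NormedAddCommGroup F] {f : ℝ × E3 → F}
    (hf : LocInt f) (S R : ℝ) : IntegrableOn f (cylinder S R) :=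
  hf S _ (isCompact_closedBall _ _)

theorem integrableOn_indicator_cylinder {f : ℝ × E3 → ℝ} {S R : ℝ}
    (hf : IntegrableOn f (cylinder S R)) :
    IntegrableOn ((cylinder S R).indicator f) (slab S) := by
  rw [IntegrableOn, integrable_indicator_iff (measurableSet_cylinder S R), IntegrableOn,
    Measure.restrict_restrict (measurableSet_cylinder S R),
    inter_eq_left.2 (cylinder_subset_slab S R)]
  exact hf

theorem integral_indicator_cylinder (f : ℝ × E3 → ℝ) (S R : ℝ) :
    ∫ z in slab S, (cylinder S R).indicator f z = ∫ z in cylinder S R, f z := by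
  rw [integral_indicator (measurableSet_cylinder S R),
    Measure.restrict_restrict (measurableSet_cylinder S R),
    inter_eq_left.2 (cylinder_subset_slab S R)]

/-- Young's inequality with weight 1/6: the three space directions together then consume half of the
dissipation χ|∂ₜu|². -/
theorem two_mul_abs_mul_le {a c l x y p : ℝ} (hc : 0 ≤ c) (ha : a ^ 2 ≤ l ^ 2 * c)
    (hp : |p| ≤ x * y) : 2 * |a * p| ≤ c * y ^ 2 / 6 + 6 * l ^ 2 * x ^ 2 := by
  have hp2 : p ^ 2 ≤ (x * y) ^ 2 := sq_le_sq' (abs_le.1 hp).1 (abs_le.1 hp).2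
  have hq : 0 ≤ c * y ^ 2 / 6 + 6 * l ^ 2 * x ^ 2 := by positivity
  rw [show 2 * |a * p| = |2 * (a * p)| by rw [abs_mul]; norm_num]
  refine abs_le_of_sq_le_sq ?_ hq
  have h1 : a ^ 2 * p ^ 2 ≤ (l ^ 2 * c) * (x * y) ^ 2 :=
    mul_le_mul ha hp2 (sq_nonneg _) (by positivity)
  nlinarith [sq_nonneg (c * y ^ 2 / 6 - 6 * l ^ 2 * x ^ 2)]

theorem IsCutoff.mem_closedBall (hχ : IsCutoff L R χ) {x : E3} (hx : χ x ≠ 0) :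
    x ∈ Metric.closedBall (0 : E3) (2 * R) := by
  by_contra h
  rw [Metric.mem_closedBall, dist_zero_right, not_le] at h
  exact hx (hχ.eq_zero x h.le)

theorem IsCutoff.fderiv_eq_zero (hχ : IsCutoff L R χ) {x : E3} (hx : χ x = 0) (i : Fin 3) :
    fderiv ℝ χ x (basisVec i) = 0 := by
  have := hχ.sq_fderiv_le i x
  rw [hx, mul_zero] at this
  exact pow_eq_zero_iff two_ne_zero |>.1 (le_antisymm this (sq_nonneg _))

theorem IsCutoff.integral_le (hχ : IsCutoff L R χ)
    (hg : ∀ i, MemLp (fun x => fderiv ℝ m₀ x (basisVec i)) 2 volume) :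
    ∑ i, ∫ x, χ x * ‖fderiv ℝ m₀ x (basisVec i)‖ ^ 2 ≤ initialEnergy m₀ := by
  refine Finset.sum_le_sum fun i _ => integral_mono_of_nonneg
    (Filter.Eventually.of_forall fun x => mul_nonneg (hχ.nonneg x) (sq_nonneg _))
    ((memLp_two_iff_integrable_sq_norm (hg i).1).1 (hg i))
    (Filter.Eventually.of_forall fun x => mul_le_of_le_one_left (sq_nonneg _) (hχ.le_one x))

theorem IsTruncatedSolution.continuousOn_energy (hu : IsTruncatedSolution T m₀ u) :
    ContinuousOn (fun z => ∑ i, ‖dirDeriv (spaceDir i) u z‖ ^ 2) closedHalfSpace :=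
  continuousOn_finsetSum _ fun i _ => (hu.smooth.dirDeriv (spaceDir i)).continuousOn.norm.pow 2

theorem IsTruncatedSolution.integrableOn_cutoff_dt (hu : IsTruncatedSolution T m₀ u)
    (hχ : IsCutoff L R χ) (S : ℝ) :
    IntegrableOn (fun z => χ z.2 * ‖dirDeriv timeDir u z‖ ^ 2) (slab S) :=
  integrableOn_slab_of_continuousOn (isCompact_closedBall (0 : E3) (2 * R))
    (hχ.suppIn_smul _) ((contDiffOn_spatial hχ.smooth).continuousOn.mul
      ((hu.smooth.dirDeriv timeDir).continuousOn.norm.pow 2)) S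

theorem IsTruncatedSolution.integrableOn_cutoff_dx (hu : IsTruncatedSolution T m₀ u)
    (hχ : IsCutoff L R χ) (i : Fin 3) (S : ℝ) :
    IntegrableOn (fun z => χ z.2 * ‖dirDeriv (spaceDir i) u z‖ ^ 2) (slab S) :=
  integrableOn_slab_of_continuousOn (isCompact_closedBall (0 : E3) (2 * R))
    (hχ.suppIn_smul _) ((contDiffOn_spatial hχ.smooth).continuousOn.mul
      ((hu.smooth.dirDeriv (spaceDir i)).continuousOn.norm.pow 2)) S

/-- The terms with ∂χ in the energy identity are absorbed into half of the dissipation, at the price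
of (L/R)² times the gradient energy on the cylinder of twice the radius. -/
theorem IsTruncatedSolution.energy_le (hu : IsTruncatedSolution T m₀ u)
    (hm₀ : ContDiff ℝ ∞ m₀) (hg : ∀ i, MemLp (fun x => fderiv ℝ m₀ x (basisVec i)) 2 volume)
    (hχ : IsCutoff L R χ) :
    ∀ᵐ S ∂(volume.restrict (Ioo 0 T)),
      (∑ i, ∫ x, χ x * ‖dirDeriv (spaceDir i) u (S, x)‖ ^ 2) +
        1 / 2 * ∫ z in slab S, χ z.2 * ‖dirDeriv timeDir u z‖ ^ 2 ≤
      initialEnergy m₀ +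
        6 * (L / R) ^ 2 * ∫ z in cylinder S (2 * R), ∑ i, ‖dirDeriv (spaceDir i) u z‖ ^ 2 := by
  obtain ⟨h1, h2⟩ := hu.energy_identity hm₀ hχ
  filter_upwards [h2] with S hS
  have hle := hχ.integral_le hg
  have i1 := hu.integrableOn_cutoff_dt hχ S
  have i2 := integrableOn_indicator_cylinder
    ((locInt_of_continuousOn hu.continuousOn_energy).integrableOn_cylinder S (2 * R))
  have key : ∫ z in slab S, (- (χ z.2 * ‖dirDeriv timeDir u z‖ ^ 2)
        - 2 * ∑ i, fderiv ℝ χ z.2 (basisVec i) *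
          (inner ℝ (dirDeriv (spaceDir i) u z) (dirDeriv timeDir u z) : ℝ)) ≤
      ∫ z in slab S, (- (1 / 2) * (χ z.2 * ‖dirDeriv timeDir u z‖ ^ 2) +
        6 * (L / R) ^ 2 * (cylinder S (2 * R)).indicator
          (fun z => ∑ i, ‖dirDeriv (spaceDir i) u z‖ ^ 2) z) := by
    refine setIntegral_mono_on (h1 S) ((i1.const_mul _).add (i2.const_mul _))
      (measurableSet_slab S) fun z hz => ?_
    by_cases hz0 : χ z.2 = 0
    · simp only [hz0, hχ.fderiv_eq_zero hz0, zero_mul, mul_zero, Finset.sum_const_zero, neg_zero,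
        sub_zero, zero_add]
      exact mul_nonneg (by positivity) (indicator_nonneg (fun z _ =>
        Finset.sum_nonneg fun i _ => sq_nonneg _) z)
    · have hmem : z ∈ cylinder S (2 * R) := ⟨hz.1, hχ.mem_closedBall hz0⟩
      rw [indicator_of_mem hmem]
      have hi : ∀ i, - (2 * (fderiv ℝ χ z.2 (basisVec i) *
          (inner ℝ (dirDeriv (spaceDir i) u z) (dirDeriv timeDir u z) : ℝ))) ≤
          χ z.2 * ‖dirDeriv timeDir u z‖ ^ 2 / 6 +
            6 * (L / R) ^ 2 * ‖dirDeriv (spaceDir i) u z‖ ^ 2 := fun i => by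
        refine le_trans ?_ (two_mul_abs_mul_le (hχ.nonneg z.2) (hχ.sq_fderiv_le i z.2)
          (abs_real_inner_le_norm (dirDeriv (spaceDir i) u z) (dirDeriv timeDir u z)))
        have := neg_abs_le (fderiv ℝ χ z.2 (basisVec i) *
          (inner ℝ (dirDeriv (spaceDir i) u z) (dirDeriv timeDir u z) : ℝ))
        linarith
      have h0 := hi 0
      have h1 := hi 1
      have h2 := hi 2
      simp only [Fin.sum_univ_three]
      linarith
  rw [integral_add (i1.const_mul _) (i2.const_mul _), integral_const_mul, integral_const_mul,
    integral_indicator_cylinder] at key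
  linarith

/-- Integration of the energy bound over time relates the gradient energy on radius R to that on
radius 2R with the gain R⁻². This is the step iterated in the bootstrap. -/
theorem IsTruncatedSolution.integral_cylinder_le_of_cutoff (hT : 0 < T)
    (hu : IsTruncatedSolution T m₀ u)
    (hm₀ : ContDiff ℝ ∞ m₀) (hg : ∀ i, MemLp (fun x => fderiv ℝ m₀ x (basisVec i)) 2 volume)
    (hχ : IsCutoff L R χ) :
    ∫ z in cylinder T R, ∑ i, ‖dirDeriv (spaceDir i) u z‖ ^ 2 ≤
      T * (initialEnergy m₀ + 6 * (L / R) ^ 2 *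
        ∫ z in cylinder T (2 * R), ∑ i, ‖dirDeriv (spaceDir i) u z‖ ^ 2) := by
  have iE := locInt_of_continuousOn hu.continuousOn_energy
  have hpos : ∀ z, 0 ≤ ∑ i, ‖dirDeriv (spaceDir i) u z‖ ^ 2 := fun z =>
    Finset.sum_nonneg fun i _ => sq_nonneg _
  have ix := fun i => hu.integrableOn_cutoff_dx hχ i T
  have iX : IntegrableOn (fun z => ∑ i, χ z.2 * ‖dirDeriv (spaceDir i) u z‖ ^ 2) (slab T) :=
    integrable_finsetSum _ fun i _ => ix i
  calc ∫ z in cylinder T R, ∑ i, ‖dirDeriv (spaceDir i) u z‖ ^ 2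
      = ∫ z in cylinder T R, ∑ i, χ z.2 * ‖dirDeriv (spaceDir i) u z‖ ^ 2 := by
        refine setIntegral_congr_fun (measurableSet_cylinder T R) fun z hz => ?_
        have : χ z.2 = 1 := hχ.eq_one _ (by simpa using hz.2)
        simp [this]
    _ ≤ ∫ z in slab T, ∑ i, χ z.2 * ‖dirDeriv (spaceDir i) u z‖ ^ 2 :=
        setIntegral_mono_set iX (Filter.Eventually.of_forall fun z =>
          Finset.sum_nonneg fun i _ => mul_nonneg (hχ.nonneg _) (sq_nonneg _))
          (cylinder_subset_slab T R).eventuallyLE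
    _ = ∑ i, ∫ t in Ioo 0 T, ∫ x, χ x * ‖dirDeriv (spaceDir i) u (t, x)‖ ^ 2 := by
        rw [integral_finsetSum _ fun i _ => ix i]
        exact Finset.sum_congr rfl fun i _ => integral_slab (ix i)
    _ = ∫ t in Ioo 0 T, ∑ i, ∫ x, χ x * ‖dirDeriv (spaceDir i) u (t, x)‖ ^ 2 :=
        (integral_finsetSum _ fun i _ => integrableOn_integral_slab (ix i)).symm
    _ ≤ ∫ _t in Ioo 0 T, (initialEnergy m₀ + 6 * (L / R) ^ 2 *
          ∫ z in cylinder T (2 * R), ∑ i, ‖dirDeriv (spaceDir i) u z‖ ^ 2) := by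
        refine integral_mono_ae (integrable_finsetSum _ fun i _ =>
          integrableOn_integral_slab (ix i)) (integrable_const _) ?_
        filter_upwards [hu.energy_le hm₀ hg hχ, ae_restrict_mem measurableSet_Ioo] with S hS hST
        have h1 : 0 ≤ ∫ z in slab S, χ z.2 * ‖dirDeriv timeDir u z‖ ^ 2 :=
          integral_nonneg fun z => mul_nonneg (hχ.nonneg _) (sq_nonneg _)
        have h2 : ∫ z in cylinder S (2 * R), ∑ i, ‖dirDeriv (spaceDir i) u z‖ ^ 2 ≤
            ∫ z in cylinder T (2 * R), ∑ i, ‖dirDeriv (spaceDir i) u z‖ ^ 2 :=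
          setIntegral_mono_set (iE.integrableOn_cylinder _ _) (Filter.Eventually.of_forall hpos)
            (cylinder_mono hST.2.le le_rfl).eventuallyLE
        have h3 := mul_le_mul_of_nonneg_left h2 (show 0 ≤ 6 * (L / R) ^ 2 by positivity)
        linarith
    _ = _ := by
        rw [setIntegral_const, smul_eq_mul, Measure.real, Real.volume_Ioo, sub_zero,
          ENNReal.toReal_ofReal hT.le]

theorem measureReal_cylinder (hT : 0 < T) (hR : 0 ≤ R) :
    volume.real (cylinder T R) = T * (R ^ 3 * volume.real (Metric.ball (0 : E3) 1)) := by
  rw [Measure.real, cylinder, Measure.volume_eq_prod, Measure.prod_prod, ENNReal.toReal_mul,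
    Real.volume_Ioo, sub_zero, ENNReal.toReal_ofReal hT.le, Measure.addHaar_closedBall _ _ hR,
    ENNReal.toReal_mul, ENNReal.toReal_ofReal (by positivity), finrank_euclideanSpace_fin]
  rfl

/-- The energy of a smooth solution on cylinders is bounded independently of the radius. -/
theorem IsTruncatedSolution.exists_bound_cylinder (hT : 0 < T) (hu : IsTruncatedSolution T m₀ u)
    (hm₀ : ContDiff ℝ ∞ m₀) (hg : ∀ i, MemLp (fun x => fderiv ℝ m₀ x (basisVec i)) 2 volume) :
    ∃ B : ℝ, ∀ R : ℝ, 1 ≤ R → ∀ᵐ S ∂(volume.restrict (Ioo 0 T)),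
      ∫ z in cylinder S R, ((∑ i, ‖dirDeriv (spaceDir i) u z‖ ^ 2) + ‖dirDeriv timeDir u z‖ ^ 2)
        ≤ B := by
  obtain ⟨L, hL0, hL⟩ := exists_isCutoff
  obtain ⟨M, hM⟩ := hu.bounded
  set E := initialEnergy m₀ with hE
  have hE0 : 0 ≤ E := Finset.sum_nonneg fun i _ => integral_nonneg fun x => sq_nonneg _
  set g : ℝ → ℝ := fun R => ∫ z in cylinder T R, ∑ i, ‖dirDeriv (spaceDir i) u z‖ ^ 2 with hgdef
  have iE := locInt_of_continuousOn hu.continuousOn_energy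
  set V := volume.real (Metric.ball (0 : E3) 1) with hV
  have hV0 : 0 ≤ V := measureReal_nonneg
  -- The bootstrap starts from the volume of the cylinder: bounded derivatives give growth R³. Each
  -- use of `step` gains R⁻², leading to growth R and then to a bound independent of R.
  have b0 : ∀ R, 0 ≤ R → g R ≤ 3 * M ^ 2 * (T * (R ^ 3 * V)) := by
    intro R hR
    have hfin : volume (cylinder T R) ≠ ⊤ := by
      rw [cylinder, Measure.volume_eq_prod, Measure.prod_prod]
      exact (ENNReal.mul_lt_top measure_Ioo_lt_top
        (isCompact_closedBall (0 : E3) R).measure_lt_top).ne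
    calc g R ≤ ∫ _z in cylinder T R, (3 * M ^ 2) := by
          refine setIntegral_mono_on (iE.integrableOn_cylinder _ _)
            (integrableOn_const hfin) (measurableSet_cylinder T R) fun z hz => ?_
          have h1 : ∀ i, ‖dirDeriv (spaceDir i) u z‖ ^ 2 ≤ M ^ 2 := fun i =>
            pow_le_pow_left₀ (norm_nonneg _) ((hM z (cylinder_subset_slab T R hz)).2 i) 2
          rw [Fin.sum_univ_three]
          linarith [h1 0, h1 1, h1 2]
      _ = _ := by
          rw [setIntegral_const, smul_eq_mul, measureReal_cylinder hT hR]; ring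
  have step : ∀ R, 0 < R → g R ≤ T * (E + 6 * (L / R) ^ 2 * g (2 * R)) := fun R hR => by
    obtain ⟨χ, hχ⟩ := hL R hR
    exact hu.integral_cylinder_le_of_cutoff hT hm₀ hg hχ
  set C₁ := T * (E + 6 * L ^ 2 * (3 * M ^ 2 * (T * (8 * V)))) with hC₁
  have hC₁0 : 0 ≤ C₁ := by positivity
  have b1 : ∀ R, 1 ≤ R → g R ≤ C₁ * R := by
    intro R hR
    have hR0 : 0 < R := one_pos.trans_le hR
    have h1 := b0 (2 * R) (by positivity)
    calc g R ≤ T * (E + 6 * (L / R) ^ 2 * g (2 * R)) := step R hR0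
      _ ≤ T * (E + 6 * (L / R) ^ 2 * (3 * M ^ 2 * (T * ((2 * R) ^ 3 * V)))) := by gcongr
      _ = T * (E + 6 * L ^ 2 * (3 * M ^ 2 * (T * (8 * V))) * R) := by field_simp; ring
      _ ≤ T * (E * R + 6 * L ^ 2 * (3 * M ^ 2 * (T * (8 * V))) * R) := by
          gcongr; exact le_mul_of_one_le_right hE0 hR
      _ = C₁ * R := by rw [hC₁]; ring
  set C₂ := T * (E + 12 * L ^ 2 * C₁) with hC₂
  have b2 : ∀ R, 1 ≤ R → g R ≤ C₂ := by
    intro R hR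
    have hR0 : 0 < R := one_pos.trans_le hR
    have h1 := b1 (2 * R) (by linarith)
    calc g R ≤ T * (E + 6 * (L / R) ^ 2 * g (2 * R)) := step R hR0
      _ ≤ T * (E + 6 * (L / R) ^ 2 * (C₁ * (2 * R))) := by gcongr
      _ = T * (E + 12 * L ^ 2 * C₁ / R) := by field_simp; ring
      _ ≤ T * (E + 12 * L ^ 2 * C₁) := by
          gcongr; exact div_le_self (by positivity) hR
  -- The first C₂ bounds the gradient part; the rest is twice the right side of `energy_le`, because
  -- the dissipation occurs there with coefficient 1/2.
  refine ⟨C₂ + 2 * (E + 6 * L ^ 2 * C₂), fun R hR => ?_⟩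
  have hR0 : 0 < R := one_pos.trans_le hR
  obtain ⟨χ, hχ⟩ := hL R hR0
  have hC₂0 : 0 ≤ C₂ := by positivity
  have hpos : ∀ z, 0 ≤ ∑ i, ‖dirDeriv (spaceDir i) u z‖ ^ 2 := fun z =>
    Finset.sum_nonneg fun i _ => sq_nonneg _
  filter_upwards [hu.energy_le hm₀ hg hχ, ae_restrict_mem measurableSet_Ioo] with S hS hST
  have c1 : ∀ r, 1 ≤ r → ∫ z in cylinder S r, ∑ i, ‖dirDeriv (spaceDir i) u z‖ ^ 2 ≤ C₂ :=
    fun r hr => (setIntegral_mono_set (iE.integrableOn_cylinder _ _)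
      (Filter.Eventually.of_forall hpos) (cylinder_mono hST.2.le le_rfl).eventuallyLE).trans
        (b2 r hr)
  have c2 : ∫ z in cylinder S R, ‖dirDeriv timeDir u z‖ ^ 2 ≤
      ∫ z in slab S, χ z.2 * ‖dirDeriv timeDir u z‖ ^ 2 := by
    calc ∫ z in cylinder S R, ‖dirDeriv timeDir u z‖ ^ 2
        = ∫ z in cylinder S R, χ z.2 * ‖dirDeriv timeDir u z‖ ^ 2 := by
          refine setIntegral_congr_fun (measurableSet_cylinder S R) fun z hz => ?_
          have : χ z.2 = 1 := hχ.eq_one _ (by simpa using hz.2)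
          simp [this]
      _ ≤ _ := setIntegral_mono_set (hu.integrableOn_cutoff_dt hχ S)
          (Filter.Eventually.of_forall fun z => mul_nonneg (hχ.nonneg _) (sq_nonneg _))
          (cylinder_subset_slab S R).eventuallyLE
  have c3 : 0 ≤ ∑ i, ∫ x, χ x * ‖dirDeriv (spaceDir i) u (S, x)‖ ^ 2 :=
    Finset.sum_nonneg fun i _ => integral_nonneg fun x => mul_nonneg (hχ.nonneg _) (sq_nonneg _)
  have c4 : 6 * (L / R) ^ 2 * ∫ z in cylinder S (2 * R), ∑ i, ‖dirDeriv (spaceDir i) u z‖ ^ 2 ≤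
      6 * L ^ 2 * C₂ := by
    have h1 : L / R ≤ L := div_le_self hL0 hR
    have h2 : (L / R) ^ 2 ≤ L ^ 2 := pow_le_pow_left₀ (by positivity) h1 2
    exact mul_le_mul (by linarith) (c1 _ (by linarith)) (integral_nonneg hpos) (by positivity)
  have iT : IntegrableOn (fun z => ‖dirDeriv timeDir u z‖ ^ 2) (cylinder S R) :=
    (locInt_of_continuousOn
      ((hu.smooth.dirDeriv timeDir).continuousOn.norm.pow 2)).integrableOn_cylinder _ _
  rw [integral_add (iE.integrableOn_cylinder _ _) iT]
  linarith [c1 R hR]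

end LandauLifshitz
end

/-! ### Localized energy inequality and the pointwise stability estimate. -/

noncomputable section

namespace LandauLifshitz

variable {L R T : ℝ} {χ : E3 → ℝ} {m₀ : E3 → E3} {u v vt : ℝ × E3 → E3} {vx : Fin 3 → ℝ × E3 → E3}

/-- Functions that are square integrable on all cylinders `(0,S) × B(0,R)`. -/
def LocSq (f : ℝ × E3 → E3) : Prop :=
  ∀ S R : ℝ, MemLp f 2 (volume.restrict (cylinder S R))

theorem LocSq.sub {f g : ℝ × E3 → E3} (hf : LocSq f) (hg : LocSq g) :
    LocSq (fun z => f z - g z) := fun S R => (hf S R).sub (hg S R)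

theorem locSq_of_continuousOn {f : ℝ × E3 → E3} (hf : ContinuousOn f closedHalfSpace) :
    LocSq f := fun S R =>
  (memLp_two_iff_integrable_sq_norm ((aestronglyMeasurable_slab_of_continuousOn hf S).mono_measure
    (Measure.restrict_mono (cylinder_subset_slab S R) le_rfl))).2
      ((locInt_of_continuousOn (hf.norm.pow 2)).integrableOn_cylinder S R)

theorem locSq_of_memLp {f : ℝ × E3 → E3}
    (h : ∀ S, 0 < S → MemLp f 2 (volume.restrict (slab S))) : LocSq f := fun S R =>
  (h (max S 1) (by positivity)).mono_measure (Measure.restrict_mono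
    ((cylinder_mono (le_max_left _ _) le_rfl).trans (cylinder_subset_slab _ R)) le_rfl)

theorem IsGlobalWeakSolution.locSq (h : IsGlobalWeakSolution m₀ v vt vx) : LocSq v := by
  intro S R
  have hi := h.locInt.integrableOn_cylinder S R
  refine (memLp_two_iff_integrable_sq_norm hi.1).2 (hi.norm.congr ?_)
  filter_upwards [ae_restrict_of_ae_restrict_of_subset (cylinder_subset_slab S R) (h.ae_norm S)]
    with z hz
  rw [hz, one_pow]

theorem LocSq.integrableOn_cylinder {f : ℝ × E3 → E3} (hf : LocSq f) (S R : ℝ) :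
    IntegrableOn (fun z => ‖f z‖ ^ 2) (cylinder S R) :=
  (memLp_two_iff_integrable_sq_norm (hf S R).1).1 (hf S R)

theorem LocSq.integrableOn_cutoff {f : ℝ × E3 → E3} (hf : LocSq f) (hχ : IsCutoff L R χ) (S : ℝ) :
    IntegrableOn (fun z => χ z.2 * ‖f z‖ ^ 2) (slab S) := by
  have h1 : IntegrableOn (fun z => χ z.2 * ‖f z‖ ^ 2) (cylinder S (2 * R)) := by
    refine Integrable.mono (hf.integrableOn_cylinder S (2 * R))
      ((hχ.smooth.continuous.comp continuous_snd).aestronglyMeasurable.mul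
        (hf.integrableOn_cylinder S (2 * R)).1) (Filter.Eventually.of_forall fun z => ?_)
    rw [norm_mul, Real.norm_of_nonneg (hχ.nonneg _)]
    exact mul_le_of_le_one_left (norm_nonneg _) (hχ.le_one _)
  refine h1.of_forall_sdiff_eq_zero (measurableSet_slab S) fun z hz => ?_
  by_cases h : χ z.2 = 0
  · rw [h, zero_mul]
  · exact absurd ⟨hz.1.1, hχ.mem_closedBall h⟩ hz.2

theorem ofReal_initialEnergy
    (hg : ∀ i, MemLp (fun x => fderiv ℝ m₀ x (basisVec i)) 2 volume) :
    ∫⁻ x : E3, ∑ i, ‖fderiv ℝ m₀ x (basisVec i)‖ₑ ^ 2 = ENNReal.ofReal (initialEnergy m₀) := by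
  have hi := fun i => (memLp_two_iff_integrable_sq_norm (hg i).1).1 (hg i)
  rw [initialEnergy, ← integral_finsetSum _ fun i _ => hi i,
    ofReal_integral_eq_lintegral_ofReal (integrable_finsetSum _ fun i _ => hi i)
      (Filter.Eventually.of_forall fun x => Finset.sum_nonneg fun i _ => sq_nonneg _)]
  refine lintegral_congr fun x => ?_
  rw [ENNReal.ofReal_sum_of_nonneg fun i _ => sq_nonneg _]
  refine Finset.sum_congr rfl fun i _ => ?_
  rw [ENNReal.ofReal_pow (norm_nonneg _), ofReal_norm]

theorem IsCutoff.enorm_mul_sq_le (hχ : IsCutoff L R χ) (x a : E3) :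
    ‖χ x * ‖a‖ ^ 2‖ₑ ≤ ‖a‖ₑ ^ 2 := by
  rw [Real.enorm_of_nonneg (mul_nonneg (hχ.nonneg x) (sq_nonneg _)), ← ofReal_norm a,
    ← ENNReal.ofReal_pow (norm_nonneg _)]
  exact ENNReal.ofReal_le_ofReal (mul_le_of_le_one_left (sq_nonneg _) (hχ.le_one x))

/-- The localized energy inequality. -/
theorem EnergyInequality.cutoff_le (h : EnergyInequality m₀ vt vx)
    (hg : ∀ i, MemLp (fun x => fderiv ℝ m₀ x (basisVec i)) 2 volume)
    (hvt : LocSq vt) (hvx : ∀ i, LocSq (vx i)) (hχ : IsCutoff L R χ) :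
    ∀ᵐ S ∂(volume.restrict (Ioo 0 T)),
      (∑ i, ∫ x, χ x * ‖vx i (S, x)‖ ^ 2) + ∫ z in slab S, χ z.2 * ‖vt z‖ ^ 2 ≤
        initialEnergy m₀ := by
  have hE0 : 0 ≤ initialEnergy m₀ :=
    Finset.sum_nonneg fun i _ => integral_nonneg fun x => sq_nonneg _
  filter_upwards [ae_restrict_of_ae_restrict_of_subset
      (Ioo_subset_Ioi_self.trans Ioi_subset_Ici_self) h,
    ae_all_iff.2 fun i => ae_integrable_slice ((hvx i).integrableOn_cutoff hχ T)] with S hS hi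
  rw [ofReal_initialEnergy hg] at hS
  rw [← integral_finsetSum _ fun i _ => hi i]
  have p1 : 0 ≤ ∫ x, ∑ i, χ x * ‖vx i (S, x)‖ ^ 2 := integral_nonneg fun x =>
    Finset.sum_nonneg fun i _ => mul_nonneg (hχ.nonneg _) (sq_nonneg _)
  have p2 : 0 ≤ ∫ z in slab S, χ z.2 * ‖vt z‖ ^ 2 :=
    integral_nonneg fun z => mul_nonneg (hχ.nonneg _) (sq_nonneg _)
  rw [← ENNReal.ofReal_le_ofReal_iff hE0, ENNReal.ofReal_add p1 p2]
  -- Since χ ≤ 1 the cutoff only decreases the left side. The right side stays the full initial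
  -- energy, and the defect vanishes as R → ∞.
  refine le_trans (add_le_add ?_ ?_) hS
  · rw [← Real.enorm_of_nonneg p1]
    refine (enorm_integral_le_lintegral_enorm _).trans (lintegral_mono fun x => ?_)
    exact (enorm_sum_le _ _).trans (Finset.sum_le_sum fun i _ => hχ.enorm_mul_sq_le _ _)
  · rw [← Real.enorm_of_nonneg p2, integral_slab (hvt.integrableOn_cutoff hχ S)]
    refine (enorm_integral_le_lintegral_enorm _).trans (lintegral_mono fun t => ?_)
    exact (enorm_integral_le_lintegral_enorm _).trans
      (lintegral_mono fun x => hχ.enorm_mul_sq_le _ _)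

/-- Antisymmetry of the triple product turns the two gyroscopic terms into one that is quadratic in
the differences. -/
theorem inner_wedge_sub (a b p q : E3) :
    - (inner ℝ (wedge a p) q : ℝ) - inner ℝ (wedge b q) p
      = - inner ℝ (wedge (b - a) (q - p)) p := by
  simp only [inner_eq_sum, Fin.sum_univ_three, wedge_apply_zero, wedge_apply_one, wedge_apply_two,
    PiLp.sub_apply]
  ring

/-- Here d stands for ∇w, and the first factor is |∇v|² - |∇u|². Its cubic contribution |d|²|w| is
made quadratic by |w| ≤ 2, as both maps take values in the sphere. -/
theorem neg_two_mul_sum_mul_inner_le {w p : E3} {d ai : Fin 3 → E3} {M : ℝ} (hw : ‖w‖ ≤ 2)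
    (hp : ‖p‖ ≤ M) (hai : ∀ i, ‖ai i‖ ≤ M) :
    - 2 * ((∑ i, (‖d i‖ ^ 2 + 2 * (inner ℝ (d i) (ai i) : ℝ))) * (inner ℝ w p : ℝ)) ≤
      (4 * M + 2 * M ^ 2) * (∑ i, ‖d i‖ ^ 2) + 6 * M ^ 2 * ‖w‖ ^ 2 := by
  have hM : 0 ≤ M := (norm_nonneg _).trans hp
  have hwp : |(inner ℝ w p : ℝ)| ≤ ‖w‖ * M :=
    (abs_real_inner_le_norm _ _).trans (mul_le_mul_of_nonneg_left hp (norm_nonneg _))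
  have hi : ∀ i, - 2 * ((‖d i‖ ^ 2 + 2 * (inner ℝ (d i) (ai i) : ℝ)) *
      (inner ℝ w p : ℝ)) ≤ (4 * M + 2 * M ^ 2) * ‖d i‖ ^ 2 + 2 * M ^ 2 * ‖w‖ ^ 2 := by
    intro i
    have h1 : |(inner ℝ (d i) (ai i) : ℝ)| ≤ ‖d i‖ * M :=
      (abs_real_inner_le_norm _ _).trans (mul_le_mul_of_nonneg_left (hai i) (norm_nonneg _))
    have h2 : |‖d i‖ ^ 2 + 2 * (inner ℝ (d i) (ai i) : ℝ)| ≤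
        ‖d i‖ ^ 2 + 2 * (‖d i‖ * M) := by
      refine (abs_add_le _ _).trans ?_
      rw [abs_of_nonneg (sq_nonneg _), abs_mul, abs_two]
      linarith
    have h3 := mul_le_mul h2 hwp (abs_nonneg _) (by positivity)
    rw [← abs_mul] at h3
    have h4 := neg_abs_le ((‖d i‖ ^ 2 + 2 * (inner ℝ (d i) (ai i) : ℝ)) *
      (inner ℝ w p : ℝ))
    have h5 : ‖d i‖ ^ 2 * (‖w‖ * M) ≤ ‖d i‖ ^ 2 * (2 * M) := by gcongr
    have h6 := mul_le_mul_of_nonneg_left (two_mul_le_add_sq ‖d i‖ ‖w‖)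
      (show 0 ≤ 2 * M ^ 2 by positivity)
    linarith
  calc - 2 * ((∑ i, (‖d i‖ ^ 2 + 2 * (inner ℝ (d i) (ai i) : ℝ))) * (inner ℝ w p : ℝ))
      = ∑ i, - 2 * ((‖d i‖ ^ 2 + 2 * (inner ℝ (d i) (ai i) : ℝ)) *
        (inner ℝ w p : ℝ)) := by rw [← Finset.mul_sum, ← Finset.sum_mul]
    _ ≤ ∑ i : Fin 3, ((4 * M + 2 * M ^ 2) * ‖d i‖ ^ 2 + 2 * M ^ 2 * ‖w‖ ^ 2) :=
        Finset.sum_le_sum fun i _ => hi i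
    _ = _ := by
        rw [Finset.sum_add_distrib, ← Finset.mul_sum]
        simp
        ring

/-- The pointwise estimate behind the stability inequality. -/
theorem stability_density_le {a b p q D : E3} {ai bi : Fin 3 → E3} {M : ℝ}
    (ha : ‖a‖ = 1) (hb : ‖b‖ = 1) (hap : inner ℝ a p = (0 : ℝ)) (hbq : inner ℝ b q = (0 : ℝ))
    (hp : ‖p‖ ≤ M) (hai : ∀ i, ‖ai i‖ ≤ M)
    (hD : (2 : ℝ) • D = p - wedge a p - (2 * ∑ i, ‖ai i‖ ^ 2) • a) :
    - ‖p‖ ^ 2 - ‖q‖ ^ 2 + 2 * inner ℝ D q + inner ℝ (q - wedge b q) p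
        - 2 * ((∑ i, ‖bi i‖ ^ 2) * inner ℝ b p) ≤
      - (1 / 2) * ‖q - p‖ ^ 2 + (1 / 2 * (M + 6 * M ^ 2) ^ 2 + 8 * M ^ 2 + 4 * M) *
        (‖b - a‖ ^ 2 + ∑ i, ‖bi i - ai i‖ ^ 2) := by
  have hM : 0 ≤ M := (norm_nonneg _).trans hp
  have e1 : 2 * (inner ℝ D q : ℝ) = inner ℝ p q - inner ℝ (wedge a p) q
      - 2 * ((∑ i, ‖ai i‖ ^ 2) * inner ℝ a q) := by
    have := congrArg (fun y => (inner ℝ y q : ℝ)) hD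
    simp only [inner_sub_left, real_inner_smul_left] at this
    linarith
  -- The orthogonality relations make a·q and b·p small, of the order of the differences. The parts
  -- 2A(w·p) coming from both then cancel, where A = |∇u|².
  have e2 : (inner ℝ a q : ℝ) = - inner ℝ (b - a) (q - p) - inner ℝ (b - a) p := by
    simp only [inner_sub_left, inner_sub_right, hap, hbq]; ring
  have e3 : (inner ℝ b p : ℝ) = inner ℝ (b - a) p := by rw [inner_sub_left, hap, sub_zero]
  have e4 : ‖q - p‖ ^ 2 = ‖q‖ ^ 2 - 2 * inner ℝ p q + ‖p‖ ^ 2 := by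
    rw [norm_sub_sq_real, real_inner_comm]
  have e5 := inner_wedge_sub a b p q
  have e6 : ∀ i, ‖bi i‖ ^ 2 = ‖ai i‖ ^ 2 + (‖bi i - ai i‖ ^ 2 + 2 * inner ℝ (bi i - ai i) (ai i)) := by
    intro i
    conv_lhs => rw [← sub_add_cancel (bi i) (ai i), norm_add_sq_real]
    ring
  have hw2 : ‖b - a‖ ≤ 2 := (norm_sub_le _ _).trans (by rw [ha, hb]; norm_num)
  set w := b - a
  set r := q - p
  set A := ∑ i, ‖ai i‖ ^ 2
  have hA : A ≤ 3 * M ^ 2 := by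
    refine (Finset.sum_le_sum fun i _ => pow_le_pow_left₀ (norm_nonneg _) (hai i) 2).trans ?_
    simp
  have hA0 : 0 ≤ A := Finset.sum_nonneg fun i _ => sq_nonneg _
  have hB : ∑ i, ‖bi i‖ ^ 2 = A +
      ∑ i, (‖bi i - ai i‖ ^ 2 + 2 * inner ℝ (bi i - ai i) (ai i)) := by
    rw [← Finset.sum_add_distrib]; exact Finset.sum_congr rfl fun i _ => e6 i
  set B := ∑ i, (‖bi i - ai i‖ ^ 2 + 2 * (inner ℝ (bi i - ai i) (ai i) : ℝ))
  have b1 : - (inner ℝ (wedge w r) p : ℝ) ≤ ‖w‖ * ‖r‖ * M := by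
    refine (neg_le_abs _).trans ((abs_real_inner_le_norm _ _).trans ?_)
    exact mul_le_mul (norm_wedge_le w r) hp (norm_nonneg _) (by positivity)
  have b2 : 2 * (A * (inner ℝ w r : ℝ)) ≤ 6 * M ^ 2 * (‖w‖ * ‖r‖) := by
    have h1 := real_inner_le_norm w r
    have h2 : A * (inner ℝ w r : ℝ) ≤ A * (‖w‖ * ‖r‖) := mul_le_mul_of_nonneg_left h1 hA0
    have h3 : A * (‖w‖ * ‖r‖) ≤ 3 * M ^ 2 * (‖w‖ * ‖r‖) :=
      mul_le_mul_of_nonneg_right hA (by positivity)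
    linarith
  have b3 : - 2 * (B * (inner ℝ w p : ℝ)) ≤
      (4 * M + 2 * M ^ 2) * (∑ i, ‖bi i - ai i‖ ^ 2) + 6 * M ^ 2 * ‖w‖ ^ 2 :=
    neg_two_mul_sum_mul_inner_le hw2 hp hai
  have hs0 : 0 ≤ ∑ i, ‖bi i - ai i‖ ^ 2 := Finset.sum_nonneg fun i _ => sq_nonneg _
  set s := ∑ i, ‖bi i - ai i‖ ^ 2
  rw [e1, e2, e3, hB, inner_sub_left q, real_inner_comm q p]
  rw [real_inner_comm q p] at e4
  clear_value s A B w r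
  -- Young's inequality spends half of |r|², with r the difference of the time derivatives; the
  -- other half remains in the conclusion.
  have b4 : (M + 6 * M ^ 2) * (‖w‖ * ‖r‖) ≤
      1 / 2 * ‖r‖ ^ 2 + 1 / 2 * (M + 6 * M ^ 2) ^ 2 * ‖w‖ ^ 2 := by
    have := two_mul_le_add_sq ((M + 6 * M ^ 2) * ‖w‖) ‖r‖
    rw [mul_pow] at this
    linarith
  -- The slack needed to use one common constant for |w|² and for the squared gradient differences.
  have b5 : 0 ≤ 1 / 2 * (M + 6 * M ^ 2) ^ 2 * s + 6 * M ^ 2 * s + (2 * M ^ 2 + 4 * M) * ‖w‖ ^ 2 := by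
    positivity
  linarith [b1, b2, b3, b4, b5, e4, e5]

end LandauLifshitz
end

/-! ### The localized stability inequality. -/

noncomputable section

namespace LandauLifshitz

variable {L R T : ℝ} {χ : E3 → ℝ} {m₀ : E3 → E3} {u v vt : ℝ × E3 → E3} {vx : Fin 3 → ℝ × E3 → E3}

theorem IsCutoff.abs_fderiv_le (hχ : IsCutoff L R χ) (hL : 0 ≤ L) (hR : 0 < R) (i : Fin 3) (x : E3) :
    |fderiv ℝ χ x (basisVec i)| ≤ L / R := by
  refine abs_le_of_sq_le_sq ((hχ.sq_fderiv_le i x).trans ?_) (by positivity)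
  exact mul_le_of_le_one_right (sq_nonneg _) (hχ.le_one x)

/-- The factor 6 is dictated by |p|², which occurs twice in each of the three directions after
applying 2|x·y| ≤ |x|² + |y|². -/
theorem boundary_density_le {c : Fin 3 → ℝ} {l : ℝ} (hc : ∀ i, |c i| ≤ l) (ai bi : Fin 3 → E3)
    (p q : E3) :
    ∑ i, c i * (- 2 * (inner ℝ (ai i) p : ℝ) + 2 * inner ℝ (ai i) q + 2 * inner ℝ (bi i) p) ≤
      6 * l * ((∑ i, ‖ai i‖ ^ 2) + ‖p‖ ^ 2 + ((∑ i, ‖bi i‖ ^ 2) + ‖q‖ ^ 2)) := by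
  have hl : 0 ≤ l := (abs_nonneg _).trans (hc 0)
  have hin : ∀ x y : E3, 2 * |(inner ℝ x y : ℝ)| ≤ ‖x‖ ^ 2 + ‖y‖ ^ 2 := fun x y => by
    have h1 := abs_real_inner_le_norm x y
    have h2 := two_mul_le_add_sq ‖x‖ ‖y‖
    linarith
  have hi : ∀ i, c i * (- 2 * (inner ℝ (ai i) p : ℝ) + 2 * inner ℝ (ai i) q + 2 * inner ℝ (bi i) p) ≤
      l * (2 * ‖ai i‖ ^ 2 + 2 * ‖p‖ ^ 2 + ‖q‖ ^ 2 + ‖bi i‖ ^ 2) := by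
    intro i
    refine (le_abs_self _).trans ?_
    rw [abs_mul]
    refine mul_le_mul (hc i) ?_ (abs_nonneg _) hl
    have h1 := hin (ai i) p
    have h2 := hin (ai i) q
    have h3 := hin (bi i) p
    rw [abs_le]
    constructor <;> linarith [neg_abs_le (inner ℝ (ai i) p : ℝ), le_abs_self (inner ℝ (ai i) p : ℝ),
      neg_abs_le (inner ℝ (ai i) q : ℝ), le_abs_self (inner ℝ (ai i) q : ℝ),
      neg_abs_le (inner ℝ (bi i) p : ℝ), le_abs_self (inner ℝ (bi i) p : ℝ)]
  refine (Finset.sum_le_sum fun i _ => hi i).trans ?_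
  simp only [Fin.sum_univ_three]
  have : 0 ≤ l * (4 * (‖ai 0‖ ^ 2 + ‖ai 1‖ ^ 2 + ‖ai 2‖ ^ 2) +
    5 * (‖bi 0‖ ^ 2 + ‖bi 1‖ ^ 2 + ‖bi 2‖ ^ 2) + 3 * ‖q‖ ^ 2) := by positivity
  linarith

/-- The density of the variation of the localized energy of `v - u`. -/
def stabilityDensity (χ : E3 → ℝ) (u v vt : ℝ × E3 → E3) (vx : Fin 3 → ℝ × E3 → E3)
    (z : ℝ × E3) : ℝ :=
  (- (χ z.2 * ‖dirDeriv timeDir u z‖ ^ 2) - 2 * ∑ i, fderiv ℝ χ z.2 (basisVec i) *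
      (inner ℝ (dirDeriv (spaceDir i) u z) (dirDeriv timeDir u z) : ℝ))
    - 2 * crossDensity χ u vt vx z - χ z.2 * ‖vt z‖ ^ 2
    + ((inner ℝ (vt z - wedge (v z) (vt z)) (χ z.2 • dirDeriv timeDir u z) : ℝ) +
        2 * ∑ i, (inner ℝ (vx i z)
            (dirDeriv (spaceDir i) (fun z => χ z.2 • dirDeriv timeDir u z) z)
          - ‖vx i z‖ ^ 2 * inner ℝ (v z) (χ z.2 • dirDeriv timeDir u z)))

/-- The second derivatives ∂ᵢ∂ₜu from the cross term and from the tested weak formulation cancel.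
Only Δu remains, separated from the terms with ∂χ. -/
theorem stabilityDensity_eq (hu : ContDiffOn ℝ ∞ u closedHalfSpace) (hχ : IsCutoff L R χ)
    {z : ℝ × E3} (hz : z ∈ closedHalfSpace) :
    stabilityDensity χ u v vt vx z =
      χ z.2 * (- ‖dirDeriv timeDir u z‖ ^ 2 - ‖vt z‖ ^ 2
        + 2 * inner ℝ (∑ i, dirDeriv (spaceDir i) (dirDeriv (spaceDir i) u) z) (vt z)
        + inner ℝ (vt z - wedge (v z) (vt z)) (dirDeriv timeDir u z)
        - 2 * ((∑ i, ‖vx i z‖ ^ 2) * inner ℝ (v z) (dirDeriv timeDir u z)))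
      + ∑ i, fderiv ℝ χ z.2 (basisVec i) *
        (- 2 * inner ℝ (dirDeriv (spaceDir i) u z) (dirDeriv timeDir u z)
          + 2 * inner ℝ (dirDeriv (spaceDir i) u z) (vt z)
          + 2 * inner ℝ (vx i z) (dirDeriv timeDir u z)) := by
  have hut := hu.dirDeriv timeDir
  simp only [stabilityDensity, crossDensity, fun i => hχ.dirDeriv_smul_space hut hz i,
    inner_add_left, inner_add_right, real_inner_smul_right, Fin.sum_univ_three]
  rw [real_inner_comm (vx 0 z), real_inner_comm (vx 1 z), real_inner_comm (vx 2 z)]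
  ring

theorem integral_sq_sub {μ : Measure E3} {c : E3 → ℝ} {a b : E3 → E3}
    (ha : Integrable (fun x => c x * ‖a x‖ ^ 2) μ) (hb : Integrable (fun x => c x * ‖b x‖ ^ 2) μ)
    (hab : Integrable (fun x => c x * ‖b x - a x‖ ^ 2) μ) :
    ∫ x, c x * ‖b x - a x‖ ^ 2 ∂μ = (∫ x, c x * ‖b x‖ ^ 2 ∂μ) + (∫ x, c x * ‖a x‖ ^ 2 ∂μ)
      - 2 * ∫ x, c x * inner ℝ (a x) (b x) ∂μ := by
  have h : ∀ x, c x * (inner ℝ (a x) (b x) : ℝ) =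
      1 / 2 * ((c x * ‖b x‖ ^ 2 + c x * ‖a x‖ ^ 2) - c x * ‖b x - a x‖ ^ 2) := fun x => by
    rw [norm_sub_sq_real, real_inner_comm]; ring
  simp_rw [h]
  have hba : Integrable (fun x => c x * ‖b x‖ ^ 2 + c x * ‖a x‖ ^ 2) μ := hb.add ha
  rw [integral_const_mul, integral_sub hba hab, integral_add hb ha]
  ring

theorem integral_sub_two_mul_sub_add {α : Type*} [MeasurableSpace α] {μ : Measure α}
    {f g h k : α → ℝ} (hf : Integrable f μ) (hg : Integrable g μ) (hh : Integrable h μ)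
    (hk : Integrable k μ) : ∫ x, (f x - 2 * g x - h x + k x) ∂μ =
      (∫ x, f x ∂μ) - 2 * (∫ x, g x ∂μ) - (∫ x, h x ∂μ) + ∫ x, k x ∂μ := by
  have h1 : Integrable (fun x => f x - 2 * g x) μ := hf.sub (hg.const_mul 2)
  have h2 : Integrable (fun x => f x - 2 * g x - h x) μ := h1.sub hh
  rw [integral_add h2 hk, integral_sub h1 hh, integral_sub hf (hg.const_mul 2), integral_const_mul]

theorem integral_const_mul_add_add {α : Type*} [MeasurableSpace α] {μ : Measure α}
    {f g h : α → ℝ} (hf : Integrable f μ) (hg : Integrable g μ) (hh : Integrable h μ) (a b c : ℝ) :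
    ∫ x, (a * f x + b * g x + c * h x) ∂μ =
      a * (∫ x, f x ∂μ) + b * (∫ x, g x ∂μ) + c * ∫ x, h x ∂μ := by
  have h1 : Integrable (fun x => a * f x + b * g x) μ := (hf.const_mul a).add (hg.const_mul b)
  rw [integral_add h1 (hh.const_mul c), integral_add (hf.const_mul a) (hg.const_mul b),
    integral_const_mul, integral_const_mul, integral_const_mul]

/-- The constant of the stability inequality. -/
def stabilityConst (M : ℝ) : ℝ := 1 / 2 * (M + 6 * M ^ 2) ^ 2 + 8 * M ^ 2 + 4 * M

/-- The localized energy of the difference of a weak and of a smooth solution. -/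
theorem energy_sub_le (hm₀ : ContDiff ℝ ∞ m₀)
    (hg : ∀ i, MemLp (fun x => fderiv ℝ m₀ x (basisVec i)) 2 volume)
    (hv : IsGlobalWeakSolution m₀ v vt vx) (hve : EnergyInequality m₀ vt vx)
    (hu : IsTruncatedSolution T m₀ u) (hχ : IsCutoff L R χ) :
    (∀ S, 0 < S → IntegrableOn (stabilityDensity χ u v vt vx) (slab S)) ∧
    ∀ᵐ S ∂(volume.restrict (Ioo 0 T)),
      ∑ i, ∫ x, χ x * ‖vx i (S, x) - dirDeriv (spaceDir i) u (S, x)‖ ^ 2 ≤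
        initialEnergy m₀ - (∑ i, ∫ x, χ x * ‖fderiv ℝ m₀ x (basisVec i)‖ ^ 2) +
          ∫ z in slab S, stabilityDensity χ u v vt vx z := by
  have hus := hu.smooth
  have hut := hus.dirDeriv timeDir
  have qux : ∀ i, LocSq (dirDeriv (spaceDir i) u) := fun i =>
    locSq_of_continuousOn (hus.dirDeriv _).continuousOn
  have qvt : LocSq vt := locSq_of_memLp hv.memLp_dt
  have qvx : ∀ i, LocSq (vx i) := fun i => locSq_of_memLp fun _ hS => hv.memLp_dx hS i
  obtain ⟨i1, h1⟩ := hu.energy_identity hm₀ hχ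
  obtain ⟨i2, h2⟩ := integral_cutoff_cross hm₀ hus hu.initial hχ hv.weak_dx hv.locInt hv.locInt_dt
    hv.locInt_dx (hv.initial.ae_eq_primitive hm₀.continuous hv.locInt hv.locInt_dt)
  obtain ⟨N, hN, hNu⟩ := hu.vanish
  have hΦN : ∀ z ∈ closedHalfSpace, N + 1 ≤ z.1 → χ z.2 • dirDeriv timeDir u z = 0 := by
    intro z hz hzN
    rw [dirDeriv_eq_zero_of_eventuallyEq ?_ hz, smul_zero]
    have hn : {y : ℝ × E3 | N < y.1} ∈ nhds z :=
      (isOpen_Ioi.preimage continuous_fst).mem_nhds (show N < z.1 by linarith)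
    filter_upwards [mem_nhdsWithin_of_mem_nhds hn, self_mem_nhdsWithin] with y hy hy'
    exact hNu y hy' (le_of_lt hy)
  have h3 := fun (S : ℝ) (hS : 0 < S) => hv.weak_eq_wedge (isCompact_closedBall (0 : E3) (2 * R))
    (hχ.contDiffOn_smul hut) (hχ.suppIn_smul _) (by linarith : 0 < N + 1) hΦN hS
  have i4 := fun S => qvt.integrableOn_cutoff hχ S
  refine ⟨fun S hS => (((i1 S).sub ((i2 S).const_mul 2)).sub (i4 S)).add (h3 S hS).1, ?_⟩
  filter_upwards [h1, ae_restrict_of_ae_restrict_of_subset Ioo_subset_Ioi_self h2,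
    hve.cutoff_le hg qvt qvx hχ, ae_restrict_mem measurableSet_Ioo,
    ae_all_iff.2 fun i => ae_integrable_slice ((qux i).integrableOn_cutoff hχ T),
    ae_all_iff.2 fun i => ae_integrable_slice ((qvx i).integrableOn_cutoff hχ T),
    ae_all_iff.2 fun i => ae_integrable_slice (((qvx i).sub (qux i)).integrableOn_cutoff hχ T)]
    with S e1 e2 e3 hS s1 s2 s3
  have key : ∫ z in slab S, stabilityDensity χ u v vt vx z =
      (∫ z in slab S, (- (χ z.2 * ‖dirDeriv timeDir u z‖ ^ 2)
            - 2 * ∑ i, fderiv ℝ χ z.2 (basisVec i) *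
              (inner ℝ (dirDeriv (spaceDir i) u z) (dirDeriv timeDir u z) : ℝ)))
        - 2 * (∫ z in slab S, crossDensity χ u vt vx z) - ∫ z in slab S, χ z.2 * ‖vt z‖ ^ 2 := by
    -- The zero inserted here is the weak formulation tested with v∧(χ∂ₜu).
    rw [← add_zero (_ - _ - ∫ z in slab S, χ z.2 * ‖vt z‖ ^ 2), ← (h3 S hS.1).2]
    exact integral_sub_two_mul_sub_add (i1 S) (i2 S) (i4 S) (h3 S hS.1).1
  rw [key, Finset.sum_congr rfl fun i _ => integral_sq_sub (s1 i) (s2 i) (s3 i),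
    Finset.sum_sub_distrib, Finset.sum_add_distrib, ← Finset.mul_sum, e1, e2]
  linarith

/-- The squared derivatives of `u` and `v`. -/
def derivSq (u vt : ℝ × E3 → E3) (vx : Fin 3 → ℝ × E3 → E3) (z : ℝ × E3) : ℝ :=
  (∑ i, ‖dirDeriv (spaceDir i) u z‖ ^ 2) + ‖dirDeriv timeDir u z‖ ^ 2 +
    ((∑ i, ‖vx i z‖ ^ 2) + ‖vt z‖ ^ 2)

theorem derivSq_nonneg (z : ℝ × E3) : 0 ≤ derivSq u vt vx z :=
  add_nonneg (add_nonneg (Finset.sum_nonneg fun _ _ => sq_nonneg _) (sq_nonneg _))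
    (add_nonneg (Finset.sum_nonneg fun _ _ => sq_nonneg _) (sq_nonneg _))

theorem stabilityDensity_le (hL : 0 ≤ L) (hR : 0 < R) (hu : IsTruncatedSolution T m₀ u)
    (hχ : IsCutoff L R χ) {M S : ℝ} {z : ℝ × E3} (hS : S ≤ T) (hz : z ∈ slab S)
    (hM : ‖dirDeriv timeDir u z‖ ≤ M ∧ ∀ i, ‖dirDeriv (spaceDir i) u z‖ ≤ M)
    (hvz : ‖v z‖ = 1) (hvt : inner ℝ (v z) (vt z) = (0 : ℝ)) :
    stabilityDensity χ u v vt vx z ≤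
      - (1 / 2) * (χ z.2 * ‖vt z - dirDeriv timeDir u z‖ ^ 2) +
        stabilityConst M * (χ z.2 * ‖v z - u z‖ ^ 2 +
          ∑ i, χ z.2 * ‖vx i z - dirDeriv (spaceDir i) u z‖ ^ 2) +
        6 * (L / R) * (cylinder S (2 * R)).indicator (derivSq u vt vx) z := by
  have hzT : z ∈ slab T := ⟨⟨hz.1.1, hz.1.2.trans_le hS⟩, mem_univ _⟩
  have hd := stability_density_le (bi := fun i => vx i z) (hu.norm_eq_one z hzT) hvz
    (hu.orthogonal_dt z hzT) hvt hM.1 hM.2 (hu.equation z hzT)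
  have hd' := mul_le_mul_of_nonneg_left hd (hχ.nonneg z.2)
  rw [stabilityDensity_eq hu.smooth hχ (mem_closedHalfSpace_of_mem_slab hz), ← Finset.mul_sum]
  -- Where χ = 0 its gradient vanishes too, so the error is supported in the cylinder of radius 2R.
  by_cases hz0 : χ z.2 = 0
  · simp only [hz0, hχ.fderiv_eq_zero hz0, zero_mul, mul_zero, Finset.sum_const_zero,
      zero_add]
    refine mul_nonneg (by positivity) (indicator_nonneg (fun z _ => derivSq_nonneg z) z)
  · have hmem : z ∈ cylinder S (2 * R) := ⟨hz.1, hχ.mem_closedBall hz0⟩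
    rw [indicator_of_mem hmem]
    have hb := boundary_density_le (fun i => hχ.abs_fderiv_le hL hR i z.2)
      (fun i => dirDeriv (spaceDir i) u z) (fun i => vx i z) (dirDeriv timeDir u z) (vt z)
    refine (add_le_add hd' hb).trans (le_of_eq ?_)
    unfold stabilityConst derivSq
    ring

theorem integrableOn_derivSq (hu : IsTruncatedSolution T m₀ u)
    (hv : IsGlobalWeakSolution m₀ v vt vx) (S R : ℝ) :
    IntegrableOn (derivSq u vt vx) (cylinder S R) := by
  have qu := fun d => locSq_of_continuousOn (hu.smooth.dirDeriv d).continuousOn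
  exact ((integrable_finsetSum _ fun i _ => (qu (spaceDir i)).integrableOn_cylinder S R).add
    ((qu timeDir).integrableOn_cylinder S R)).add
      ((integrable_finsetSum _ fun i _ =>
        (locSq_of_memLp fun _ hS => hv.memLp_dx hS i).integrableOn_cylinder S R).add
          ((locSq_of_memLp hv.memLp_dt).integrableOn_cylinder S R))

/-- The stability inequality. -/
theorem stability_le (hL : 0 ≤ L) (hR : 0 < R) (hm₀ : ContDiff ℝ ∞ m₀)
    (hg : ∀ i, MemLp (fun x => fderiv ℝ m₀ x (basisVec i)) 2 volume)
    (hv : IsGlobalWeakSolution m₀ v vt vx) (hve : EnergyInequality m₀ vt vx)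
    (hu : IsTruncatedSolution T m₀ u) (hχ : IsCutoff L R χ) {M : ℝ}
    (hM : ∀ z ∈ slab T, ‖dirDeriv timeDir u z‖ ≤ M ∧ ∀ i, ‖dirDeriv (spaceDir i) u z‖ ≤ M) :
    ∀ᵐ S ∂(volume.restrict (Ioo 0 T)),
      (∑ i, ∫ x, χ x * ‖vx i (S, x) - dirDeriv (spaceDir i) u (S, x)‖ ^ 2) +
          1 / 2 * ∫ z in slab S, χ z.2 * ‖vt z - dirDeriv timeDir u z‖ ^ 2 ≤
        initialEnergy m₀ - (∑ i, ∫ x, χ x * ‖fderiv ℝ m₀ x (basisVec i)‖ ^ 2) +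
          stabilityConst M * (∫ z in slab S, (χ z.2 * ‖v z - u z‖ ^ 2 +
            ∑ i, χ z.2 * ‖vx i z - dirDeriv (spaceDir i) u z‖ ^ 2)) +
          6 * (L / R) * ∫ z in cylinder S (2 * R), derivSq u vt vx z := by
  have hus := hu.smooth
  have hut := hus.dirDeriv timeDir
  have qut : LocSq (dirDeriv timeDir u) := locSq_of_continuousOn hut.continuousOn
  have qux : ∀ i, LocSq (dirDeriv (spaceDir i) u) := fun i =>
    locSq_of_continuousOn (hus.dirDeriv _).continuousOn
  have qvt : LocSq vt := locSq_of_memLp hv.memLp_dt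
  have qvx : ∀ i, LocSq (vx i) := fun i => locSq_of_memLp fun _ hS => hv.memLp_dx hS i
  have qw : LocSq (fun z => v z - u z) := hv.locSq.sub (locSq_of_continuousOn hus.continuousOn)
  obtain ⟨i0, h0⟩ := energy_sub_le hm₀ hg hv hve hu hχ
  filter_upwards [h0, ae_restrict_mem measurableSet_Ioo] with S hS hST
  have j1 := (qvt.sub qut).integrableOn_cutoff hχ S
  have j2 : IntegrableOn (fun z => χ z.2 * ‖v z - u z‖ ^ 2 +
      ∑ i, χ z.2 * ‖vx i z - dirDeriv (spaceDir i) u z‖ ^ 2) (slab S) :=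
    (qw.integrableOn_cutoff hχ S).add
      (integrable_finsetSum _ fun i _ => ((qvx i).sub (qux i)).integrableOn_cutoff hχ S)
  have j3 := integrableOn_indicator_cylinder (integrableOn_derivSq hu hv S (2 * R))
  have o1 := ae_restrict_of_ae_restrict_of_subset (slab_subset_halfSpace S)
    (hv.weak_dt.inner_eq_zero hv.norm_eq_one)
  have key : ∫ z in slab S, stabilityDensity χ u v vt vx z ≤
      ∫ z in slab S, (- (1 / 2) * (χ z.2 * ‖vt z - dirDeriv timeDir u z‖ ^ 2) +
        stabilityConst M * (χ z.2 * ‖v z - u z‖ ^ 2 +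
          ∑ i, χ z.2 * ‖vx i z - dirDeriv (spaceDir i) u z‖ ^ 2) +
        6 * (L / R) * (cylinder S (2 * R)).indicator (derivSq u vt vx) z) := by
    refine integral_mono_ae (i0 S hST.1)
      (((j1.const_mul _).add (j2.const_mul _)).add (j3.const_mul _)) ?_
    filter_upwards [ae_restrict_mem (measurableSet_slab S), hv.ae_norm S, o1] with z hz hvz hbq
    exact stabilityDensity_le hL hR hu hχ hST.2.le hz
      (hM z ⟨⟨hz.1.1, hz.1.2.trans hST.2⟩, mem_univ _⟩) hvz hbq
  rw [integral_const_mul_add_add j1 j2 j3, integral_indicator_cylinder] at key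
  linarith

end LandauLifshitz
end

/-! ### Control of the difference, Gronwall's lemma and the limit of large radius. -/

noncomputable section

namespace LandauLifshitz

variable {L R T : ℝ} {χ : E3 → ℝ} {m₀ : E3 → E3} {u v vt : ℝ × E3 → E3} {vx : Fin 3 → ℝ × E3 → E3}

theorem sq_norm_integral_Ioo_le {F : Type*} [NormedAddCommGroup F] [NormedSpace ℝ F] {h : ℝ → F}
    {t : ℝ} (ht : 0 < t) (h1 : IntegrableOn h (Ioo 0 t))
    (h2 : IntegrableOn (fun s => ‖h s‖ ^ 2) (Ioo 0 t)) :
    ‖∫ s in Ioo 0 t, h s‖ ^ 2 ≤ t * ∫ s in Ioo 0 t, ‖h s‖ ^ 2 := by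
  set A := ∫ s in Ioo 0 t, ‖h s‖
  have hA : ‖∫ s in Ioo 0 t, h s‖ ≤ A := norm_integral_le_integral_norm _
  -- The Cauchy–Schwarz inequality, from the nonnegativity of the integral of (|h| - mean)².
  have h3 : 0 ≤ ∫ s in Ioo 0 t, (‖h s‖ - A / t) ^ 2 := integral_nonneg fun s => sq_nonneg _
  have h4 : ∫ s in Ioo 0 t, (‖h s‖ - A / t) ^ 2 =
      (∫ s in Ioo 0 t, ‖h s‖ ^ 2) - 2 * (A / t) * A + t * (A / t) ^ 2 := by
    have i1 : IntegrableOn (fun s => ‖h s‖ ^ 2 - 2 * (A / t) * ‖h s‖) (Ioo 0 t) :=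
      h2.sub (h1.norm.const_mul _)
    have i2 : IntegrableOn (fun _ => (A / t) ^ 2) (Ioo 0 t) := integrableOn_const (by simp)
    calc ∫ s in Ioo 0 t, (‖h s‖ - A / t) ^ 2
        = ∫ s in Ioo 0 t, (‖h s‖ ^ 2 - 2 * (A / t) * ‖h s‖ + (A / t) ^ 2) :=
          integral_congr_ae (Filter.Eventually.of_forall fun s => by ring)
      _ = _ := by
          rw [integral_add i1 i2, integral_sub h2 (h1.norm.const_mul _), integral_const_mul]
          simp [ht.le, A]
  have h5 : A ^ 2 ≤ t * ∫ s in Ioo 0 t, ‖h s‖ ^ 2 := by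
    rw [h4] at h3
    have h6 := mul_nonneg ht.le h3
    have h7 : t * ((∫ s in Ioo 0 t, ‖h s‖ ^ 2) - 2 * (A / t) * A + t * (A / t) ^ 2) =
        t * (∫ s in Ioo 0 t, ‖h s‖ ^ 2) - A ^ 2 := by
      field_simp
      ring
    linarith
  exact (pow_le_pow_left₀ (norm_nonneg _) hA 2).trans h5

/-- The difference of two functions with the same initial value is controlled by the difference of
their time derivatives. -/
theorem integral_slice_sub_le (hm₀ : ContDiff ℝ ∞ m₀)
    (hv : IsGlobalWeakSolution m₀ v vt vx) (hu : IsTruncatedSolution T m₀ u)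
    (hχ : IsCutoff L R χ) :
    ∀ᵐ t ∂(volume.restrict (Ioo 0 T)),
      ∫ x, χ x * ‖v (t, x) - u (t, x)‖ ^ 2 ≤
        T * ∫ z in slab t, χ z.2 * ‖vt z - dirDeriv timeDir u z‖ ^ 2 := by
  have hus := hu.smooth
  have hut := hus.dirDeriv timeDir
  have lut := locInt_of_continuousOn hut.continuousOn
  have q := ((locSq_of_memLp hv.memLp_dt).sub (locSq_of_continuousOn hut.continuousOn))
  have r1 := hv.initial.ae_eq_primitive hm₀.continuous hv.locInt hv.locInt_dt
  rw [restrict_halfSpace] at r1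
  filter_upwards [ae_restrict_of_ae_restrict_of_subset Ioo_subset_Ioi_self
    (Measure.ae_ae_of_ae_prod r1), ae_restrict_mem measurableSet_Ioo] with t ht htT
  have iq := q.integrableOn_cutoff hχ t
  have iq' := iq
  rw [IntegrableOn, restrict_slab] at iq'
  rw [integral_slab_symm iq]
  have hnn : 0 ≤ ∫ x, ∫ s in Ioo 0 t, χ x * ‖vt (s, x) - dirDeriv timeDir u (s, x)‖ ^ 2 :=
    integral_nonneg fun x => integral_nonneg fun s => mul_nonneg (hχ.nonneg _) (sq_nonneg _)
  refine le_trans ?_ (mul_le_mul_of_nonneg_right htT.2.le hnn)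
  rw [← integral_const_mul]
  refine integral_mono_of_nonneg
    (Filter.Eventually.of_forall fun x => mul_nonneg (hχ.nonneg _) (sq_nonneg _))
    (iq'.integral_prod_right.const_mul t) ?_
  filter_upwards [ht, hv.locInt_dt.ae_intervalIntegrable, lut.ae_intervalIntegrable,
    iq'.prod_left_ae] with x hx i1 i2 i3
  by_cases h0 : χ x = 0
  · simp [h0]
  -- The initial values cancel, so v - u is the time integral of the difference of the time
  -- derivatives.
  have e : v (t, x) - u (t, x) =
      ∫ s in Ioo 0 t, (vt (s, x) - dirDeriv timeDir u (s, x)) := by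
    rw [hx, eq_primitive_of_contDiffOn hus hu.initial (mem_halfSpace.2 htT.1),
      setIntegral_Ioo_eq htT.1.le, intervalIntegral.integral_sub (i1 t htT.1.le) (i2 t htT.1.le)]
    simp only [timePrimitive]
    abel
  have j1 : IntegrableOn (fun s => vt (s, x) - dirDeriv timeDir u (s, x)) (Ioo 0 t) :=
    (intervalIntegrable_iff_Ioo htT.1.le).1 ((i1 t htT.1.le).sub (i2 t htT.1.le))
  have j2 : IntegrableOn (fun s => ‖vt (s, x) - dirDeriv timeDir u (s, x)‖ ^ 2) (Ioo 0 t) := by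
    have := i3.const_mul (χ x)⁻¹
    simpa only [inv_mul_cancel_left₀ h0, IntegrableOn] using this
  have := mul_le_mul_of_nonneg_left (sq_norm_integral_Ioo_le htT.1 j1 j2) (hχ.nonneg x)
  rw [e, integral_const_mul]
  linarith

/-- The function G is only integrable and the bound holds only almost everywhere. One integration
gives H ≤ f = ∫(α + βH) for the primitive H of G; as f is C¹ with f' ≤ α + βf, the classical
Gronwall lemma applies to f. -/
theorem integral_le_of_ae_le_add_mul_integral {G : ℝ → ℝ} {α β : ℝ} (hT : 0 < T) (hα : 0 ≤ α)
    (hβ : 0 < β) (hG : IntegrableOn G (Ioo 0 T)) (hG0 : ∀ t, 0 ≤ G t)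
    (h : ∀ᵐ S ∂(volume.restrict (Ioo 0 T)), G S ≤ α + β * ∫ t in Ioo 0 S, G t) :
    ∫ t in Ioo 0 T, G t ≤ α / β * (Real.exp (β * T) - 1) := by
  set g : ℝ → ℝ := (Ioo 0 T).indicator G with hg
  have ig : Integrable g := (integrable_indicator_iff measurableSet_Ioo).2 hG
  have g0 : ∀ t, 0 ≤ g t := fun t => indicator_nonneg (fun t _ => hG0 t) t
  set H : ℝ → ℝ := fun S => ∫ t in (0 : ℝ)..S, g t with hH
  have Hc : Continuous H := intervalIntegral.continuous_primitive
    (fun a b => ig.intervalIntegrable) 0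
  have HG : ∀ S ∈ Icc 0 T, ∫ t in Ioo 0 S, G t = H S := by
    intro S hS
    change _ = ∫ t in (0 : ℝ)..S, g t
    rw [← setIntegral_Ioo_eq hS.1]
    refine setIntegral_congr_fun measurableSet_Ioo fun t ht => ?_
    exact (indicator_of_mem (show t ∈ Ioo 0 T from ⟨ht.1, ht.2.trans_le hS.2⟩) G).symm
  have H0 : ∀ S, 0 ≤ S → 0 ≤ H S := fun S hS =>
    intervalIntegral.integral_nonneg hS fun t _ => g0 t
  set f : ℝ → ℝ := fun S => ∫ t in (0 : ℝ)..S, (α + β * H t) with hf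
  have kc : Continuous fun t => α + β * H t := by fun_prop
  have hd : ∀ S, HasDerivAt f (α + β * H S) S := fun S =>
    intervalIntegral.integral_hasDerivAt_right (kc.intervalIntegrable _ _)
      (kc.stronglyMeasurableAtFilter _ _) kc.continuousAt
  have f0 : ∀ S, 0 ≤ S → 0 ≤ f S := fun S hS =>
    intervalIntegral.integral_nonneg hS fun t ht => add_nonneg hα (mul_nonneg hβ.le (H0 t ht.1))
  have Hf : ∀ S ∈ Icc 0 T, H S ≤ f S := by
    intro S hS
    rw [← HG S hS, hf]
    simp only
    rw [← setIntegral_Ioo_eq hS.1]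
    refine integral_mono_ae (hG.mono_set (Ioo_subset_Ioo_right hS.2))
      ((intervalIntegrable_iff_Ioo hS.1).1 (kc.intervalIntegrable _ _)) ?_
    filter_upwards [ae_restrict_of_ae_restrict_of_subset (Ioo_subset_Ioo_right hS.2) h,
      ae_restrict_mem measurableSet_Ioo] with s hs hsS
    rwa [HG s ⟨hsS.1.le, hsS.2.le.trans hS.2⟩] at hs
  have key := norm_le_gronwallBound_of_norm_deriv_right_le (f := f) (f' := fun S => α + β * H S)
    (δ := 0) (K := β) (ε := α) (a := 0) (b := T)
    (fun S _ => (hd S).continuousAt.continuousWithinAt) (fun S _ => (hd S).hasDerivWithinAt)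
    (by simp [hf]) (fun S hS => by
      have hS' : S ∈ Icc 0 T := ⟨hS.1, hS.2.le⟩
      rw [Real.norm_of_nonneg (add_nonneg hα (mul_nonneg hβ.le (H0 S hS.1))),
        Real.norm_of_nonneg (f0 S hS.1), add_comm]
      exact add_le_add_left (mul_le_mul_of_nonneg_left (Hf S hS') hβ.le) _)
    T ⟨hT.le, le_rfl⟩
  simp only [gronwallBound_of_K_ne_0 hβ.ne', sub_zero, zero_mul, zero_add] at key
  rw [HG T ⟨hT.le, le_rfl⟩]
  exact (Hf T ⟨hT.le, le_rfl⟩).trans ((le_abs_self _).trans key)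

theorem stabilityConst_nonneg {M : ℝ} (hM : 0 ≤ M) : 0 ≤ stabilityConst M := by
  unfold stabilityConst
  positivity

/-- The localized distance of a weak and of a smooth solution. -/
theorem integral_cutoff_sub_le (hT : 0 < T) (hL : 0 ≤ L) (hR : 0 < R) (hm₀ : ContDiff ℝ ∞ m₀)
    (hg : ∀ i, MemLp (fun x => fderiv ℝ m₀ x (basisVec i)) 2 volume)
    (hv : IsGlobalWeakSolution m₀ v vt vx) (hve : EnergyInequality m₀ vt vx)
    (hu : IsTruncatedSolution T m₀ u) (hχ : IsCutoff L R χ) {M B : ℝ} (hM0 : 0 ≤ M)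
    (hM : ∀ z ∈ slab T, ‖dirDeriv timeDir u z‖ ≤ M ∧ ∀ i, ‖dirDeriv (spaceDir i) u z‖ ≤ M)
    (hB0 : 0 ≤ B)
    (hB : ∀ᵐ S ∂(volume.restrict (Ioo 0 T)), ∫ z in cylinder S (2 * R), derivSq u vt vx z ≤ B) :
    ∫ z in slab T, χ z.2 * ‖v z - u z‖ ^ 2 ≤
      (1 + 2 * T) * (initialEnergy m₀ - (∑ i, ∫ x, χ x * ‖fderiv ℝ m₀ x (basisVec i)‖ ^ 2) +
        6 * (L / R) * B) / ((1 + 2 * T) * (stabilityConst M + 1)) *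
          (Real.exp ((1 + 2 * T) * (stabilityConst M + 1) * T) - 1) := by
  have hC := stabilityConst_nonneg hM0
  have qw : LocSq (fun z => v z - u z) :=
    hv.locSq.sub (locSq_of_continuousOn hu.smooth.continuousOn)
  have qwx : ∀ i, LocSq (fun z => vx i z - dirDeriv (spaceDir i) u z) := fun i =>
    (locSq_of_memLp fun _ hS => hv.memLp_dx hS i).sub
      (locSq_of_continuousOn (hu.smooth.dirDeriv _).continuousOn)
  have i1 := fun S => qw.integrableOn_cutoff hχ S
  have i2 := fun i S => (qwx i).integrableOn_cutoff hχ S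
  have i3 : ∀ S, IntegrableOn (fun z => χ z.2 * ‖v z - u z‖ ^ 2 +
      ∑ i, χ z.2 * ‖vx i z - dirDeriv (spaceDir i) u z‖ ^ 2) (slab S) := fun S =>
    (i1 S).add (integrable_finsetSum _ fun i _ => i2 i S)
  have hpos : ∀ z, 0 ≤ ∑ i, χ z.2 * ‖vx i z - dirDeriv (spaceDir i) u z‖ ^ 2 := fun z =>
    Finset.sum_nonneg fun i _ => mul_nonneg (hχ.nonneg _) (sq_nonneg _)
  have hpos' : ∀ z, 0 ≤ χ z.2 * ‖v z - u z‖ ^ 2 := fun z => mul_nonneg (hχ.nonneg _) (sq_nonneg _)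
  set e := initialEnergy m₀ - (∑ i, ∫ x, χ x * ‖fderiv ℝ m₀ x (basisVec i)‖ ^ 2) +
    6 * (L / R) * B with he
  have he0 : 0 ≤ e := add_nonneg (sub_nonneg.2 (hχ.integral_le hg)) (by positivity)
  set G : ℝ → ℝ := fun t => ∫ x, (χ x * ‖v (t, x) - u (t, x)‖ ^ 2 +
      ∑ i, χ x * ‖vx i (t, x) - dirDeriv (spaceDir i) u (t, x)‖ ^ 2) with hG
  have G0 : ∀ t, 0 ≤ G t := fun t => integral_nonneg fun x =>
    add_nonneg (hpos' (t, x)) (hpos (t, x))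
  have hle : ∫ z in slab T, χ z.2 * ‖v z - u z‖ ^ 2 ≤ ∫ t in Ioo 0 T, G t := by
    rw [hG, ← integral_slab (i3 T)]
    exact integral_mono (i1 T) (i3 T) fun z => le_add_of_nonneg_right (hpos z)
  -- Gronwall with α = (1 + 2T)e and β = (1 + 2T)(C + 1), C being the stability constant. The added
  -- 1 keeps β positive even when M = 0.
  refine hle.trans (integral_le_of_ae_le_add_mul_integral hT (by positivity) (by positivity)
    (integrableOn_integral_slab (i3 T)) G0 ?_)
  filter_upwards [stability_le hL hR hm₀ hg hv hve hu hχ hM, hB, integral_slice_sub_le hm₀ hv hu hχ,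
    ae_integrable_slice (i1 T), ae_all_iff.2 fun i => ae_integrable_slice (i2 i T)]
    with S h1 h2 h3 h4 h5
  rw [integral_slab (i3 S)] at h1
  have h6 : G S = (∫ x, χ x * ‖v (S, x) - u (S, x)‖ ^ 2) +
      ∑ i, ∫ x, χ x * ‖vx i (S, x) - dirDeriv (spaceDir i) u (S, x)‖ ^ 2 := by
    rw [← integral_finsetSum _ fun i _ => h5 i]
    exact integral_add h4 (integrable_finsetSum _ fun i _ => h5 i)
  have p1 : 0 ≤ ∑ i, ∫ x, χ x * ‖vx i (S, x) - dirDeriv (spaceDir i) u (S, x)‖ ^ 2 :=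
    Finset.sum_nonneg fun i _ => integral_nonneg fun x => mul_nonneg (hχ.nonneg _) (sq_nonneg _)
  have p2 : 0 ≤ ∫ z in slab S, χ z.2 * ‖vt z - dirDeriv timeDir u z‖ ^ 2 :=
    integral_nonneg fun z => mul_nonneg (hχ.nonneg _) (sq_nonneg _)
  have p3 : 0 ≤ ∫ t in Ioo 0 S, G t := integral_nonneg G0
  have h7 : 6 * (L / R) * ∫ z in cylinder S (2 * R), derivSq u vt vx z ≤ 6 * (L / R) * B :=
    mul_le_mul_of_nonneg_left h2 (by positivity)
  change _ ≤ _ + stabilityConst M * (∫ t in Ioo 0 S, G t) + _ at h1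
  rw [h6]
  generalize (∑ i, ∫ x, χ x * ‖vx i (S, x) - dirDeriv (spaceDir i) u (S, x)‖ ^ 2) = a at *
  generalize (∫ z in slab S, χ z.2 * ‖vt z - dirDeriv timeDir u z‖ ^ 2) = b at *
  generalize (∫ t in Ioo 0 S, G t) = I at *
  -- The stability inequality bounds a + b/2, with a the gradient part and b the time derivative
  -- part. The zeroth order part is at most Tb, which costs the additional factor 2T.
  have h8 : a + 1 / 2 * b ≤ e + (stabilityConst M + 1) * I := by linarith
  have h9 : T * b ≤ T * (2 * (e + (stabilityConst M + 1) * I)) :=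
    mul_le_mul_of_nonneg_left (by linarith) hT.le
  linarith

theorem tendsto_cutoff_energy {χ : ℕ → E3 → ℝ} (hχ : ∀ n : ℕ, IsCutoff L ((n : ℝ) + 1) (χ n))
    (hg : ∀ i, MemLp (fun x => fderiv ℝ m₀ x (basisVec i)) 2 volume) :
    Filter.Tendsto (fun n : ℕ => ∑ i, ∫ x, χ n x * ‖fderiv ℝ m₀ x (basisVec i)‖ ^ 2) Filter.atTop
      (nhds (initialEnergy m₀)) := by
  refine tendsto_finsetSum _ fun i _ => ?_
  have hi := (memLp_two_iff_integrable_sq_norm (hg i).1).1 (hg i)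
  refine tendsto_integral_of_dominated_convergence _
    (fun n => (hχ n).smooth.continuous.aestronglyMeasurable.mul hi.1) hi
    (fun n => Filter.Eventually.of_forall fun x => ?_) (Filter.Eventually.of_forall fun x => ?_)
  · rw [Real.norm_of_nonneg (mul_nonneg ((hχ n).nonneg _) (sq_nonneg _))]
    exact mul_le_of_le_one_left (sq_nonneg _) ((hχ n).le_one x)
  · refine tendsto_const_nhds.congr' ?_
    filter_upwards [Filter.eventually_ge_atTop ⌈‖x‖⌉₊] with n hn
    have h1 : ‖x‖ ≤ (n : ℝ) + 1 := (Nat.ceil_le.1 hn).trans (by linarith)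
    rw [(hχ n).eq_one x h1, one_mul]

/-- A weak solution coincides with a smooth solution with the same initial value. -/
theorem IsTruncatedSolution.ae_eq (hT : 0 < T) (hm₀ : ContDiff ℝ ∞ m₀)
    (hg : ∀ i, MemLp (fun x => fderiv ℝ m₀ x (basisVec i)) 2 volume)
    (hv : IsGlobalWeakSolution m₀ v vt vx) (hve : EnergyInequality m₀ vt vx)
    (hu : IsTruncatedSolution T m₀ u) :
    ∀ᵐ z ∂(volume.restrict (slab T)), v z = u z := by
  obtain ⟨L, hL, hcut⟩ := exists_isCutoff
  have hcut' : ∀ n : ℕ, ∃ χ, IsCutoff L ((n : ℝ) + 1) χ := fun n => hcut _ (by positivity)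
  choose χ hχ using hcut'
  obtain ⟨M, hM⟩ := hu.bounded
  -- Any point of the slab shows that M is nonnegative.
  have hM0 : 0 ≤ M := (norm_nonneg _).trans (hM (T / 2, 0) (mem_slab.2 ⟨by positivity, by linarith⟩)).1
  obtain ⟨B₁, hB₁⟩ := hu.exists_bound_cylinder hT hm₀ hg
  set V : ℝ × E3 → ℝ := fun z => (∑ i, ‖vx i z‖ ^ 2) + ‖vt z‖ ^ 2 with hV
  have iV : IntegrableOn V (slab T) :=
    (integrable_finsetSum _ fun i _ => (memLp_two_iff_integrable_sq_norm
      (hv.memLp_dx hT i).1).1 (hv.memLp_dx hT i)).add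
        ((memLp_two_iff_integrable_sq_norm (hv.memLp_dt T hT).1).1 (hv.memLp_dt T hT))
  have V0 : ∀ z, 0 ≤ V z := fun z =>
    add_nonneg (Finset.sum_nonneg fun i _ => sq_nonneg _) (sq_nonneg _)
  -- One bound for all radii: the derivatives of `u` by the bootstrap, those of `v` by their square
  -- integrability on the slab. The maximum with 0 provides nonnegativity.
  set B := max 0 (B₁ + ∫ z in slab T, V z) with hBdef
  have hB : ∀ n : ℕ, ∀ᵐ S ∂(volume.restrict (Ioo 0 T)),
      ∫ z in cylinder S (2 * ((n : ℝ) + 1)), derivSq u vt vx z ≤ B := by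
    intro n
    have hn : (1 : ℝ) ≤ 2 * ((n : ℝ) + 1) := by linarith [(Nat.cast_nonneg n : (0 : ℝ) ≤ n)]
    filter_upwards [hB₁ _ hn, ae_restrict_mem measurableSet_Ioo] with S hS hST
    have hsub : cylinder S (2 * ((n : ℝ) + 1)) ⊆ slab T :=
      (cylinder_subset_slab _ _).trans (prod_mono (Ioo_subset_Ioo_right hST.2.le) subset_rfl)
    have iU : IntegrableOn (fun z => (∑ i, ‖dirDeriv (spaceDir i) u z‖ ^ 2) +
        ‖dirDeriv timeDir u z‖ ^ 2) (cylinder S (2 * ((n : ℝ) + 1))) :=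
      (locInt_of_continuousOn (hu.continuousOn_energy.add
        ((hu.smooth.dirDeriv timeDir).continuousOn.norm.pow 2))).integrableOn_cylinder _ _
    have h1 : ∫ z in cylinder S (2 * ((n : ℝ) + 1)), derivSq u vt vx z = _ :=
      integral_add iU (iV.mono_set hsub)
    rw [h1]
    refine le_trans (add_le_add hS ?_) (le_max_right _ _)
    exact setIntegral_mono_set iV (Filter.Eventually.of_forall V0) hsub.eventuallyLE
  have qw : LocSq (fun z => v z - u z) :=
    hv.locSq.sub (locSq_of_continuousOn hu.smooth.continuousOn)
  have main := fun n : ℕ => integral_cutoff_sub_le hT hL (by positivity : (0 : ℝ) < (n : ℝ) + 1) hm₀ hg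
    hv hve hu (hχ n) hM0 hM (le_max_left _ _) (hB n)
  have hlim : Filter.Tendsto (fun n : ℕ => (1 + 2 * T) * (initialEnergy m₀ -
      (∑ i, ∫ x, χ n x * ‖fderiv ℝ m₀ x (basisVec i)‖ ^ 2) + 6 * (L / ((n : ℝ) + 1)) * B) /
        ((1 + 2 * T) * (stabilityConst M + 1)) *
          (Real.exp ((1 + 2 * T) * (stabilityConst M + 1) * T) - 1)) Filter.atTop (nhds 0) := by
    have h1 : Filter.Tendsto (fun n : ℕ => L / ((n : ℝ) + 1)) Filter.atTop (nhds 0) := by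
      simpa [div_eq_mul_inv] using (tendsto_one_div_add_atTop_nhds_zero_nat (𝕜 := ℝ)).const_mul L
    have h2 := ((((tendsto_const_nhds (x := initialEnergy m₀)).sub
      (tendsto_cutoff_energy hχ hg)).add ((h1.const_mul 6).mul_const B)).const_mul
        (1 + 2 * T)).div_const ((1 + 2 * T) * (stabilityConst M + 1))
    simpa using h2.mul_const (Real.exp ((1 + 2 * T) * (stabilityConst M + 1) * T) - 1)
  have hzero : ∀ k : ℕ, ∀ᵐ z ∂(volume.restrict (cylinder T k)), v z = u z := by
    intro k
    have i1 := qw.integrableOn_cylinder T k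
    have hle : ∫ z in cylinder T k, ‖v z - u z‖ ^ 2 ≤ 0 := by
      -- For a fixed cylinder the left side is below the bound at every scale n ≥ k, and these
      -- bounds tend to 0.
      refine ge_of_tendsto hlim ?_
      filter_upwards [Filter.eventually_ge_atTop k] with n hn
      refine le_trans ?_ (main n)
      calc ∫ z in cylinder T k, ‖v z - u z‖ ^ 2
          = ∫ z in cylinder T k, χ n z.2 * ‖v z - u z‖ ^ 2 := by
            refine setIntegral_congr_fun (measurableSet_cylinder T k) fun z hz => ?_
            have h1 : ‖z.2‖ ≤ k := by simpa using hz.2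
            have h2 : (k : ℝ) ≤ n := Nat.cast_le.2 hn
            simp [(hχ n).eq_one z.2 (by linarith)]
        _ ≤ _ := setIntegral_mono_set (qw.integrableOn_cutoff (hχ n) T)
            (Filter.Eventually.of_forall fun z => mul_nonneg ((hχ n).nonneg _) (sq_nonneg _))
            (cylinder_subset_slab T k).eventuallyLE
    have h0 := (integral_eq_zero_iff_of_nonneg (fun z => sq_nonneg _) i1).1
      (le_antisymm hle (integral_nonneg fun z => sq_nonneg _))
    filter_upwards [h0] with z hz
    simpa [sub_eq_zero] using hz
  have hU : slab T = ⋃ k : ℕ, cylinder T k := by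
    ext z
    simp only [slab, cylinder, mem_prod, mem_univ, and_true, mem_iUnion, Metric.mem_closedBall,
      dist_zero_right, exists_and_left]
    exact ⟨fun h => ⟨h, exists_nat_ge _⟩, fun h => h.1⟩
  rw [hU, ae_restrict_iUnion_iff]
  exact hzero

end LandauLifshitz
end

theorem theorem2p3
    (m₀ : LandauLifshitz.E3 → LandauLifshitz.E3)
    (hm₀_smooth : ContDiff ℝ ∞ m₀)
    (hm₀_norm : ∀ᵐ x, ‖m₀ x‖ = 1)
    (hm₀_grad : ∀ i, MemLp (fun x => fderiv ℝ m₀ x (LandauLifshitz.basisVec i)) 2 volume)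
    (m₂ m₂t : ℝ × LandauLifshitz.E3 → LandauLifshitz.E3)
    (m₂x : Fin 3 → ℝ × LandauLifshitz.E3 → LandauLifshitz.E3)
    (hm₂ : LandauLifshitz.IsGlobalWeakSolution m₀ m₂ m₂t m₂x)
    (hm₂_energy : LandauLifshitz.EnergyInequality m₀ m₂t m₂x)
    (T : ℝ) (hT : 0 < T)
    (m₁ : ℝ × LandauLifshitz.E3 → LandauLifshitz.E3)
    (hm₁ : LandauLifshitz.IsSmoothSolution T m₀ m₁) :
    ∀ᵐ z ∂(volume.restrict (LandauLifshitz.slab T)), m₂ z = m₁ z := by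
  -- Two continuous functions equal almost everywhere are equal everywhere.
  have hnorm : ∀ x, ‖m₀ x‖ = 1 := fun x => congrFun
    ((hm₀_smooth.continuous.norm.ae_eq_iff_eq (μ := volume) continuous_const).1 hm₀_norm) x
  -- The derivatives of `m₁` are bounded only up to times strictly less than T, so (0,T) is
  -- exhausted by countably many shorter intervals.
  obtain ⟨s, -, hs, hsT⟩ := exists_seq_strictMono_tendsto' hT
  have hU : LandauLifshitz.slab T = ⋃ n : ℕ, LandauLifshitz.slab (s n) := by
    ext z
    simp only [LandauLifshitz.slab, mem_prod, mem_univ, and_true, mem_iUnion, mem_Ioo,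
      exists_and_left]
    refine ⟨fun h => ⟨h.1, ?_⟩, fun ⟨h1, n, hn⟩ => ⟨h1, hn.trans (hs n).2⟩⟩
    exact (hsT.eventually (lt_mem_nhds h.2)).exists
  rw [hU, ae_restrict_iUnion_iff]
  intro n
  obtain ⟨u, hu, hum⟩ := hm₁.exists_truncation hnorm (hs n).1 (hs n).2
  filter_upwards [hu.ae_eq (hs n).1 hm₀_smooth hm₀_grad hm₂ hm₂_energy,
    ae_restrict_mem (LandauLifshitz.measurableSet_slab (s n))] with z hz hzs
  rw [hz, hum z hzs]
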